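/- **Theorem.** Fix the following setting. A bipartite graph $G=(U,V,E)$ consists of disjoint finite vertex sets $U,V$ and an edge set $E\subseteq U\times V$; write $e(G)=|E|$ and $n=|U\cup V|$. The *independence oracle* of $G$ tells for a set $S\subseteq U\cup V$ whether $S$ is an independent set of $G$, and the *adjacency oracle* of $G$ tells for $(u,v)\in U\times V$ whether $(u,v)\in E$. Running times are measured on the word-RAM with words of logarithmic size (at least a suitable constant times the logarithm of the input length, and large enough to hold the name of a vertex), whose programs may toss fair coins and query the two oracles; the set $S$ of an independence query is written in memory as a list of vertex names. We write $f(x)=\tilde O(g(x))$ if $f(x)=O((\log x)^c g(x))$ as $x\to\infty$ for some constant $c$. There is a randomised algorithm $\mathcal A$ with the following properties: 1. $\mathcal A$ is given as input two disjoint finite sets $U$ and $V$ (as arrays of vertex names) and a rational number $0<\varepsilon<1$ (by the binary digits of its numerator and denominator); 2. for some unknown bipartite graph $G=(U,V,E)$ with $n$ vertices, $\mathcal A$ has access to the independence oracle and to the adjacency oracle of $G$; 3. $\mathcal A$ always returns a rational number $x$, and $(1-\varepsilon)\,e(G)\le x\le(1+\varepsilon)\,e(G)$ holds with probability at least $\tfrac23$;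 4. $\mathcal A$ always runs in time at most $\varepsilon^{-4}\cdot f(n)$, for some function $f(n)=\tilde O(n)$; 5. $\mathcal A$ always makes at most $\varepsilon^{-2}\cdot h(n)$ calls to the independence oracle, for some function $h(n)=O((\log n)^6)$. The algorithm and the functions $f$, $h$ do not depend on $G$, $\varepsilon$ or the word size. -/

import Mathlib

open Asymptotics Filter

/-- A finite bipartite graph `G = (U, V, E)` with disjoint vertex classes `U`, `V` and edge set
`E ⊆ U × V`. Vertices are named by natural numbers. -/
structure BipGraph where
  U : Finset ℕ
  V : Finset ℕ
  E : Finset (ℕ × ℕ)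
  disjoint : Disjoint U V
  subset : E ⊆ U ×ˢ V

namespace BipGraph

/-- `n = |V(G)| = |U ∪ V|`. -/
def order (G : BipGraph) : ℕ := (G.U ∪ G.V).card

/-- `e(G)`, the number of edges. -/
def edgeCount (G : BipGraph) : ℕ := G.E.card

/-- `S` is an independent set: no edge has both of its endpoints in `S`. -/
def IsIndep (G : BipGraph) (S : Finset ℕ) : Prop := ∀ e ∈ G.E, ¬ (e.1 ∈ S ∧ e.2 ∈ S)

instance (G : BipGraph) (S : Finset ℕ) : Decidable (G.IsIndep S) := by
  unfold IsIndep; infer_instance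

/-- The independence oracle: `true` if and only if `S` is independent
(names in `S` that are not vertices are ignored). -/
def indepOracle (G : BipGraph) (S : Finset ℕ) : Bool := decide (G.IsIndep S)

/-- The adjacency oracle: `true` if and only if `(u, v) ∈ E`. -/
def adjOracle (G : BipGraph) (u v : ℕ) : Bool := decide ((u, v) ∈ G.E)

end BipGraph

/-- Soft-O: `f = Õ(g)` if `f = O((log x) ^ c * g)` as `x → ∞`, for some constant `c`. -/
def IsSoftO (f g : ℕ → ℝ) : Prop :=
  ∃ c : ℝ, f =O[atTop] fun x : ℕ => Real.log x ^ c * g x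

/-! ## A randomised word-RAM with oracles

Words are natural numbers below `2 ^ w`. There are registers and a random-access memory that is
addressed by words. Programs are written with structured control flow instead of jumps. -/

namespace WordRAM

/-- Arithmetic, bitwise and comparison operations on words. -/
inductive BinOp
  | add | sub | mul | div | mod | and | or | xor | shl | shr | eq | lt

/-- The value of an operation on words of `w` bits; arithmetic is modulo `2 ^ w`, quotients are
rounded down, and comparisons return `1` or `0`. -/
def BinOp.eval (w : ℕ) : BinOp → ℕ → ℕ → ℕ
  | .add, x, y => (x + y) % 2 ^ w
  | .sub, x, y => (x + (2 ^ w - y)) % 2 ^ w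
  | .mul, x, y => (x * y) % 2 ^ w
  | .div, x, y => (x / y) % 2 ^ w
  | .mod, x, y => (x % y) % 2 ^ w
  | .and, x, y => (x &&& y) % 2 ^ w
  | .or, x, y => (x ||| y) % 2 ^ w
  | .xor, x, y => (x ^^^ y) % 2 ^ w
  | .shl, x, y => (x <<< y) % 2 ^ w
  | .shr, x, y => (x >>> y) % 2 ^ w
  | .eq, x, y => (if x = y then 1 else 0) % 2 ^ w
  | .lt, x, y => (if x < y then 1 else 0) % 2 ^ w

/-- Programs. The arguments `d`, `a`, `b` are the indices of registers; below, `R[i]` is the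
content of register `i` and `M[x]` the content of the memory cell with address `x`. -/
inductive Prog
  /-- do nothing -/
  | skip
  /-- `R[d] := k` for a constant `k` of the program -/
  | const (d k : ℕ)
  /-- `R[d] := R[a]` -/
  | move (d a : ℕ)
  /-- `R[d] := R[a] o R[b]` -/
  | op (o : BinOp) (d a b : ℕ)
  /-- `R[d] := M[R[a]]` -/
  | load (d a : ℕ)
  /-- `M[R[a]] := R[b]` -/
  | store (a b : ℕ)
  /-- `R[d] :=` a fair random bit, independent of all others -/
  | toss (d : ℕ)
  /-- `R[d] :=` the answer of the adjacency oracle for the pair `(R[a], R[b])` -/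
  | adj (d a b : ℕ)
  /-- `R[d] :=` the answer of the independence oracle for the set of the `R[b]` names that are
  listed in memory from address `R[a]` on -/
  | indep (d a b : ℕ)
  /-- `p`, then `q` -/
  | seq (p q : Prog)
  /-- if `R[a] ≠ 0` then `p` else `q` -/
  | ite (a : ℕ) (p q : Prog)
  /-- while `R[a] ≠ 0` do `p` -/
  | loop (a : ℕ) (p : Prog)

/-- A configuration: the pieces of program that remain to be executed (in this order), registers,
memory, the time used so far and the number of calls to the independence oracle so far. -/
structure Config where
  todo : List Prog
  reg : ℕ → ℕ
  mem : ℕ → ℕ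
  time : ℕ
  indepCalls : ℕ

/-- The set of names listed in the `len` consecutive memory cells that start at address `x`. -/
def listedSet (w : ℕ) (mem : ℕ → ℕ) (x len : ℕ) : Finset ℕ :=
  (Finset.range len).image fun i => mem ((x + i) % 2 ^ w)

/-- The configuration that follows when the head of the to-do list (already removed in `c`) puts
the word `x` into register `d`, at unit cost. -/
def Config.put (c : Config) (d x : ℕ) : Config :=
  { c with reg := Function.update c.reg d x, time := c.time + 1 }

/-- One step on words of `w` bits, with adjacency oracle `A` and independence oracle `I`, where
`bit` is the outcome of the coin toss of this step (only `toss` looks at it). Every step takes unit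
time, except that an independence query about a list of `m` names takes time `m + 1`. A
configuration with nothing left to do has halted and does not change. -/
def stepWith (A : ℕ → ℕ → Bool) (I : Finset ℕ → Bool) (w : ℕ) (bit : Bool) (c : Config) :
    Config :=
  match c.todo with
  | [] => c
  | p :: rest =>
    let c' : Config := { c with todo := rest }
    match p with
    | .skip => { c' with time := c.time + 1 }
    | .const d k => c'.put d (k % 2 ^ w)
    | .move d a => c'.put d (c.reg a)
    | .op o d a b => c'.put d (o.eval w (c.reg a) (c.reg b))
    | .load d a => c'.put d (c.mem (c.reg a))
    | .store a b =>
        { c' with mem := Function.update c.mem (c.reg a) (c.reg b), time := c.time + 1 }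
    | .toss d => c'.put d (bit.toNat % 2 ^ w)
    | .adj d a b => c'.put d ((A (c.reg a) (c.reg b)).toNat % 2 ^ w)
    | .indep d a b =>
        { c' with
          reg := Function.update c.reg d
            ((I (listedSet w c.mem (c.reg a) (c.reg b))).toNat % 2 ^ w)
          time := c.time + (c.reg b + 1)
          indepCalls := c.indepCalls + 1 }
    | .seq p q => { c' with todo := p :: q :: rest, time := c.time + 1 }
    | .ite a p q =>
        { c' with todo := (if c.reg a ≠ 0 then p else q) :: rest, time := c.time + 1 }
    | .loop a p =>
        { c' with
          todo := if c.reg a ≠ 0 then p :: .loop a p :: rest else rest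
          time := c.time + 1 }

/-- The distribution of the next configuration. -/
noncomputable def step (A : ℕ → ℕ → Bool) (I : Finset ℕ → Bool) (w : ℕ) (c : Config) :
    PMF Config :=
  (PMF.uniformOfFintype Bool).map fun bit => stepWith A I w bit c

/-- The distribution of the configuration after `T` steps. -/
noncomputable def run (A : ℕ → ℕ → Bool) (I : Finset ℕ → Bool) (w : ℕ) :
    ℕ → Config → PMF Config
  | 0, c => PMF.pure c
  | T + 1, c => (step A I w c).bind (run A I w T)

/-- The program has halted. -/
def Config.Halted (c : Config) : Prop := c.todo = []

/-- The rational number that a halted program has computed: `R[0] / R[1]`. -/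
def Config.output (c : Config) : ℚ := (c.reg 0 : ℚ) / (c.reg 1 : ℚ)

/-- The input `U`, `V`, `ε` as an array: the names of the vertices of `U`, those of `V`, then the
binary digits (lowest first) of the numerator and of the denominator of `ε`, one per entry. -/
def inputArray (us vs : List ℕ) (ε : ℚ) : List ℕ :=
  us ++ vs ++ ε.num.natAbs.bits.map Bool.toNat ++ ε.den.bits.map Bool.toNat

/-- The start of program `P`: the input array is in memory from address `0` on, registers `0` to
`3` hold the lengths of its four parts, and all else is `0`. -/
def initial (P : Prog) (us vs : List ℕ) (ε : ℚ) : Config where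
  todo := [P]
  reg := fun i =>
    [us.length, vs.length, ε.num.natAbs.bits.length, ε.den.bits.length].getD i 0
  mem := fun x => (inputArray us vs ε).getD x 0
  time := 0
  indepCalls := 0

end WordRAM

/-! Let `len` be the number of binary digits of n. Every vertex receives, once and for all, a random
level: the number of leading heads among 2 `len` fair coins. Level at least s has probability 2^(-s)
for s ≤ 2 `len`, and levels of different vertices are independent, so thresholds on levels provide
samples at every dyadic rate. The same levels serve all samples; only linearity of expectation and a
union bound are used across them.

Suppose 2^g is a guess for e(G). Split U into classes by j = ⌊log₂ deg u⌋. In class j, sample U at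
rate about 2^(j + `kap` - g) (at most 1) and weight each sampled u by deg u times the inverse rate.
The sum is an unbiased estimate of e(G) (`ideal`), and since deg u < 2^(j+1) its variance is at most
e(G) 2^(g + 1 - `kap`), whatever the degrees are (`expect_ideal_sub_sq`). With 2^t of order 1/ε and
`kap` = 2t + 11, Chebyshev gives error below 2^g / 2^(t+2).

Sampled vertices of class j have to be found with few queries. Sample V at rate about 2^(`lam` - j).
A vertex of degree at least 2^j then expects about 2^`lam` > `len` + 4 sampled neighbours, so with
high probability no vertex is missed (`expect_missed`). The expected number of edges between the two
samples is at most e(G) 2^(`kap` + `lam` - g) (`expect_edgeHits`), so by Markov a budget `bud` of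
order `len` 2^(`kap` + `lam`) suffices once 2^g is at least of the order of e(G). List the V-sample
and then the U-sample in one array. Independence is inherited by subsets, so binary search finds the
longest independent prefix, and the next entry is a vertex of U with a sampled neighbour
(`exists_touches`). Its degree is counted with the adjacency oracle, and its entry is overwritten by
a member of the V-sample, which leaves the other vertices to be found unchanged (`roundsP_ends`).

Finally the guess. Let 2^m ≤ e(G) < 2^(m+1). With probability at least 13/16, all guesses g ≥ m are
accurate at once (`expect_penalty_le`): the failure bounds decay like 2^(-g), so they sum to a
constant. Accepting g when 2^g ≤ 2 · estimate, guess m is accepted and guesses from m + 3 on are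
rejected, so the last accepted guess lies in {m, m+1, m+2} and has relative error at most 2^(-t)
(`Good.accurate`). Guesses below m may exhaust their budget, but a later guess overrides them. If ε
is so small that t is capped at `len`, all rates on U are 1 and the estimate is exact.

Queries: 2 `len` guesses, `len` classes, `bud` rounds and `len` queries per search give O(`len`^5
ε^(-2)); each round takes time O(n `len`). The program is verified by a Hoare-style calculus for a
fixed coin sequence, and randomness enters only through uniformly random coin sequences
(`run_eq_map_tick`). -/

namespace WordRAM

/-! ## Deterministic semantics on a fixed sequence of coins -/

/-- Oracles, word size, and a sequence of outcomes of the coin tosses. -/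
structure Env where
  adj : ℕ → ℕ → Bool
  indep : Finset ℕ → Bool
  width : ℕ
  coin : ℕ → Bool

/-- Registers, memory, and the number of coins tossed so far. -/
structure St where
  reg : ℕ → ℕ
  mem : ℕ → ℕ
  tossed : ℕ

/-- Write the word `x` into register `d`. -/
def St.put (σ : St) (d x : ℕ) : St := { σ with reg := Function.update σ.reg d x }

/-- Programs without loops and without independence queries. -/
def Prog.simple : Prog → Bool
  | .indep _ _ _ => false
  | .seq p q => p.simple && q.simple
  | .ite _ p q => p.simple && q.simple
  | .loop _ _ => false
  | _ => true

/-- Single instructions other than independence queries. -/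
def Prog.atomic : Prog → Bool
  | .indep _ _ _ => false
  | .seq _ _ => false
  | .ite _ _ _ => false
  | .loop _ _ => false
  | _ => true

/-- The effect of a simple program. -/
def Env.act (e : Env) : Prog → St → St
  | .skip, σ => σ
  | .const d k, σ => σ.put d (k % 2 ^ e.width)
  | .move d a, σ => σ.put d (σ.reg a)
  | .op o d a b, σ => σ.put d (o.eval e.width (σ.reg a) (σ.reg b))
  | .load d a, σ => σ.put d (σ.mem (σ.reg a))
  | .store a b, σ => { σ with mem := Function.update σ.mem (σ.reg a) (σ.reg b) }
  | .toss d, σ =>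
      { σ with
        reg := Function.update σ.reg d ((e.coin σ.tossed).toNat % 2 ^ e.width)
        tossed := σ.tossed + 1 }
  | .adj d a b, σ => σ.put d ((e.adj (σ.reg a) (σ.reg b)).toNat % 2 ^ e.width)
  | .indep _ _ _, σ => σ
  | .seq p q, σ => e.act q (e.act p σ)
  | .ite a p q, σ => if σ.reg a ≠ 0 then e.act p σ else e.act q σ
  | .loop _ _, σ => σ

/-- An upper bound for the running time of a simple program. -/
def Prog.cost : Prog → ℕ
  | .seq p q => p.cost + q.cost + 1
  | .ite _ p q => max p.cost q.cost + 1
  | _ => 1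

/-- `Exec e p σ σ' t q`: program `p` started in `σ` ends in `σ'`, in time `t` and with `q`
independence queries. -/
inductive Exec (e : Env) : Prog → St → St → ℕ → ℕ → Prop
  | atom {p σ} : p.atomic = true → Exec e p σ (e.act p σ) 1 0
  | indep {d a b σ} : Exec e (.indep d a b) σ
      (σ.put d ((e.indep (listedSet e.width σ.mem (σ.reg a) (σ.reg b))).toNat % 2 ^ e.width))
      (σ.reg b + 1) 1
  | seq {p r σ σ₁ σ₂ t₁ t₂ q₁ q₂} : Exec e p σ σ₁ t₁ q₁ → Exec e r σ₁ σ₂ t₂ q₂ →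
      Exec e (.seq p r) σ σ₂ (t₁ + t₂ + 1) (q₁ + q₂)
  | ite_pos {a p r σ σ' t q} : σ.reg a ≠ 0 → Exec e p σ σ' t q →
      Exec e (.ite a p r) σ σ' (t + 1) q
  | ite_neg {a p r σ σ' t q} : σ.reg a = 0 → Exec e r σ σ' t q →
      Exec e (.ite a p r) σ σ' (t + 1) q
  | loop_exit {a p σ} : σ.reg a = 0 → Exec e (.loop a p) σ σ 1 0
  | loop_next {a p σ σ₁ σ₂ t₁ t₂ q₁ q₂} : σ.reg a ≠ 0 → Exec e p σ σ₁ t₁ q₁ →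
      Exec e (.loop a p) σ₁ σ₂ t₂ q₂ → Exec e (.loop a p) σ σ₂ (t₁ + t₂ + 1) (q₁ + q₂)

/-- The next step of a configuration tosses a coin. -/
def Config.tossNext (c : Config) : Bool :=
  match c.todo with
  | .toss _ :: _ => true
  | _ => false

/-- One step on a fixed sequence of coins; the second component counts the coins used. -/
def Env.tick (e : Env) (x : Config × ℕ) : Config × ℕ :=
  (stepWith e.adj e.indep e.width (e.coin x.2) x.1, if x.1.tossNext then x.2 + 1 else x.2)

/-- Every step costs at least one unit of time, so the number of steps is at most the time. The
arbitrary `rest`, time and call count make the claim compose in the induction. -/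
theorem Exec.reaches {e : Env} {p : Prog} {σ σ' : St} {t q : ℕ} (h : Exec e p σ σ' t q) :
    ∀ rest time calls, ∃ T ≤ t,
      e.tick^[T] (⟨p :: rest, σ.reg, σ.mem, time, calls⟩, σ.tossed) =
        (⟨rest, σ'.reg, σ'.mem, time + t, calls + q⟩, σ'.tossed) := by
  induction h with
  | @atom p σ h =>
    intro rest time calls
    refine ⟨1, le_rfl, ?_⟩
    cases p <;> simp_all [Env.tick, stepWith, Config.tossNext, Env.act, St.put, Config.put,
      Prog.atomic]
  | indep =>
    intro rest time calls
    exact ⟨1, by omega, by simp [Env.tick, stepWith, Config.tossNext, St.put]⟩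
  | @seq p r σ σ₁ σ₂ t₁ t₂ q₁ q₂ _ _ ih₁ ih₂ =>
    intro rest time calls
    obtain ⟨T₁, h₁, e₁⟩ := ih₁ (r :: rest) (time + 1) calls
    obtain ⟨T₂, h₂, e₂⟩ := ih₂ rest (time + 1 + t₁) (calls + q₁)
    refine ⟨T₂ + (T₁ + 1), by omega, ?_⟩
    rw [Function.iterate_add_apply, Function.iterate_succ_apply]
    have : e.tick (⟨.seq p r :: rest, σ.reg, σ.mem, time, calls⟩, σ.tossed) =
        (⟨p :: r :: rest, σ.reg, σ.mem, time + 1, calls⟩, σ.tossed) := by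
      simp [Env.tick, stepWith, Config.tossNext]
    rw [this, e₁, e₂]
    simp only [Prod.mk.injEq, Config.mk.injEq, true_and, and_true]
    omega
  | @ite_pos a p r σ σ' t q h _ ih =>
    intro rest time calls
    obtain ⟨T, h₁, e₁⟩ := ih rest (time + 1) calls
    refine ⟨T + 1, by omega, ?_⟩
    rw [Function.iterate_succ_apply]
    have : e.tick (⟨.ite a p r :: rest, σ.reg, σ.mem, time, calls⟩, σ.tossed) =
        (⟨p :: rest, σ.reg, σ.mem, time + 1, calls⟩, σ.tossed) := by
      simp [Env.tick, stepWith, Config.tossNext, h]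
    rw [this, e₁]
    simp only [Prod.mk.injEq, Config.mk.injEq, true_and, and_true]
    omega
  | @ite_neg a p r σ σ' t q h _ ih =>
    intro rest time calls
    obtain ⟨T, h₁, e₁⟩ := ih rest (time + 1) calls
    refine ⟨T + 1, by omega, ?_⟩
    rw [Function.iterate_succ_apply]
    have : e.tick (⟨.ite a p r :: rest, σ.reg, σ.mem, time, calls⟩, σ.tossed) =
        (⟨r :: rest, σ.reg, σ.mem, time + 1, calls⟩, σ.tossed) := by
      simp [Env.tick, stepWith, Config.tossNext, h]
    rw [this, e₁]
    simp only [Prod.mk.injEq, Config.mk.injEq, true_and, and_true]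
    omega
  | loop_exit h =>
    intro rest time calls
    exact ⟨1, le_rfl, by simp [Env.tick, stepWith, Config.tossNext, h]⟩
  | @loop_next a p σ σ₁ σ₂ t₁ t₂ q₁ q₂ h _ _ ih₁ ih₂ =>
    intro rest time calls
    obtain ⟨T₁, h₁, e₁⟩ := ih₁ (.loop a p :: rest) (time + 1) calls
    obtain ⟨T₂, h₂, e₂⟩ := ih₂ rest (time + 1 + t₁) (calls + q₁)
    refine ⟨T₂ + (T₁ + 1), by omega, ?_⟩
    rw [Function.iterate_add_apply, Function.iterate_succ_apply]
    have : e.tick (⟨.loop a p :: rest, σ.reg, σ.mem, time, calls⟩, σ.tossed) =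
        (⟨p :: .loop a p :: rest, σ.reg, σ.mem, time + 1, calls⟩, σ.tossed) := by
      simp [Env.tick, stepWith, Config.tossNext, h]
    rw [this, e₁, e₂]
    simp only [Prod.mk.injEq, Config.mk.injEq, true_and, and_true]
    omega

theorem Env.tick_halted (e : Env) {c : Config} (h : c.todo = []) (i : ℕ) :
    e.tick (c, i) = (c, i) := by
  simp [Env.tick, stepWith, Config.tossNext, h]

/-- A program that ends within time `t` has halted after any `T ≥ t` steps. -/
theorem Exec.halts {e : Env} {p : Prog} {σ σ' : St} {t q T : ℕ} (h : Exec e p σ σ' t q)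
    (hT : t ≤ T) :
    e.tick^[T] (⟨[p], σ.reg, σ.mem, 0, 0⟩, σ.tossed) =
      (⟨[], σ'.reg, σ'.mem, t, q⟩, σ'.tossed) := by
  obtain ⟨T₀, h₀, e₀⟩ := h.reaches [] 0 0
  obtain ⟨k, rfl⟩ := Nat.exists_eq_add_of_le' (h₀.trans hT)
  rw [Function.iterate_add_apply, e₀, Nat.zero_add, Nat.zero_add]
  exact Function.iterate_fixed (e.tick_halted rfl _) k

/-! ## Random runs as deterministic runs on random coins -/

/-- A finite sequence of coins, continued by `false`. -/
def extend {N : ℕ} (b : Fin N → Bool) (k : ℕ) : Bool := if h : k < N then b ⟨k, h⟩ else false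

theorem extend_cons_zero {N : ℕ} (x : Bool) (b : Fin N → Bool) :
    extend (Fin.cons x b : Fin (N + 1) → Bool) 0 = x := by
  simp [extend]

theorem extend_cons_succ {N : ℕ} (x : Bool) (b : Fin N → Bool) (k : ℕ) :
    extend (Fin.cons x b : Fin (N + 1) → Bool) (k + 1) = extend b k := by
  by_cases h : k < N
  · rw [extend, extend, dif_pos (Nat.succ_lt_succ h), dif_pos h]
    exact Fin.cons_succ (α := fun _ => Bool) x b ⟨k, h⟩
  · simp [extend, h]

theorem uniform_cons (N : ℕ) :
    PMF.uniformOfFintype (Fin (N + 1) → Bool) =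
      (PMF.uniformOfFintype Bool).bind fun x =>
        (PMF.uniformOfFintype (Fin N → Bool)).map fun b => (Fin.cons x b : Fin (N + 1) → Bool) := by
  ext f
  rw [PMF.bind_apply, tsum_bool]
  have key : ∀ x : Bool, ((PMF.uniformOfFintype (Fin N → Bool)).map
      fun b => (Fin.cons x b : Fin (N + 1) → Bool)) f =
        if f 0 = x then ((2 : ENNReal) ^ N)⁻¹ else 0 := by
    intro x
    rw [PMF.map_apply, tsum_eq_single (Fin.tail f)]
    · by_cases h : f 0 = x
      · subst h; simp
      · rw [if_neg, if_neg h]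
        intro h'
        exact h (by rw [h']; simp)
    · intro b hb
      rw [if_neg]
      rintro rfl
      exact hb (by simp)
  rw [key, key]
  have h2 : ((2 : ENNReal) ^ (N + 1))⁻¹ = 2⁻¹ * (2 ^ N)⁻¹ := by
    rw [pow_succ', ENNReal.mul_inv (by simp) (by simp)]
  rw [PMF.uniformOfFintype_apply, PMF.uniformOfFintype_apply, PMF.uniformOfFintype_apply,
    Fintype.card_fun, Fintype.card_bool, Fintype.card_fin]
  push_cast
  rw [h2]
  cases f 0 <;> simp

/-- The configuration after `T` steps, on a sequence of coins that is used up from the front. -/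
def runOn (A : ℕ → ℕ → Bool) (I : Finset ℕ → Bool) (w : ℕ) :
    ℕ → Config → (ℕ → Bool) → Config
  | 0, c, _ => c
  | T + 1, c, s => runOn A I w T (stepWith A I w (s 0) c)
      (if c.tossNext then fun k => s (k + 1) else s)

theorem Env.iterate_tick (e : Env) (T : ℕ) (c : Config) (i : ℕ) :
    (e.tick^[T] (c, i)).1 = runOn e.adj e.indep e.width T c (fun k => e.coin (i + k)) := by
  induction T generalizing c i with
  | zero => rfl
  | succ T ih =>
    rw [Function.iterate_succ_apply, runOn, Env.tick]
    by_cases h : c.tossNext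
    · simp only [h, if_true, ih, Nat.add_zero]
      congr 1
      funext k
      rw [Nat.add_assoc, Nat.add_comm 1 k]
    · simp only [h, ih, Nat.add_zero, Bool.false_eq_true, if_false]

theorem stepWith_eq_of_not_tossNext {A : ℕ → ℕ → Bool} {I : Finset ℕ → Bool} {w : ℕ} {c : Config}
    (h : ¬ c.tossNext) (b b' : Bool) : stepWith A I w b c = stepWith A I w b' c := by
  obtain ⟨todo, reg, mem, time, calls⟩ := c
  match todo with
  | [] => rfl
  | p :: rest => cases p <;> simp_all [stepWith, Config.tossNext]

/-- A step uses at most one coin, so any N ≥ T coins suffice. The slack in N is needed because a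
step without a toss leaves the front coin for later steps. -/
theorem run_eq_map_runOn (A : ℕ → ℕ → Bool) (I : Finset ℕ → Bool) (w : ℕ) (T N : ℕ) (h : T ≤ N)
    (c : Config) :
    run A I w T c =
      (PMF.uniformOfFintype (Fin N → Bool)).map fun b => runOn A I w T c (extend b) := by
  induction T generalizing c N with
  | zero => simp [run, runOn, PMF.map_const, Function.const_def]
  | succ T ih =>
    by_cases hc : c.tossNext
    · obtain ⟨N, rfl⟩ := Nat.exists_eq_add_of_le' (Nat.one_le_of_lt h)
      rw [uniform_cons, PMF.map_bind, run, step, PMF.bind_map]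
      congr 1
      funext x
      rw [Function.comp_apply, ih N (by omega), PMF.map_comp]
      congr 1
      funext b
      simp [runOn, hc, extend_cons_zero, extend_cons_succ]
    · have : step A I w c = PMF.pure (stepWith A I w false c) := by
        rw [step, ← PMF.map_const (PMF.uniformOfFintype Bool)]
        congr 1
        funext b
        exact stepWith_eq_of_not_tossNext hc _ _
      rw [run, this, PMF.pure_bind, ih N (by omega)]
      congr 1
      funext b
      rw [runOn, if_neg hc, stepWith_eq_of_not_tossNext hc (extend b 0) false]

/-- All probabilities reduce to counting coin sequences: the rest of the program analysis fixes the
coins. -/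
theorem run_eq_map_tick (A : ℕ → ℕ → Bool) (I : Finset ℕ → Bool) (w : ℕ) (T : ℕ) (c : Config) :
    run A I w T c =
      (PMF.uniformOfFintype (Fin T → Bool)).map fun b =>
        ((⟨A, I, w, extend b⟩ : Env).tick^[T] (c, 0)).1 := by
  rw [run_eq_map_runOn A I w T T le_rfl]
  congr 1
  funext b
  rw [Env.iterate_tick]
  simp

/-! ## Program logic -/

/-- Program `p` started in `σ` ends within time `t`, with at most `q` independence queries, in a
state that satisfies `Q`. -/
def Ends (e : Env) (p : Prog) (σ : St) (t q : ℕ) (Q : St → Prop) : Prop :=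
  ∃ σ' t' q', Exec e p σ σ' t' q' ∧ t' ≤ t ∧ q' ≤ q ∧ Q σ'

namespace Ends

variable {e : Env} {p r : Prog} {σ : St} {t t₁ t₂ q q₁ q₂ : ℕ} {Q Q' : St → Prop}

theorem mono (h : Ends e p σ t₁ q₁ Q) (ht : t₁ ≤ t) (hq : q₁ ≤ q) (hQ : ∀ σ', Q σ' → Q' σ') :
    Ends e p σ t q Q' := by
  obtain ⟨σ', t', q', h, h₁, h₂, h₃⟩ := h
  exact ⟨σ', t', q', h, h₁.trans ht, h₂.trans hq, hQ _ h₃⟩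

/-- The postcondition of the first part is the claim about the second, so a proof follows the
program text from left to right. -/
theorem seq (h : Ends e p σ t₁ q₁ fun σ' => Ends e r σ' t₂ q₂ Q)
    (ht : t₁ + t₂ + 1 ≤ t := by omega) (hq : q₁ + q₂ ≤ q := by omega) :
    Ends e (.seq p r) σ t q Q := by
  obtain ⟨σ₁, t₁', q₁', h₁, _, _, σ₂, t₂', q₂', h₂, _, _, hQ⟩ := h
  exact ⟨σ₂, _, _, h₁.seq h₂, by omega, by omega, hQ⟩

/-- Straight-line code is verified by evaluating `act`, and branches cost at most the maximum, so no
intermediate assertions are needed. -/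
theorem simple (hp : p.simple = true) (hQ : Q (e.act p σ)) (ht : p.cost ≤ t := by decide) :
    Ends e p σ t q Q := by
  suffices h : ∃ t' ≤ p.cost, Exec e p σ (e.act p σ) t' 0 by
    obtain ⟨t', h', h⟩ := h
    exact ⟨_, _, _, h, h'.trans ht, Nat.zero_le _, hQ⟩
  clear hQ ht
  induction p generalizing σ with
  | seq p r ihp ihr =>
    simp only [Prog.simple, Bool.and_eq_true] at hp
    obtain ⟨t₁, h₁, e₁⟩ := ihp (σ := σ) hp.1
    obtain ⟨t₂, h₂, e₂⟩ := ihr (σ := e.act p σ) hp.2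
    exact ⟨_, by simp only [Prog.cost]; omega, e₁.seq e₂⟩
  | ite a p r ihp ihr =>
    simp only [Prog.simple, Bool.and_eq_true] at hp
    by_cases h : σ.reg a = 0
    · obtain ⟨t₂, h₂, e₂⟩ := ihr (σ := σ) hp.2
      have : e.act (.ite a p r) σ = e.act r σ := by simp [Env.act, h]
      exact ⟨t₂ + 1, by simp only [Prog.cost]; omega, this ▸ Exec.ite_neg h e₂⟩
    · obtain ⟨t₁, h₁, e₁⟩ := ihp (σ := σ) hp.1
      have : e.act (.ite a p r) σ = e.act p σ := by simp [Env.act, h]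
      exact ⟨t₁ + 1, by simp only [Prog.cost]; omega, this ▸ Exec.ite_pos h e₁⟩
  | indep => simp [Prog.simple] at hp
  | loop => simp [Prog.simple] at hp
  | _ => exact ⟨1, le_rfl, Exec.atom rfl⟩

theorem indep {d a b : ℕ} (hQ : Q (σ.put d
      ((e.indep (listedSet e.width σ.mem (σ.reg a) (σ.reg b))).toNat % 2 ^ e.width)))
    (ht : σ.reg b + 1 ≤ t := by omega) (hq : 1 ≤ q := by omega) :
    Ends e (.indep d a b) σ t q Q :=
  ⟨_, _, _, .indep, ht, hq, hQ⟩

theorem ite {a : ℕ} (hp : σ.reg a ≠ 0 → Ends e p σ t₁ q Q) (hr : σ.reg a = 0 → Ends e r σ t₁ q Q)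
    (ht : t₁ + 1 ≤ t := by omega) : Ends e (.ite a p r) σ t q Q := by
  by_cases h : σ.reg a = 0
  · obtain ⟨σ', t', q', h₁, _, h₂, hQ⟩ := hr h
    exact ⟨σ', _, _, h₁.ite_neg h, by omega, h₂, hQ⟩
  · obtain ⟨σ', t', q', h₁, _, h₂, hQ⟩ := hp h
    exact ⟨σ', _, _, h₁.ite_pos h, by omega, h₂, hQ⟩

/-- `J k` is an invariant that holds when `k` more rounds are to come. -/
theorem loop {a : ℕ} (J : ℕ → St → Prop) (h0 : ∀ σ, J 0 σ → σ.reg a = 0)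
    (hs : ∀ k σ, J (k + 1) σ → σ.reg a ≠ 0 ∧ Ends e p σ t₁ q₁ (J k)) (k : ℕ) (hJ : J k σ)
    (ht : k * (t₁ + 1) + 1 ≤ t := by omega) (hq : k * q₁ ≤ q := by omega) :
    Ends e (.loop a p) σ t q (J 0) := by
  suffices h : Ends e (.loop a p) σ (k * (t₁ + 1) + 1) (k * q₁) (J 0) from
    h.mono ht hq fun _ => id
  clear ht hq
  induction k generalizing σ with
  | zero => exact ⟨σ, _, _, .loop_exit (h0 σ hJ), by simp, by simp, hJ⟩
  | succ k ih =>
    obtain ⟨hne, σ₁, t', q', h₁, _, _, hJ₁⟩ := hs k σ hJ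
    obtain ⟨σ₂, t'', q'', h₂, _, _, hJ₂⟩ := ih hJ₁
    refine ⟨σ₂, _, _, .loop_next hne h₁ h₂, ?_, ?_, hJ₂⟩ <;> rw [Nat.succ_mul] <;> omega

end Ends

/-- The registers that a program may write. -/
def Prog.writes : Prog → List ℕ
  | .skip => []
  | .const d _ => [d]
  | .move d _ => [d]
  | .op _ d _ _ => [d]
  | .load d _ => [d]
  | .store _ _ => []
  | .toss d => [d]
  | .adj d _ _ => [d]
  | .indep d _ _ => [d]
  | .seq p q => p.writes ++ q.writes
  | .ite _ p q => p.writes ++ q.writes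
  | .loop _ p => p.writes

/-- The program contains no `store`. -/
def Prog.storeFree : Prog → Bool
  | .store _ _ => false
  | .seq p q => p.storeFree && q.storeFree
  | .ite _ p q => p.storeFree && q.storeFree
  | .loop _ p => p.storeFree
  | _ => true

theorem Exec.reg_eq {e : Env} {p : Prog} {σ σ' : St} {t q : ℕ} (h : Exec e p σ σ' t q) {i : ℕ}
    (hi : i ∉ p.writes) : σ'.reg i = σ.reg i := by
  induction h with
  | @atom p σ h =>
    cases p <;> simp_all [Prog.atomic, Prog.writes, Env.act, St.put]
  | indep => simp_all [Prog.writes, St.put]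
  | seq _ _ ih₁ ih₂ =>
    simp only [Prog.writes, List.mem_append, not_or] at hi
    rw [ih₂ hi.2, ih₁ hi.1]
  | ite_pos _ _ ih => simp only [Prog.writes, List.mem_append, not_or] at hi; exact ih hi.1
  | ite_neg _ _ ih => simp only [Prog.writes, List.mem_append, not_or] at hi; exact ih hi.2
  | loop_exit _ => rfl
  | loop_next _ _ _ ih₁ ih₂ => rw [ih₂ hi, ih₁ hi]

theorem Exec.mem_eq {e : Env} {p : Prog} {σ σ' : St} {t q : ℕ} (h : Exec e p σ σ' t q)
    (hp : p.storeFree = true) : σ'.mem = σ.mem := by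
  induction h with
  | @atom p σ h =>
    cases p <;> simp_all [Prog.atomic, Prog.storeFree, Env.act, St.put]
  | indep => simp [St.put]
  | seq _ _ ih₁ ih₂ =>
    simp only [Prog.storeFree, Bool.and_eq_true] at hp
    rw [ih₂ hp.2, ih₁ hp.1]
  | ite_pos _ _ ih => simp only [Prog.storeFree, Bool.and_eq_true] at hp; exact ih hp.1
  | ite_neg _ _ ih => simp only [Prog.storeFree, Bool.and_eq_true] at hp; exact ih hp.2
  | loop_exit _ => rfl
  | loop_next _ _ _ ih₁ ih₂ => rw [ih₂ hp, ih₁ hp]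

/-- Registers that a program does not write keep their contents. -/
theorem Ends.frame {e : Env} {p : Prog} {σ : St} {t q : ℕ} {Q : St → Prop}
    (h : Ends e p σ t q Q) :
    Ends e p σ t q fun σ' => Q σ' ∧ ∀ i ∉ p.writes, σ'.reg i = σ.reg i := by
  obtain ⟨σ', t', q', h, h₁, h₂, hQ⟩ := h
  exact ⟨σ', t', q', h, h₁, h₂, hQ, fun i => h.reg_eq⟩

/-- A program without `store` leaves the memory as it is. -/
theorem Ends.frame_mem {e : Env} {p : Prog} {σ : St} {t q : ℕ} {Q : St → Prop}
    (h : Ends e p σ t q Q) (hp : p.storeFree = true) :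
    Ends e p σ t q fun σ' => Q σ' ∧ σ'.mem = σ.mem := by
  obtain ⟨σ', t', q', h, h₁, h₂, hQ⟩ := h
  exact ⟨σ', t', q', h, h₁, h₂, hQ, h.mem_eq hp⟩

/-- Run the programs of a list one after the other. -/
def block : List Prog → Prog
  | [] => .skip
  | [p] => p
  | p :: l => .seq p (block l)

/-! ## Arithmetic without overflow -/

namespace BinOp

variable {w x y : ℕ}

theorem eval_add (h : x + y < 2 ^ w) : BinOp.add.eval w x y = x + y := Nat.mod_eq_of_lt h

theorem eval_mul (h : x * y < 2 ^ w) : BinOp.mul.eval w x y = x * y := Nat.mod_eq_of_lt h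

theorem eval_sub (h : y ≤ x) (hx : x < 2 ^ w) : BinOp.sub.eval w x y = x - y := by
  rw [BinOp.eval, ← Nat.add_sub_assoc (h.trans hx.le), Nat.add_comm, Nat.add_sub_assoc h,
    Nat.add_mod_left, Nat.mod_eq_of_lt (by omega)]

theorem eval_lt (h : 1 < 2 ^ w) : BinOp.lt.eval w x y = if x < y then 1 else 0 := by
  rw [BinOp.eval]
  split_ifs
  exacts [Nat.mod_eq_of_lt h, Nat.zero_mod _]

theorem eval_eq (h : 1 < 2 ^ w) : BinOp.eq.eval w x y = if x = y then 1 else 0 := by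
  rw [BinOp.eval]
  split_ifs
  exacts [Nat.mod_eq_of_lt h, Nat.zero_mod _]

theorem eval_shl (h : x * 2 ^ y < 2 ^ w) : BinOp.shl.eval w x y = x * 2 ^ y := by
  rw [BinOp.eval, Nat.shiftLeft_eq, Nat.mod_eq_of_lt h]

theorem eval_shr (h : x < 2 ^ w) : BinOp.shr.eval w x y = x / 2 ^ y := by
  rw [BinOp.eval, Nat.shiftRight_eq_div_pow, Nat.mod_eq_of_lt ((Nat.div_le_self _ _).trans_lt h)]

end BinOp

/-! ## Arrays in memory -/

/-- The list `l` is stored in memory from address `a` on. -/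
def Holds (mem : ℕ → ℕ) (a : ℕ) (l : List ℕ) : Prop := ∀ i (h : i < l.length), mem (a + i) = l[i]

namespace Holds

variable {mem mem' : ℕ → ℕ} {a x : ℕ} {l l₁ l₂ : List ℕ}

theorem nil : Holds mem a [] := fun i h => absurd h (Nat.not_lt_zero i)

theorem append : Holds mem a (l₁ ++ l₂) ↔ Holds mem a l₁ ∧ Holds mem (a + l₁.length) l₂ := by
  constructor
  · intro h
    refine ⟨fun i hi => ?_, fun i hi => ?_⟩
    · rw [h i (by simp; omega), List.getElem_append_left hi]
    · rw [Nat.add_assoc, h (l₁.length + i) (by simp; omega), List.getElem_append_right (by omega)]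
      simp
  · rintro ⟨h₁, h₂⟩ i hi
    by_cases h : i < l₁.length
    · rw [h₁ i h, List.getElem_append_left h]
    · have := h₂ (i - l₁.length) (by simp at hi; omega)
      rw [List.getElem_append_right (by omega), ← this]
      congr 1
      omega

theorem singleton : Holds mem a [x] ↔ mem a = x := by
  constructor
  · intro h
    simpa using h 0 (by simp)
  · intro h i hi
    obtain rfl : i = 0 := by simpa using hi
    simpa using h

theorem cons : Holds mem a (x :: l) ↔ mem a = x ∧ Holds mem (a + 1) l := by
  rw [← List.singleton_append, append, singleton, List.length_singleton]

theorem congr (h : Holds mem a l) (hm : ∀ x, a ≤ x → x < a + l.length → mem' x = mem x) :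
    Holds mem' a l := fun i hi => by rw [hm _ (by omega) (by omega), h i hi]

/-- The array ends within the address space, so the addresses of an independence query never wrap
around. -/
theorem listedSet_eq {w : ℕ} (h : Holds mem a l) (hw : a + l.length ≤ 2 ^ w) :
    listedSet w mem a l.length = l.toFinset := by
  ext x
  simp only [listedSet, Finset.mem_image, Finset.mem_range, List.mem_toFinset]
  constructor
  · rintro ⟨i, hi, rfl⟩
    rw [Nat.mod_eq_of_lt (by omega), h i hi]
    exact List.getElem_mem hi
  · intro hx
    obtain ⟨i, hi, rfl⟩ := List.getElem_of_mem hx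
    exact ⟨i, hi, by rw [Nat.mod_eq_of_lt (by omega), h i hi]⟩

theorem take (h : Holds mem a l) (k : ℕ) : Holds mem a (l.take k) := by
  rw [← List.take_append_drop k l, append] at h
  exact h.1

end Holds

/-! ## Program fragments

Register `4` holds the constant `1` throughout. -/

/-- `R[31] :=` number of binary digits of `R[30]`. -/
def sizeP : Prog :=
  .seq (.const 31 0) (.loop 30 (.seq (.op .add 31 31 4) (.op .shr 30 30 4)))

theorem sizeP_ends {e : Env} {σ : St} {x : ℕ} (hx : x < 2 ^ e.width) (h1 : σ.reg 4 = 1)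
    (h30 : σ.reg 30 = x) :
    Ends e sizeP σ (4 * x.size + 3) 0 fun σ' =>
      σ'.reg 31 = x.size ∧ σ'.mem = σ.mem ∧ σ'.tossed = σ.tossed := by
  have hxw : x.size < 2 ^ e.width := (Nat.size_le.2 hx).trans_lt Nat.lt_two_pow_self
  refine Ends.seq (t₁ := 1) (t₂ := 4 * x.size + 1) (q₁ := 0) (q₂ := 0)
    (Ends.simple rfl ?_)
  refine (Ends.loop (t₁ := 3) (q₁ := 0) (fun k τ => τ.reg 4 = 1 ∧ (τ.reg 30).size = k ∧
    τ.reg 30 < 2 ^ e.width ∧ τ.reg 31 + k = x.size ∧ τ.mem = σ.mem ∧ τ.tossed = σ.tossed)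
    ?_ ?_ x.size ?_).mono le_rfl le_rfl ?_
  · rintro τ ⟨-, h, -⟩
    exact Nat.size_eq_zero.1 h
  · rintro k τ ⟨t4, t30, tlt, t31, tm, tt⟩
    have hne : τ.reg 30 ≠ 0 := by
      rintro h
      simp [h] at t30
    refine ⟨hne, Ends.simple rfl ?_⟩
    -- Halving removes exactly one binary digit, so the size counts the remaining rounds.
    have hs : (τ.reg 30 / 2).size = k := by
      have := Nat.size_bit (b := (τ.reg 30).bodd) (n := τ.reg 30 / 2)
      rw [← Nat.div2_val, Nat.bit_bodd_div2] at this
      have := this hne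
      rw [← Nat.div2_val]
      omega
    simp [Env.act, St.put, t4, BinOp.eval_shr tlt, BinOp.eval_add (w := e.width) (x := τ.reg 31)
      (y := 1) (by omega), hs, tm, tt]
    exact ⟨(Nat.div_le_self _ _).trans_lt tlt, by omega⟩
  · simp [Env.act, St.put, h1, h30, hx]
  · rintro τ ⟨-, -, -, h, h', h''⟩
    exact ⟨h, h', h''⟩

/-- `R[29] :=` number of neighbours of `R[28]` among the `R[1]` vertices listed from address `R[0]`
on. -/
def degP : Prog :=
  .seq (block [.const 29 0, .move 30 0, .move 31 1])
    (.loop 31 (block [.load 32 30, .adj 32 28 32, .op .add 29 29 32, .op .add 30 30 4,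
      .op .sub 31 31 4]))

theorem degP_ends {e : Env} {σ : St} {a u : ℕ} {l : List ℕ} (hl : a + l.length < 2 ^ e.width)
    (hw : 1 < 2 ^ e.width)
    (hm : Holds σ.mem a l) (h1 : σ.reg 4 = 1) (h0 : σ.reg 0 = a) (hlen : σ.reg 1 = l.length)
    (hu : σ.reg 28 = u) :
    Ends e degP σ (10 * l.length + 7) 0 fun σ' =>
      σ'.reg 29 = l.countP (e.adj u) := by
  refine Ends.seq (t₁ := 5) (t₂ := 10 * l.length + 1) (q₁ := 0) (q₂ := 0) (Ends.simple rfl ?_)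
  refine (Ends.loop (t₁ := 9) (q₁ := 0) (fun k τ => ∃ l₁ l₂, l = l₁ ++ l₂ ∧ l₂.length = k ∧
    τ.reg 4 = 1 ∧ τ.reg 28 = u ∧ τ.reg 29 = l₁.countP (e.adj u) ∧ τ.reg 30 = a + l₁.length ∧
    τ.reg 31 = k ∧ τ.mem = σ.mem) ?_ ?_ l.length ?_).mono le_rfl le_rfl ?_
  · rintro τ ⟨l₁, l₂, -, -, -, -, -, -, h, -⟩
    exact h
  · rintro k τ ⟨l₁, l₂, rfl, hk, t4, t28, t29, t30, t31, tm⟩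
    obtain ⟨v, l₂, rfl⟩ : ∃ v l', l₂ = v :: l' := by
      cases l₂ with
      | nil => simp at hk
      | cons v l' => exact ⟨v, l', rfl⟩
    refine ⟨by omega, Ends.simple rfl ⟨l₁ ++ [v], l₂, by simp, by simpa using hk, ?_⟩⟩
    have hv : σ.mem (a + l₁.length) = v := (Holds.cons.1 (Holds.append.1 hm).2).1
    have hc := List.countP_le_length (p := e.adj u) (l := l₁)
    simp only [List.length_append, List.length_cons] at hl hk
    have e1 : BinOp.add.eval e.width (l₁.countP (e.adj u)) (e.adj u v).toNat =
        l₁.countP (e.adj u) + (e.adj u v).toNat :=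
      BinOp.eval_add (by have := Bool.toNat_le (e.adj u v); omega)
    have e2 : (e.adj u v).toNat % 2 ^ e.width = (e.adj u v).toNat :=
      Nat.mod_eq_of_lt (by have := Bool.toNat_le (e.adj u v); omega)
    have e3 : BinOp.add.eval e.width (a + l₁.length) 1 = a + l₁.length + 1 :=
      BinOp.eval_add (by omega)
    have e4 : BinOp.sub.eval e.width (k + 1) 1 = k := by
      rw [BinOp.eval_sub (by omega) (by omega)]; rfl
    simp [Env.act, St.put, block, t4, t28, t29, t30, t31, tm, hv, e1, e2, e3, e4, Nat.add_assoc]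
    cases e.adj u v <;> simp
  · exact ⟨[], l, by simp [Env.act, St.put, block, h1, h0, hlen, hu]⟩
  · rintro τ ⟨l₁, l₂, rfl, hk, t4, t28, t29, -⟩
    obtain rfl : l₂ = [] := by simpa using hk
    simpa using t29

/-- Of the `R[32]` names listed from address `R[30]` on, append those to the array that ends at
address `R[21]` whose entry in the parallel array from address `R[31]` on is at least `R[33]`. -/
def filterP : Prog :=
  .loop 32 (block [.load 34 30, .load 35 31, .op .lt 35 35 33,
    .ite 35 .skip (.seq (.store 21 34) (.op .add 21 21 4)),
    .op .add 30 30 4, .op .add 31 31 4, .op .sub 32 32 4])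

/-- Both source arrays lie below `c` and output is written only from `c` on, so copying never
destroys what is still to be read. -/
theorem filterP_ends {e : Env} {σ : St} {a b c th : ℕ} {l : List ℕ} {lv : ℕ → ℕ}
    (hw : 1 < 2 ^ e.width) (ha : a + l.length ≤ c) (hb : b + l.length ≤ c)
    (hc : c + l.length < 2 ^ e.width) (hm : Holds σ.mem a l) (hlv : Holds σ.mem b (l.map lv))
    (h1 : σ.reg 4 = 1) (h30 : σ.reg 30 = a) (h31 : σ.reg 31 = b) (h32 : σ.reg 32 = l.length)
    (h33 : σ.reg 33 = th) (h21 : σ.reg 21 = c) :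
    Ends e filterP σ (17 * l.length + 1) 0 fun σ' =>
      σ'.reg 21 = c + (l.filter fun x => th ≤ lv x).length ∧
      Holds σ'.mem c (l.filter fun x => th ≤ lv x) ∧ ∀ x < c, σ'.mem x = σ.mem x := by
  refine (Ends.loop (t₁ := 16) (q₁ := 0) (fun k τ => ∃ l₁ l₂, l = l₁ ++ l₂ ∧ l₂.length = k ∧
    τ.reg 4 = 1 ∧ τ.reg 30 = a + l₁.length ∧ τ.reg 31 = b + l₁.length ∧ τ.reg 32 = k ∧
    τ.reg 33 = th ∧ τ.reg 21 = c + (l₁.filter fun x => th ≤ lv x).length ∧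
    Holds τ.mem c (l₁.filter fun x => th ≤ lv x) ∧ ∀ x < c, τ.mem x = σ.mem x)
    ?_ ?_ l.length ?_).mono le_rfl le_rfl ?_
  · rintro τ ⟨l₁, l₂, -, -, -, -, -, h, -⟩
    exact h
  · rintro k τ ⟨l₁, l₂, rfl, hk, t4, t30, t31, t32, t33, t21, tm, tf⟩
    obtain ⟨v, l₂, rfl⟩ : ∃ v l', l₂ = v :: l' := by
      cases l₂ with
      | nil => simp at hk
      | cons v l' => exact ⟨v, l', rfl⟩
    refine ⟨by omega, Ends.simple rfl ⟨l₁ ++ [v], l₂, by simp, by simpa using hk, ?_⟩⟩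
    simp only [List.length_append, List.length_cons] at ha hb hc hk
    rw [List.map_append, List.map_cons] at hlv
    have hv : τ.mem (a + l₁.length) = v := by
      rw [tf _ (by omega)]
      exact (Holds.cons.1 (Holds.append.1 hm).2).1
    have hv' : τ.mem (b + l₁.length) = lv v := by
      rw [tf _ (by omega)]
      simpa using (Holds.cons.1 (Holds.append.1 hlv).2).1
    have hf := List.length_filter_le (fun x => decide (th ≤ lv x)) l₁
    have e1 : BinOp.add.eval e.width (c + (l₁.filter fun x => th ≤ lv x).length) 1 =
        c + (l₁.filter fun x => th ≤ lv x).length + 1 := BinOp.eval_add (by omega)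
    have e2 : BinOp.add.eval e.width (a + l₁.length) 1 = a + l₁.length + 1 :=
      BinOp.eval_add (by omega)
    have e3 : BinOp.add.eval e.width (b + l₁.length) 1 = b + l₁.length + 1 :=
      BinOp.eval_add (by omega)
    have e4 : BinOp.sub.eval e.width (k + 1) 1 = k := by
      rw [BinOp.eval_sub (by omega) (by omega)]; rfl
    by_cases h : lv v < th
    · simp [Env.act, St.put, block, t4, t30, t31, t32, t33, t21, hv, hv', BinOp.eval_lt hw, h,
        e2, e3, e4, Nat.add_assoc, List.filter_append, Nat.not_le.2 h]
      exact ⟨tm, tf⟩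
    · simp [Env.act, St.put, block, t4, t30, t31, t32, t33, t21, hv, hv', BinOp.eval_lt hw, h,
        e1, e2, e3, e4, Nat.add_assoc, List.filter_append, Nat.le_of_not_lt h]
      refine ⟨Holds.append.2 ⟨tm.congr fun x _ hx => Function.update_of_ne hx.ne _ _,
        Holds.singleton.2 (Function.update_self ..)⟩, fun x hx => ?_⟩
      rw [Function.update_of_ne (by omega), tf x hx]
  · exact ⟨[], l, by simp [h1, h30, h31, h32, h33, h21, Holds.nil]⟩
  · rintro τ ⟨l₁, l₂, rfl, hk, -, -, -, -, -, t21, tm, tf⟩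
    obtain rfl : l₂ = [] := by simpa using hk
    simpa using ⟨t21, tm, tf⟩

/-- `R[25] :=` the largest length of an independent initial part of the array of length `R[23]` at
address `R[7]`, if its initial part of length `R[22]` is independent and `R[23] < R[22] + 2 ^ R[8]`.
-/
def searchP : Prog :=
  .seq (block [.op .shl 26 4 8, .move 25 22, .move 27 8])
    (.loop 27 (.seq (block [.op .shr 26 26 4, .op .add 28 25 26, .op .lt 29 23 28, .op .sub 27 27 4])
      (.ite 29 .skip (.seq (.indep 29 7 28) (.ite 29 (.move 25 28) .skip)))))

/-- Binary search on prefix lengths with steps 2^(len-1), ..., 2, 1. The invariant is that the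
prefix of length `pos` is independent while none of length at least `pos` + 2^k is; at k = 0 this is
maximality. Each step makes at most one query. -/
theorem searchP_ends {e : Env} {σ : St} {a n len : ℕ} {L : List ℕ}
    (hmono : ∀ S S' : Finset ℕ, S ⊆ S' → e.indep S' = true → e.indep S = true)
    (hw : 1 < 2 ^ e.width) (hn : n ≤ L.length) (hlen : L.length < n + 2 ^ len)
    (hlen' : L.length + 2 ^ len < 2 ^ e.width)
    (ha : a + L.length < 2 ^ e.width) (hm : Holds σ.mem a L) (hi : e.indep (L.take n).toFinset = true)
    (h1 : σ.reg 4 = 1) (h7 : σ.reg 7 = a) (h8 : σ.reg 8 = len) (h22 : σ.reg 22 = n)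
    (h23 : σ.reg 23 = L.length) :
    Ends e searchP σ (len * (L.length + 15) + 7) len fun σ' =>
      ∃ pos, σ'.reg 25 = pos ∧ n ≤ pos ∧ pos ≤ L.length ∧ e.indep (L.take pos).toFinset = true ∧
        (pos < L.length → e.indep (L.take (pos + 1)).toFinset = false) := by
  have hlw : len < 2 ^ len := Nat.lt_two_pow_self
  refine Ends.seq (t₁ := 5) (t₂ := len * (L.length + 15) + 1) (q₁ := 0) (q₂ := len)
    (Ends.simple rfl ?_)
  refine (Ends.loop (t₁ := L.length + 14) (q₁ := 1) (fun k τ => ∃ pos, τ.reg 25 = pos ∧ n ≤ pos ∧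
    pos ≤ L.length ∧ e.indep (L.take pos).toFinset = true ∧
    (∀ m, pos + 2 ^ k ≤ m → m ≤ L.length → e.indep (L.take m).toFinset = false) ∧
    τ.reg 4 = 1 ∧ τ.reg 7 = a ∧ τ.reg 23 = L.length ∧ τ.reg 26 = 2 ^ k ∧ τ.reg 27 = k ∧
    k ≤ len ∧ τ.mem = σ.mem) ?_ ?_ len ?_ le_rfl (by omega)).mono le_rfl le_rfl ?_
  · rintro τ ⟨pos, -, -, -, -, -, -, -, -, -, h, -⟩
    exact h
  · rintro k τ ⟨pos, t25, hp, hp', hpi, hpn, t4, t7, t23, t26, t27, hk, tm⟩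
    refine ⟨by omega, Ends.seq (t₁ := 7) (t₂ := L.length + 6) (q₁ := 0) (q₂ := 1)
      (Ends.simple rfl ?_)⟩
    have hk2 : 2 ^ (k + 1) ≤ 2 ^ len := Nat.pow_le_pow_right (by norm_num) hk
    have hk3 : 2 ^ (k + 1) = 2 * 2 ^ k := by rw [pow_succ, Nat.mul_comm]
    have e1 : BinOp.shr.eval e.width (2 ^ (k + 1)) 1 = 2 ^ k := by
      rw [BinOp.eval_shr (by omega)]; omega
    have e2 : BinOp.add.eval e.width pos (2 ^ k) = pos + 2 ^ k := BinOp.eval_add (by omega)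
    have e4 : BinOp.sub.eval e.width (k + 1) 1 = k := by
      rw [BinOp.eval_sub (by omega) (by omega)]; rfl
    generalize hτ : e.act _ τ = τ'
    have r4 : τ'.reg 4 = 1 := by simp [← hτ, block, Env.act, St.put, t4]
    have r7 : τ'.reg 7 = a := by simp [← hτ, block, Env.act, St.put, t7]
    have r23 : τ'.reg 23 = L.length := by simp [← hτ, block, Env.act, St.put, t23]
    have r25 : τ'.reg 25 = pos := by simp [← hτ, block, Env.act, St.put, t25]
    have r26 : τ'.reg 26 = 2 ^ k := by simp [← hτ, block, Env.act, St.put, t26, t4, e1]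
    have r27 : τ'.reg 27 = k := by simp [← hτ, block, Env.act, St.put, t27, t4, e4]
    have r28 : τ'.reg 28 = pos + 2 ^ k := by
      simp [← hτ, block, Env.act, St.put, t26, t4, t25, e1, e2]
    have r29 : τ'.reg 29 = if L.length < pos + 2 ^ k then 1 else 0 := by
      simp [← hτ, block, Env.act, St.put, t26, t4, t25, t23, e1, e2, BinOp.eval_lt hw]
    have rm : τ'.mem = σ.mem := by simp [← hτ, block, Env.act, St.put, tm]
    clear hτ
    refine Ends.ite (t₁ := L.length + 5) (fun h => ?_) (fun h => ?_)
    · have hlt : L.length < pos + 2 ^ k := by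
        by_contra hcon
        rw [r29, if_neg hcon] at h
        exact h rfl
      -- A step beyond the end of the array is rejected without a query; the invariant for the
      -- smaller step is then vacuous.
      refine Ends.simple rfl ⟨pos, r25, hp, hp', hpi, fun m h₁ h₂ => by omega, r4, r7, r23, r26, r27,
        by omega, rm⟩ (by simp [Prog.cost])
    · have hle : pos + 2 ^ k ≤ L.length := by
        by_contra hcon
        rw [r29, if_pos (by omega)] at h
        exact absurd h one_ne_zero
      refine Ends.seq (t₁ := L.length + 1) (t₂ := 2) (q₁ := 1) (q₂ := 0)
        (Ends.indep ?_) (by omega)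
      have hls : listedSet e.width τ'.mem (τ'.reg 7) (τ'.reg 28) =
          (L.take (pos + 2 ^ k)).toFinset := by
        have := (hm.take (pos + 2 ^ k)).listedSet_eq (w := e.width) (by simp; omega)
        rw [rm, r7, r28, ← this]
        congr 1
        simp [hle]
      rw [hls]
      refine Ends.simple rfl ?_
      cases hq : e.indep (L.take (pos + 2 ^ k)).toFinset
      · refine ⟨pos, ?_⟩
        simp [Env.act, St.put, r25, hp, hp', hpi, r4, r7, r23, r26, r27, rm]
        refine ⟨fun m h₁ h₂ => ?_, by omega⟩
        -- An independent longer prefix would make the dependent prefix just queried independent by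
        -- monotonicity.
        by_contra hcon
        rw [Bool.not_eq_false] at hcon
        have := hmono (L.take (pos + 2 ^ k)).toFinset _ (fun x hx => by
          rw [List.mem_toFinset] at hx ⊢
          exact (List.take_prefix_take_left h₁).subset hx) hcon
        simp [this] at hq
      · refine ⟨pos + 2 ^ k, ?_⟩
        simp [Env.act, St.put, r28, hle, hq, r4, r7, r23, r26, r27, rm, Nat.mod_eq_of_lt hw]
        exact ⟨by omega, fun m h₁ h₂ => hpn m (by omega) h₂, by omega⟩
  · have e1 : BinOp.shl.eval e.width 1 len = 2 ^ len := by
      rw [BinOp.eval_shl (by omega)]; omega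
    -- Initially no prefix is as long as n + 2^len, so the upper half of the invariant is empty.
    refine ⟨n, ?_⟩
    simp [block, Env.act, St.put, h1, h7, h8, h22, h23, e1, hn, hi]
    omega
  · rintro τ ⟨pos, t25, hp, hp', hpi, hpn, -⟩
    exact ⟨pos, t25, hp, hp', hpi, fun h => hpn _ le_rfl h⟩

end WordRAM

/-! ### Vertices with a sampled neighbour, and dependent prefixes -/

namespace BipGraph

variable (G : BipGraph)

/-- The degree of `u ∈ U`. -/
def deg (u : ℕ) : ℕ := (G.V.filter fun v => (u, v) ∈ G.E).card

/-- `u` has a neighbour in `S`. -/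
def Touches (S : Finset ℕ) (u : ℕ) : Prop := ∃ v ∈ S, (u, v) ∈ G.E

instance (S : Finset ℕ) (u : ℕ) : Decidable (G.Touches S u) := by
  unfold Touches; infer_instance

/-- The contribution of `u` if it is found by a search for vertices with degree in
`[2 ^ j, 2 ^ (j + 1))` among vertices that were sampled with probability `2 ^ (-s)`. -/
def share (j s u : ℕ) : ℕ := if G.deg u / 2 ^ j = 1 then G.deg u * 2 ^ s else 0

/-- The total contribution of the members of a list that have a neighbour in `S`. -/
def mass (S : Finset ℕ) (j s : ℕ) (l : List ℕ) : ℕ :=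
  (l.map fun u => if G.Touches S u then G.share j s u else 0).sum

/-- The number of members of a list that have a neighbour in `S`. -/
def hits (S : Finset ℕ) (l : List ℕ) : ℕ := l.countP fun u => G.Touches S u

variable {G}

theorem mem_U {u v : ℕ} (h : (u, v) ∈ G.E) : u ∈ G.U :=
  (Finset.mem_product.1 (G.subset h)).1

theorem mem_V {u v : ℕ} (h : (u, v) ∈ G.E) : v ∈ G.V :=
  (Finset.mem_product.1 (G.subset h)).2

theorem not_mem_V {u : ℕ} (h : u ∈ G.U) : u ∉ G.V := fun h' =>
  Finset.disjoint_left.1 G.disjoint h h'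

theorem not_touches {S : Finset ℕ} {v : ℕ} (hv : v ∈ G.V) : ¬ G.Touches S v := fun ⟨_, _, h⟩ =>
  not_mem_V (mem_U h) hv

theorem indepOracle_eq_true {S : Finset ℕ} : G.indepOracle S = true ↔ G.IsIndep S := by
  simp [indepOracle]

theorem indepOracle_eq_false {S : Finset ℕ} : G.indepOracle S = false ↔ ¬ G.IsIndep S := by
  simp [indepOracle]

theorem IsIndep.mono {S S' : Finset ℕ} (h : S ⊆ S') (h' : G.IsIndep S') : G.IsIndep S :=
  fun x hx hxS => h' x hx ⟨h hxS.1, h hxS.2⟩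

theorem IsIndep.of_subset_V {S : Finset ℕ} (h : S ⊆ G.V) : G.IsIndep S :=
  fun _ hx hxS => not_mem_V (mem_U hx) (h hxS.1)

theorem mass_eq_zero {S : Finset ℕ} {j s : ℕ} {l : List ℕ} (h : G.hits S l = 0) :
    G.mass S j s l = 0 := by
  rw [hits, List.countP_eq_zero] at h
  rw [mass, List.sum_eq_zero]
  intro x hx
  obtain ⟨u, hu, rfl⟩ := List.mem_map.1 hx
  exact if_neg (by simpa using h u hu)

theorem hits_eq_zero_of_isIndep {A l : List ℕ} (h : G.IsIndep (A ++ l).toFinset) :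
    G.hits A.toFinset l = 0 := by
  rw [hits, List.countP_eq_zero]
  intro u hu
  rw [decide_eq_true_iff]
  rintro ⟨v, hv, huv⟩
  exact h (u, v) huv ⟨by simp [hu], by simpa using Or.inl (List.mem_toFinset.1 hv)⟩

/-- The first vertex of a list that destroys independence has a neighbour in the part of `V` that
precedes the list. -/
theorem exists_touches {A l : List ℕ} {pos : ℕ}
    (hl : ∀ x ∈ l, x ∈ G.U ∨ x ∈ A) (hpos : A.length ≤ pos) (hlt : pos < (A ++ l).length)
    (hi : G.IsIndep ((A ++ l).take pos).toFinset)
    (hn : ¬ G.IsIndep ((A ++ l).take (pos + 1)).toFinset) :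
    ∃ l₁ y l₂, l = l₁ ++ y :: l₂ ∧ pos = A.length + l₁.length ∧ G.Touches A.toFinset y := by
  obtain ⟨i, rfl⟩ := Nat.exists_eq_add_of_le hpos
  have hi' : i < l.length := by simpa using hlt
  refine ⟨l.take i, l[i], l.drop (i + 1), by simp, by simp; omega, ?_⟩
  have e1 : (A ++ l).take (A.length + i) = A ++ l.take i := by simp [List.take_append]
  have e2 : (A ++ l).take (A.length + i + 1) = (A ++ l.take i) ++ [l[i]] := by
    rw [List.take_succ_eq_append_getElem hlt, e1]
    simp
  rw [e1] at hi
  rw [e2] at hn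
  simp only [IsIndep, not_forall, not_not] at hn
  obtain ⟨⟨a, b⟩, hab, ha, hb⟩ := hn
  -- The endpoint in V must come from `A`: every other entry of `l` is in U.
  have hbA : b ∈ A := by
    by_contra hcon
    simp only [List.mem_toFinset, List.mem_append, List.mem_singleton] at hb
    have : b ∈ l := by
      rcases hb with (hb | hb) | rfl
      exacts [absurd hb hcon, List.mem_of_mem_take hb, List.getElem_mem hi']
    exact (hl b this).elim (fun h => not_mem_V h (mem_V hab)) hcon
  simp only [List.mem_toFinset, List.mem_append, List.mem_singleton] at ha
  -- If the other endpoint were in the shorter prefix, that prefix would already contain an edge; so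
  -- it is the new entry.
  rcases ha with ha | rfl
  · exact absurd ⟨by simpa using ha, by simp [hbA]⟩ (hi _ hab)
  · exact ⟨b, by simpa using hbA, hab⟩

end BipGraph

/-! ### Correctness of the search for one guess and one degree class -/

namespace WordRAM

/-- The data of a run after the setup: the graph, the two input arrays, the levels of the vertices,
and the contents of registers `6` and `8` to `11`. -/
structure Setting where
  G : BipGraph
  us : List ℕ
  vs : List ℕ
  lv : ℕ → ℕ
  base : ℕ
  len : ℕ
  lam : ℕ
  kap : ℕ
  bud : ℕ

namespace Setting

/-- The number of vertices. -/
def n (S : Setting) : ℕ := S.us.length + S.vs.length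

/-- The address of the buffer. -/
def buf (S : Setting) : ℕ := S.base + S.n

/-- The setting describes the oracles, and words are large enough. -/
structure Valid (S : Setting) (e : Env) : Prop where
  adj : e.adj = S.G.adjOracle
  indep : e.indep = S.G.indepOracle
  us_nodup : S.us.Nodup
  vs_nodup : S.vs.Nodup
  us_eq : S.us.toFinset = S.G.U
  vs_eq : S.vs.toFinset = S.G.V
  n_lt : S.n < 2 ^ S.len
  n_le : S.n ≤ S.base
  room : S.base + 3 * S.n < 2 ^ e.width
  width : 6 * S.len + 24 ≤ e.width
  kap_lt : S.kap < 2 ^ (2 * S.len + 16)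
  bud_lt : S.bud < 2 ^ e.width

/-- Registers and memory below the buffer are as after the setup. -/
structure Ready (S : Setting) (σ : St) : Prop where
  r0 : σ.reg 0 = S.us.length
  r1 : σ.reg 1 = S.vs.length
  r4 : σ.reg 4 = 1
  r6 : σ.reg 6 = S.base
  r7 : σ.reg 7 = S.buf
  r8 : σ.reg 8 = S.len
  r9 : σ.reg 9 = S.lam
  r10 : σ.reg 10 = S.kap
  r11 : σ.reg 11 = S.bud
  input : Holds σ.mem 0 (S.us ++ S.vs)
  levels : Holds σ.mem S.base ((S.us ++ S.vs).map S.lv)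

theorem Ready.congr {S : Setting} {σ σ' : St} (h : S.Ready σ)
    (hr : ∀ i ≤ 11, σ'.reg i = σ.reg i) (hm : ∀ x < S.buf, σ'.mem x = σ.mem x) : S.Ready σ' where
  r0 := (hr 0 (by norm_num)).trans h.r0
  r1 := (hr 1 (by norm_num)).trans h.r1
  r4 := (hr 4 (by norm_num)).trans h.r4
  r6 := (hr 6 (by norm_num)).trans h.r6
  r7 := (hr 7 (by norm_num)).trans h.r7
  r8 := (hr 8 (by norm_num)).trans h.r8
  r9 := (hr 9 (by norm_num)).trans h.r9
  r10 := (hr 10 (by norm_num)).trans h.r10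
  r11 := (hr 11 (by norm_num)).trans h.r11
  input := h.input.congr fun x _ hx => hm x (by simp [buf, n] at hx ⊢; omega)
  levels := h.levels.congr fun x _ hx => hm x (by simpa [buf, n] using hx)

namespace Valid

variable {S : Setting} {e : Env}

theorem two_pow_le (h : S.Valid e) {k : ℕ} (hk : k ≤ 6 * S.len + 24) : 2 ^ k ≤ 2 ^ e.width :=
  Nat.pow_le_pow_right (by norm_num) (hk.trans h.width)

theorem one_lt (h : S.Valid e) : 1 < 2 ^ e.width :=
  lt_of_lt_of_le (by norm_num) (h.two_pow_le (k := 1) (by omega))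

theorem countP_adj (h : S.Valid e) (u : ℕ) : S.vs.countP (e.adj u) = S.G.deg u := by
  rw [BipGraph.deg, List.countP_eq_length_filter, ← h.vs_eq, ← List.toFinset_card_of_nodup
    (h.vs_nodup.filter _), h.adj]
  congr 1
  ext v
  simp [BipGraph.adjOracle]

theorem deg_lt (h : S.Valid e) (u : ℕ) : S.G.deg u < 2 ^ S.len := by
  rw [← h.countP_adj u]
  have := List.countP_le_length (p := e.adj u) (l := S.vs)
  have := h.n_lt
  simp only [n] at this
  omega

end Valid

end Setting

/-- Treat the vertex at position `R[25]` of the buffer: overwrite it by the first entry of the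
buffer, and add its share to `R[16]`. -/
def foundP : Prog :=
  .seq (block [.op .add 26 7 25, .load 28 26, .load 27 7, .store 26 27])
    (.seq degP (block [.op .shr 30 29 17, .op .eq 30 30 4,
      .ite 30 (.seq (.op .shl 30 29 20) (.op .add 16 16 30)) .skip]))

/-- The first entry `v` of the buffer already belongs to the V-sample, so overwriting `y` by it
deletes `y` from the queried set while array length and positions stay fixed. The degree is compared
with 2^j only after the vertex is found; other classes contribute 0. -/
theorem foundP_ends {e : Env} {S : Setting} {σ : St} {v y j s : ℕ} {A l₁ l₂ : List ℕ}
    (hS : S.Valid e) (hσ : S.Ready σ)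
    (hlen : ((v :: A) ++ (l₁ ++ y :: l₂)).length ≤ S.n)
    (hm : Holds σ.mem S.buf ((v :: A) ++ (l₁ ++ y :: l₂)))
    (h17 : σ.reg 17 = j) (h20 : σ.reg 20 = s) (h25 : σ.reg 25 = (v :: A).length + l₁.length)
    (hacc : σ.reg 16 + S.G.share j s y < 2 ^ e.width) :
    Ends e foundP σ (10 * S.n + 24) 0 fun σ' => S.Ready σ' ∧
      Holds σ'.mem S.buf ((v :: A) ++ (l₁ ++ v :: l₂)) ∧
      σ'.reg 16 = σ.reg 16 + S.G.share j s y := by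
  have hw := hS.one_lt
  have hroom := hS.room
  have hnb := hS.n_le
  simp only [List.length_append, List.length_cons] at hlen h25
  have hb : S.buf = S.base + S.n := rfl
  have hn : S.n = S.us.length + S.vs.length := rfl
  have e1 : BinOp.add.eval e.width S.buf (A.length + 1 + l₁.length) =
      S.buf + (A.length + 1 + l₁.length) := BinOp.eval_add (by omega)
  have m1 := hm
  rw [Holds.append, Holds.append, Holds.cons, Holds.cons] at m1
  obtain ⟨⟨mv, mA⟩, ml₁, my, ml₂⟩ := m1
  rw [List.length_cons] at my ml₁ ml₂
  refine Ends.seq (t₁ := 7) (t₂ := 10 * S.n + 16) (q₁ := 0) (q₂ := 0) (Ends.simple rfl ?_)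
  generalize hτ : e.act _ σ = τ
  have hfr : ∀ i, i ≠ 26 → i ≠ 27 → i ≠ 28 → τ.reg i = σ.reg i := by
    intro i h h' h''
    simp [← hτ, block, Env.act, St.put, h, h', h'']
  have h28 : τ.reg 28 = y := by
    simp [← hτ, block, Env.act, St.put, h25, hσ.r7, e1]
    rw [← my]
    congr 1
    omega
  have hτm : τ.mem = Function.update σ.mem (S.buf + (A.length + 1) + l₁.length) v := by
    simp [← hτ, block, Env.act, St.put, h25, hσ.r7, e1, mv]
    rw [Nat.add_assoc S.buf]
  clear hτ
  have rτ : S.Ready τ := hσ.congr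
    (fun i hi => hfr i (by omega) (by omega) (by omega)) fun x hx => by
      rw [hτm, Function.update_of_ne (by omega)]
  refine Ends.seq (t₁ := 10 * S.n + 7) (t₂ := 8) (q₁ := 0) (q₂ := 0) ?_
  have hd := degP_ends (e := e) (σ := τ) (a := S.us.length) (l := S.vs) (by omega) hw
    (by simpa using (Holds.append.1 rτ.input).2) rτ.r4 rτ.r0 rτ.r1 h28
  refine (hd.frame.frame_mem rfl).mono (by omega) le_rfl ?_
  rintro τ' ⟨⟨h29, hf⟩, hm'⟩
  have rτ' : S.Ready τ' := rτ.congr (fun i hi => hf i (by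
    simp [degP, block, Prog.writes]; omega)) fun x hx => by rw [hm']
  have hf' : ∀ i ∈ [16, 17, 20], τ'.reg i = σ.reg i := by
    intro i hi
    rw [hf i, hfr i]
    all_goals simp [degP, block, Prog.writes] at hi ⊢
    all_goals omega
  have h16 := hf' 16 (by simp)
  have h17' := (hf' 17 (by simp)).trans h17
  have h20' := (hf' 20 (by simp)).trans h20
  rw [hS.countP_adj] at h29
  have hdl := hS.deg_lt y
  have hdw : S.G.deg y < 2 ^ e.width := hdl.trans_le (hS.two_pow_le (by omega))
  have hv : Holds τ'.mem S.buf ((v :: A) ++ (l₁ ++ v :: l₂)) := by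
    rw [hm', hτm, Holds.append, Holds.append, Holds.cons, Holds.cons, List.length_cons]
    refine ⟨⟨?_, mA.congr fun x _ hx => ?_⟩, ml₁.congr fun x _ hx => ?_, ?_,
      ml₂.congr fun x hx _ => ?_⟩
    · rw [Function.update_of_ne (by omega), mv]
    · rw [Function.update_of_ne (by omega)]
    · rw [Function.update_of_ne (by omega)]
    · rw [Function.update_self]
    · rw [Function.update_of_ne (by omega)]
  refine Ends.simple rfl ?_
  have hr : ∀ σ' : St, σ'.mem = τ'.mem → (∀ i ≤ 11, σ'.reg i = τ'.reg i) → S.Ready σ' :=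
    fun σ' h h' => rτ'.congr h' fun x _ => by rw [h]
  by_cases hj : S.G.deg y / 2 ^ j = 1
  · have hsh : S.G.share j s y = S.G.deg y * 2 ^ s := if_pos hj
    rw [hsh] at hacc ⊢
    have e2 := BinOp.eval_shr (w := e.width) (y := j) hdw
    have e3 : BinOp.shl.eval e.width (S.G.deg y) s = S.G.deg y * 2 ^ s :=
      BinOp.eval_shl (by omega)
    have e4 : BinOp.add.eval e.width (σ.reg 16) (S.G.deg y * 2 ^ s) =
      σ.reg 16 + S.G.deg y * 2 ^ s := BinOp.eval_add (by omega)
    have e5 : BinOp.eq.eval e.width 1 1 = 1 := by rw [BinOp.eval_eq hw]; rfl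
    refine ⟨hr _ ?_ fun i hi => ?_, ?_, ?_⟩
    · simp [block, Env.act, St.put, h29, h17', e2, hj, rτ'.r4, e5]
    · simp [block, Env.act, St.put, h29, h17', e2, hj, rτ'.r4, e5]
      rw [Function.update_of_ne (by omega), Function.update_of_ne (by omega)]
    · simpa [block, Env.act, St.put, h29, h17', e2, hj, rτ'.r4, e5] using hv
    · simp [block, Env.act, St.put, h29, h17', h20', h16, e2, hj, rτ'.r4, e5, e3, e4]
  · have hsh : S.G.share j s y = 0 := if_neg hj
    rw [hsh]
    have e2 := BinOp.eval_shr (w := e.width) (y := j) hdw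
    have e5 : BinOp.eq.eval e.width (S.G.deg y / 2 ^ j) 1 = 0 := by
      rw [BinOp.eval_eq hw, if_neg hj]
    refine ⟨hr _ ?_ fun i hi => ?_, ?_, ?_⟩
    · simp [block, Env.act, St.put, h29, h17', e2, rτ'.r4, e5]
    · simp [block, Env.act, St.put, h29, h17', e2, rτ'.r4, e5]
      rw [Function.update_of_ne (by omega)]
    · simpa [block, Env.act, St.put, h29, h17', e2, rτ'.r4, e5] using hv
    · simp [block, Env.act, St.put, h29, h17', h16, e2, rτ'.r4, e5]

/-- `R[24]` times, search the buffer for a vertex that has a neighbour in the sample of `V` at the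
front, and treat it. -/
def roundsP : Prog :=
  .loop 24 (.seq searchP (.seq (block [.op .sub 24 24 4, .op .lt 26 25 23]) (.ite 26 foundP .skip)))

theorem roundsP_ends {e : Env} {S : Setting} {σ : St} {j s : ℕ} {A l : List ℕ}
    (hS : S.Valid e) (hσ : S.Ready σ) (hA : A.toFinset ⊆ S.G.V)
    (hl : ∀ x ∈ l, x ∈ S.G.U) (hlen : (A ++ l).length ≤ S.n) (hm : Holds σ.mem S.buf (A ++ l))
    (h17 : σ.reg 17 = j) (h20 : σ.reg 20 = s) (h22 : σ.reg 22 = A.length)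
    (h23 : σ.reg 23 = (A ++ l).length) (h24 : σ.reg 24 = S.bud)
    (hacc : σ.reg 16 + S.G.mass A.toFinset j s l < 2 ^ e.width) :
    Ends e roundsP σ (S.bud * (S.len * (S.n + 15) + 10 * S.n + 38) + 1) (S.bud * S.len)
      fun σ' => S.Ready σ' ∧ σ'.reg 16 ≤ σ.reg 16 + S.G.mass A.toFinset j s l ∧
        (S.G.hits A.toFinset l ≤ S.bud → σ'.reg 16 = σ.reg 16 + S.G.mass A.toFinset j s l) := by
  have hw := hS.one_lt
  have hroom := hS.room
  have hb : S.buf = S.base + S.n := rfl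
  have hnb := hS.n_le
  have hbud := hS.bud_lt
  -- Accumulator plus mass still in the buffer is constant. Each round lowers the number of hits by
  -- one or finds none left, so after all rounds either every hit is treated or there were more than
  -- `bud` of them. Even then the accumulator is at most the full mass, which rules out overflow.
  refine (Ends.loop (t₁ := S.len * (S.n + 15) + 10 * S.n + 37) (q₁ := S.len)
    (fun k τ => ∃ l', S.Ready τ ∧ (∀ x ∈ l', x ∈ S.G.U ∨ x ∈ A) ∧ l'.length = l.length ∧
      Holds τ.mem S.buf (A ++ l') ∧ τ.reg 17 = j ∧ τ.reg 20 = s ∧ τ.reg 22 = A.length ∧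
      τ.reg 23 = (A ++ l).length ∧ τ.reg 24 = k ∧ k ≤ S.bud ∧
      τ.reg 16 + S.G.mass A.toFinset j s l' = σ.reg 16 + S.G.mass A.toFinset j s l ∧
      (S.G.hits A.toFinset l' = 0 ∨ S.G.hits A.toFinset l' + S.bud ≤ S.G.hits A.toFinset l + k))
    ?_ ?_ S.bud ?_ le_rfl le_rfl).mono le_rfl le_rfl ?_
  · rintro τ ⟨l', -, -, -, -, -, -, -, -, h, -⟩
    exact h
  · rintro k τ ⟨l', hτ, hl', hlen', hm', t17, t20, t22, t23, t24, hk, tacc, thits⟩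
    refine ⟨by omega, ?_⟩
    have hAlen : (A ++ l').length = (A ++ l).length := by simp [hlen']
    -- The search applies since the V-sample alone is independent and 2^len exceeds the length of
    -- the array.
    have hsearch := searchP_ends (e := e) (σ := τ) (a := S.buf) (n := A.length) (len := S.len)
      (L := A ++ l') (by
        intro X X' hX h
        rw [hS.indep, BipGraph.indepOracle_eq_true] at h ⊢
        exact h.mono hX) hw (by simp)
      (by have := hS.n_lt; omega)
      (by have := hS.two_pow_le (k := S.len + 1) (by omega)
          have := hS.n_lt
          omega)
      (by omega) hm' (by
        rw [hS.indep, BipGraph.indepOracle_eq_true]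
        exact BipGraph.IsIndep.of_subset_V (by simpa using hA))
      hτ.r4 hτ.r7 hτ.r8 t22 (t23.trans hAlen.symm)
    have hle : S.len * ((A ++ l').length + 15) ≤ S.len * (S.n + 15) :=
      Nat.mul_le_mul_left _ (by omega)
    refine Ends.seq (t₁ := S.len * (S.n + 15) + 7) (t₂ := 10 * S.n + 29) (q₁ := S.len) (q₂ := 0)
      ((hsearch.frame.frame_mem rfl).mono (by omega) le_rfl ?_)
    rintro τ₁ ⟨⟨⟨pos, r25, hp, hp', hpi, hpn⟩, hf⟩, hmem⟩
    have hfr : ∀ i ≤ 24, τ₁.reg i = τ.reg i := fun i hi =>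
      hf i (by simp [searchP, block, Prog.writes]; omega)
    refine Ends.seq (t₁ := 3) (t₂ := 10 * S.n + 25) (q₁ := 0) (q₂ := 0) (Ends.simple rfl ?_)
    have e1 : BinOp.sub.eval e.width (k + 1) 1 = k := by
      rw [BinOp.eval_sub (by omega) (by omega)]; rfl
    generalize hτ₂ : e.act _ τ₁ = τ₂
    have g24 : τ₂.reg 24 = k := by
      simp [← hτ₂, block, Env.act, St.put, hfr, t24, hτ.r4, e1]
    have g26 : τ₂.reg 26 = if pos < (A ++ l').length then 1 else 0 := by
      simp [← hτ₂, block, Env.act, St.put, hfr, t23, r25, BinOp.eval_lt hw, hlen']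
    have g25 : τ₂.reg 25 = pos := by
      simp [← hτ₂, block, Env.act, St.put, r25]
    have gfr : ∀ i ≤ 23, τ₂.reg i = τ.reg i := by
      intro i hi
      have h1 : i ≠ 24 := by omega
      have h2 : i ≠ 26 := by omega
      simp [← hτ₂, block, Env.act, St.put, h1, h2, hfr i (by omega)]
    have gm : τ₂.mem = τ.mem := by simp [← hτ₂, block, Env.act, St.put, hmem]
    clear hτ₂
    have gR : S.Ready τ₂ := hτ.congr (fun i hi => gfr i (by omega)) fun x _ => by rw [gm]
    rw [hS.indep, BipGraph.indepOracle_eq_true] at hpi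
    rw [hS.indep, BipGraph.indepOracle_eq_false] at hpn
    refine Ends.ite (t₁ := 10 * S.n + 24) (fun h => ?_) (fun h => ?_)
    · have hlt : pos < (A ++ l').length := by
        by_contra hcon
        rw [g26, if_neg hcon] at h
        exact h rfl
      obtain ⟨l₁, y, l₂, rfl, hpos, hy⟩ := BipGraph.exists_touches hl' hp hlt hpi (hpn hlt)
      -- The V-sample is nonempty, because `y` has a neighbour in it.
      obtain ⟨v, A, rfl⟩ : ∃ v A', A = v :: A' := by
        cases A with
        | nil => obtain ⟨v, hv, -⟩ := hy; simp at hv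
        | cons v A' => exact ⟨v, A', rfl⟩
      have hmass : S.G.mass (v :: A).toFinset j s (l₁ ++ y :: l₂) =
          S.G.mass (v :: A).toFinset j s (l₁ ++ v :: l₂) + S.G.share j s y := by
        have : ¬ S.G.Touches (v :: A).toFinset v := BipGraph.not_touches (hA (by simp))
        simp only [BipGraph.mass, List.map_append, List.map_cons, List.sum_append, List.sum_cons,
          if_pos hy, if_neg this]
        omega
      have hhits : S.G.hits (v :: A).toFinset (l₁ ++ y :: l₂) =
          S.G.hits (v :: A).toFinset (l₁ ++ v :: l₂) + 1 := by
        have : ¬ S.G.Touches (v :: A).toFinset v := BipGraph.not_touches (hA (by simp))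
        simp only [BipGraph.hits, List.countP_append, List.countP_cons, hy, this]
        simp
        omega
      have hfound := foundP_ends (e := e) (S := S) (σ := τ₂) (j := j) (s := s) (v := v) (y := y)
        (A := A) (l₁ := l₁) (l₂ := l₂) hS gR (hAlen.le.trans hlen) (by rw [gm]; exact hm') ((gfr 17 (by omega)).trans t17)
        ((gfr 20 (by omega)).trans t20) (g25.trans hpos) (by rw [gfr 16 (by omega)]; omega)
      refine hfound.frame.mono le_rfl le_rfl ?_
      rintro τ₃ ⟨⟨u, um, u16⟩, uf⟩
      have hu : ∀ i ∈ [17, 20, 22, 23, 24], τ₃.reg i = τ₂.reg i := fun i hi =>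
        uf i (by simp [foundP, degP, block, Prog.writes] at hi ⊢; omega)
      refine ⟨l₁ ++ v :: l₂, u, ?_, ?_, um, ?_, ?_, ?_, ?_, ?_, by omega, ?_, ?_⟩
      · intro x hx
        simp only [List.mem_append, List.mem_cons] at hx hl' ⊢
        rcases hx with hx | rfl | hx
        · exact hl' x (Or.inl hx)
        · exact Or.inr (Or.inl rfl)
        · exact hl' x (Or.inr (Or.inr hx))
      · rw [← hlen']; simp
      · rw [hu _ (by simp), gfr _ (by omega), t17]
      · rw [hu _ (by simp), gfr _ (by omega), t20]
      · rw [hu _ (by simp), gfr _ (by omega), t22]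
      · rw [hu _ (by simp), gfr _ (by omega), t23]
      · rw [hu _ (by simp), g24]
      · rw [u16, gfr _ (by omega)]
        omega
      · omega
    · have hge : pos = (A ++ l').length := by
        by_contra hcon
        rw [g26, if_pos (by omega)] at h
        exact absurd h one_ne_zero
      -- The whole buffer is independent, so nothing is left to find.
      rw [hge, List.take_length] at hpi
      refine Ends.simple rfl ⟨l', gR, hl', hlen', ?_, ?_, ?_, ?_, ?_, g24, by omega, ?_,
        Or.inl (BipGraph.hits_eq_zero_of_isIndep hpi)⟩ (by simp [Prog.cost])
      · simpa [Env.act, gm] using hm'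
      · rw [Env.act, gfr _ (by omega), t17]
      · rw [Env.act, gfr _ (by omega), t20]
      · rw [Env.act, gfr _ (by omega), t22]
      · rw [Env.act, gfr _ (by omega), t23]
      · rw [Env.act, gfr _ (by omega)]
        exact tacc
  · exact ⟨l, hσ, fun x hx => Or.inl (hl x hx), rfl, hm, h17, h20, h22, h23, h24, le_rfl, rfl,
      Or.inr le_rfl⟩
  · rintro τ ⟨l', hτ, -, -, -, -, -, -, -, -, -, tacc, thits⟩
    refine ⟨hτ, by omega, fun h => ?_⟩
    have : S.G.hits A.toFinset l' = 0 := by omega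
    rw [BipGraph.mass_eq_zero this] at tacc
    exact tacc

namespace Setting

/-- The vertices of `V` of level at least `t`. -/
def sampleV (S : Setting) (t : ℕ) : List ℕ := S.vs.filter fun x => t ≤ S.lv x

/-- The vertices of `U` of level at least `s`. -/
def sampleU (S : Setting) (s : ℕ) : List ℕ := S.us.filter fun x => s ≤ S.lv x

/-- The contribution of the degree class `j` to the estimate for the guess `2 ^ g`. -/
def massAt (S : Setting) (g j : ℕ) : ℕ :=
  S.G.mass (S.sampleV (j - S.lam)).toFinset j (g - (j + S.kap)) (S.sampleU (g - (j + S.kap)))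

/-- The number of vertices to be found for the degree class `j` and the guess `2 ^ g`. -/
def hitsAt (S : Setting) (g j : ℕ) : ℕ :=
  S.G.hits (S.sampleV (j - S.lam)).toFinset (S.sampleU (g - (j + S.kap)))

/-- A bound for the running time of `innerP`. -/
def innerTime (S : Setting) : ℕ := S.bud * (S.len * (S.n + 15) + 10 * S.n + 38) + 17 * S.n + 50

end Setting

/-- `R[d] := R[a] - R[b]`, or `0` if this is negative. -/
def monusP (d a b : ℕ) : Prog := .seq (.op .lt d a b) (.ite d (.const d 0) (.op .sub d a b))

theorem monusP_ends {e : Env} {σ : St} {d a b x y : ℕ} (hw : 1 < 2 ^ e.width) (hda : a ≠ d)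
    (hdb : b ≠ d) (ha : σ.reg a = x) (hb : σ.reg b = y) (hx : x < 2 ^ e.width) :
    Ends e (monusP d a b) σ 4 0 fun σ' =>
      (σ'.reg d = x - y ∧ σ'.mem = σ.mem ∧ σ'.tossed = σ.tossed) ∧ ∀ i, i ≠ d → σ'.reg i = σ.reg i := by
  refine (Ends.simple (Q := fun σ' => σ'.reg d = x - y ∧ σ'.mem = σ.mem ∧
    σ'.tossed = σ.tossed) rfl ?_ le_rfl).frame.mono le_rfl le_rfl fun σ' ⟨h, h'⟩ => ⟨h, fun i hi => h' i (by simpa [monusP, Prog.writes] using hi)⟩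
  by_cases h : x < y
  · simp [monusP, Env.act, St.put, ha, hb, BinOp.eval_lt hw, h]
    omega
  · simp [monusP, Env.act, St.put, ha, hb, hda, hdb, BinOp.eval_lt hw, h,
      BinOp.eval_sub (not_lt.1 h) hx]

/-- Write the samples of `V` and `U` for the guess `2 ^ R[14]` and the degree class `R[17]` into the
buffer, and add the shares of the vertices found to `R[16]`. -/
def innerP : Prog :=
  .seq (monusP 19 17 9)
  (.seq (.op .add 28 17 10)
  (.seq (monusP 20 14 28)
  (.seq (block [.move 21 7, .move 30 0, .op .add 31 6 0, .move 32 1, .move 33 19])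
  (.seq filterP
  (.seq (block [.op .sub 22 21 7, .const 30 0, .move 31 6, .move 32 0, .move 33 20])
  (.seq filterP
  (.seq (block [.op .sub 23 21 7, .move 24 11])
  roundsP)))))))

/-- The V-sample is written first so that it is the known independent prefix of the search.
Truncated subtraction of thresholds means that a rate above 1 is replaced by 1. -/
theorem innerP_ends {e : Env} {S : Setting} {σ : St} {g j : ℕ}
    (hS : S.Valid e) (hσ : S.Ready σ) (hg : g < 2 * S.len) (hj : j < S.len)
    (h14 : σ.reg 14 = g) (h17 : σ.reg 17 = j) (hacc : σ.reg 16 + S.massAt g j < 2 ^ e.width) :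
    Ends e innerP σ S.innerTime (S.bud * S.len)
      fun σ' => S.Ready σ' ∧ σ'.reg 16 ≤ σ.reg 16 + S.massAt g j ∧
        (S.hitsAt g j ≤ S.bud → σ'.reg 16 = σ.reg 16 + S.massAt g j) := by
  have hw := hS.one_lt
  have hroom := hS.room
  have hb : S.buf = S.base + S.n := rfl
  have hnb := hS.n_le
  have hn : S.n = S.us.length + S.vs.length := rfl
  have hlw : 3 * S.len < 2 ^ e.width := by
    have h1 : S.len < 2 ^ S.len := Nat.lt_two_pow_self
    have h2 := hS.two_pow_le (k := S.len + 2) (by omega)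
    rw [pow_add] at h2
    omega
  have hkw : S.kap + S.len < 2 ^ e.width := by
    have h1 : S.len < 2 ^ S.len := Nat.lt_two_pow_self
    have h2 := hS.two_pow_le (k := 2 * S.len + 16 + 1) (by omega)
    have h3 := hS.kap_lt
    have h4 : 2 ^ S.len ≤ 2 ^ (2 * S.len + 16) := Nat.pow_le_pow_right (by norm_num) (by omega)
    rw [pow_succ] at h2
    omega
  have e1 : BinOp.add.eval e.width j S.kap = j + S.kap := BinOp.eval_add (by omega)
  have e2 : BinOp.add.eval e.width S.base S.us.length = S.base + S.us.length :=
    BinOp.eval_add (by omega)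
  have hT : S.innerTime = S.bud * (S.len * (S.n + 15) + 10 * S.n + 38) + 17 * S.n + 50 := rfl
  refine Ends.seq (t₁ := 4) (t₂ := S.innerTime - 5) (q₁ := 0) (q₂ := S.bud * S.len)
    ((monusP_ends hw (by norm_num) (by norm_num) h17 hσ.r9 (by omega)).mono le_rfl le_rfl ?_)
  rintro τ₁ ⟨⟨b19, bm, -⟩, bf⟩
  refine Ends.seq (t₁ := 1) (t₂ := S.innerTime - 7) (q₁ := 0) (q₂ := S.bud * S.len)
    (Ends.simple rfl ?_)
  refine Ends.seq (t₁ := 4) (t₂ := S.innerTime - 12) (q₁ := 0) (q₂ := S.bud * S.len)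
    ((monusP_ends (x := g) (y := j + S.kap) hw (by norm_num) (by norm_num)
      (by simp [Env.act, St.put, bf, h14])
      (by simp [Env.act, St.put, bf, h17, hσ.r10, e1]) (by omega)).mono le_rfl le_rfl ?_)
  rintro τ₂ ⟨⟨c20, cm, -⟩, cf⟩
  have cm : τ₂.mem = σ.mem := cm.trans bm
  have c19 : τ₂.reg 19 = j - S.lam := by simp [cf, Env.act, St.put, b19]
  have cf : ∀ i ≤ 18, τ₂.reg i = σ.reg i := fun i hi => by
    have h1 : i ≠ 28 := by omega
    have h2 : i ≠ 20 := by omega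
    have h3 : i ≠ 19 := by omega
    simp [cf, Env.act, St.put, bf, h1, h2, h3]
  clear bf bm b19
  refine Ends.seq (t₁ := 9) (t₂ := S.innerTime - 22) (q₁ := 0) (q₂ := S.bud * S.len)
    (Ends.simple rfl ?_)
  generalize hτ₃ : e.act _ τ₂ = τ₃
  have d21 : τ₃.reg 21 = S.buf := by simp [← hτ₃, block, Env.act, St.put, cf, hσ.r7]
  have d30 : τ₃.reg 30 = S.us.length := by simp [← hτ₃, block, Env.act, St.put, cf, hσ.r0]
  have d31 : τ₃.reg 31 = S.base + S.us.length := by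
    simp [← hτ₃, block, Env.act, St.put, cf, hσ.r0, hσ.r6, e2]
  have d32 : τ₃.reg 32 = S.vs.length := by simp [← hτ₃, block, Env.act, St.put, cf, hσ.r1]
  have d33 : τ₃.reg 33 = j - S.lam := by simp [← hτ₃, block, Env.act, St.put, c19]
  have dm : τ₃.mem = σ.mem := by simp [← hτ₃, block, Env.act, St.put, cm]
  have df : ∀ i ≤ 20, τ₃.reg i = τ₂.reg i := fun i hi => by
    have h1 : i ≠ 21 := by omega
    have h2 : i ≠ 30 := by omega
    have h3 : i ≠ 31 := by omega
    have h4 : i ≠ 32 := by omega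
    have h5 : i ≠ 33 := by omega
    simp [← hτ₃, block, Env.act, St.put, h1, h2, h3, h4, h5]
  clear hτ₃
  have dfr : ∀ i ≤ 18, τ₃.reg i = σ.reg i := fun i hi => (df i (by omega)).trans (cf i hi)
  have dR : S.Ready τ₃ := hσ.congr (fun i hi => dfr i (by omega)) fun x _ => by rw [dm]
  have hVlen : (S.sampleV (j - S.lam)).length ≤ S.vs.length := List.length_filter_le _ _
  have hUlen : (S.sampleU (g - (j + S.kap))).length ≤ S.us.length := List.length_filter_le _ _
  have hlev := dR.levels
  rw [List.map_append, Holds.append, List.length_map] at hlev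
  refine Ends.seq (t₁ := 17 * S.vs.length + 1) (t₂ := S.innerTime - (17 * S.vs.length + 24))
    (q₁ := 0) (q₂ := S.bud * S.len)
    ((filterP_ends (l := S.vs) (lv := S.lv) (a := S.us.length) (b := S.base + S.us.length)
      (c := S.buf) (th := j - S.lam) hw (by omega) (by omega) (by omega)
      (by simpa using (Holds.append.1 dR.input).2) hlev.2 dR.r4 d30 d31 d32 d33
      d21).frame.mono le_rfl le_rfl ?_)
  rintro τ₄ ⟨⟨f21, fm, fm'⟩, ff⟩
  have ff : ∀ i ≤ 20, τ₄.reg i = τ₃.reg i := fun i hi =>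
    ff i (by simp [filterP, block, Prog.writes]; omega)
  change τ₄.reg 21 = S.buf + (S.sampleV (j - S.lam)).length at f21
  change Holds τ₄.mem S.buf (S.sampleV (j - S.lam)) at fm
  have fR : S.Ready τ₄ := dR.congr (fun i hi => ff i (by omega)) fm'
  refine Ends.seq (t₁ := 9) (t₂ := S.innerTime - (17 * S.vs.length + 34)) (q₁ := 0)
    (q₂ := S.bud * S.len) (Ends.simple rfl ?_)
  have e3 : BinOp.sub.eval e.width (S.buf + (S.sampleV (j - S.lam)).length) S.buf =
      (S.sampleV (j - S.lam)).length := by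
    rw [BinOp.eval_sub (by omega) (by omega)]; omega
  generalize hτ₅ : e.act _ τ₄ = τ₅
  have k21 : τ₅.reg 21 = S.buf + (S.sampleV (j - S.lam)).length := by
    simp [← hτ₅, block, Env.act, St.put, f21]
  have k22 : τ₅.reg 22 = (S.sampleV (j - S.lam)).length := by
    simp [← hτ₅, block, Env.act, St.put, fR.r7, f21, e3]
  have k30 : τ₅.reg 30 = 0 := by simp [← hτ₅, block, Env.act, St.put]
  have k31 : τ₅.reg 31 = S.base := by simp [← hτ₅, block, Env.act, St.put, fR.r6]
  have k32 : τ₅.reg 32 = S.us.length := by simp [← hτ₅, block, Env.act, St.put, fR.r0]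
  have k33 : τ₅.reg 33 = g - (j + S.kap) := by
    simp [← hτ₅, block, Env.act, St.put, ff, df, c20]
  have km : τ₅.mem = τ₄.mem := by simp [← hτ₅, block, Env.act, St.put]
  have kf : ∀ i ≤ 20, τ₅.reg i = τ₄.reg i := fun i hi => by
    have h1 : i ≠ 22 := by omega
    have h2 : i ≠ 30 := by omega
    have h3 : i ≠ 31 := by omega
    have h4 : i ≠ 32 := by omega
    have h5 : i ≠ 33 := by omega
    simp [← hτ₅, block, Env.act, St.put, h1, h2, h3, h4, h5]
  clear hτ₅
  have kR : S.Ready τ₅ := fR.congr (fun i hi => kf i (by omega)) fun x _ => by rw [km]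
  have hlev := kR.levels
  rw [List.map_append, Holds.append, List.length_map] at hlev
  refine Ends.seq (t₁ := 17 * S.us.length + 1) (t₂ := S.innerTime - (17 * S.n + 36))
    (q₁ := 0) (q₂ := S.bud * S.len)
    ((filterP_ends (l := S.us) (lv := S.lv) (a := 0) (b := S.base)
      (c := S.buf + (S.sampleV (j - S.lam)).length) (th := g - (j + S.kap)) hw (by omega)
      (by omega) (by omega) (Holds.append.1 kR.input).1 hlev.1 kR.r4 k30 k31 k32 k33
      k21).frame.mono le_rfl le_rfl ?_)
  rintro τ₆ ⟨⟨u21, um, um'⟩, uf⟩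
  have uf : ∀ i, (i ≤ 20 ∨ i = 22) → τ₆.reg i = τ₅.reg i := fun i hi =>
    uf i (by simp [filterP, block, Prog.writes]; omega)
  change τ₆.reg 21 = S.buf + (S.sampleV (j - S.lam)).length +
    (S.sampleU (g - (j + S.kap))).length at u21
  change Holds τ₆.mem _ (S.sampleU (g - (j + S.kap))) at um
  have uR : S.Ready τ₆ := kR.congr (fun i hi => uf i (by omega)) fun x hx => um' x (by omega)
  have um2 : Holds τ₆.mem S.buf (S.sampleV (j - S.lam) ++ S.sampleU (g - (j + S.kap))) := by
    refine Holds.append.2 ⟨fm.congr fun x _ hx => ?_, um⟩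
    rw [um' x hx, km]
  refine Ends.seq (t₁ := 3) (t₂ := S.innerTime - (17 * S.n + 40)) (q₁ := 0)
    (q₂ := S.bud * S.len) (Ends.simple rfl ?_)
  have e4 : BinOp.sub.eval e.width (S.buf + (S.sampleV (j - S.lam)).length +
      (S.sampleU (g - (j + S.kap))).length) S.buf =
      (S.sampleV (j - S.lam) ++ S.sampleU (g - (j + S.kap))).length := by
    rw [BinOp.eval_sub (by omega) (by omega), List.length_append]; omega
  generalize hτ₇ : e.act _ τ₆ = τ₇
  have v23 : τ₇.reg 23 = (S.sampleV (j - S.lam) ++ S.sampleU (g - (j + S.kap))).length := by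
    simp [← hτ₇, block, Env.act, St.put, u21, uR.r7, e4]
  have v24 : τ₇.reg 24 = S.bud := by simp [← hτ₇, block, Env.act, St.put, uR.r11]
  have vm : τ₇.mem = τ₆.mem := by simp [← hτ₇, block, Env.act, St.put]
  have vf : ∀ i ≤ 22, τ₇.reg i = τ₆.reg i := fun i hi => by
    have h1 : i ≠ 23 := by omega
    have h2 : i ≠ 24 := by omega
    simp [← hτ₇, block, Env.act, St.put, h1, h2]
  clear hτ₇
  have vR : S.Ready τ₇ := uR.congr (fun i hi => vf i (by omega)) fun x _ => by rw [vm]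
  have vfr : ∀ i ≤ 18, τ₇.reg i = σ.reg i := fun i hi => by
    rw [vf i (by omega), uf i (by omega), kf i (by omega), ff i (by omega), dfr i hi]
  have hV : (S.sampleV (j - S.lam)).toFinset ⊆ S.G.V := fun x hx => by
    rw [← hS.vs_eq]
    simp only [Setting.sampleV, List.mem_toFinset, List.mem_filter] at hx ⊢
    exact hx.1
  have hU : ∀ x ∈ S.sampleU (g - (j + S.kap)), x ∈ S.G.U := fun x hx => by
    rw [← hS.us_eq, List.mem_toFinset]
    exact (List.mem_filter.1 hx).1
  have h16 := vfr 16 (by norm_num)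
  have := roundsP_ends (j := j) (s := g - (j + S.kap)) hS vR hV hU
    (by rw [List.length_append]; omega) (by rw [vm]; exact um2)
    ((vfr 17 (by norm_num)).trans h17)
    (by rw [vf _ (by omega), uf _ (by omega), kf _ (by omega), ff _ (by omega), df _ (by omega), c20])
    (by rw [vf _ (by omega), uf _ (by omega), k22]) v23 v24 (by rw [h16]; exact hacc)
  rw [h16] at this
  exact this.mono (by omega) le_rfl fun _ => id

/-! ### Overflow bounds and the loop over guesses -/

namespace Setting

/-- The estimate for the guess `2 ^ g` if no search runs out of budget. -/
def estimate (S : Setting) (g : ℕ) : ℕ := ∑ j ∈ Finset.range S.len, S.massAt g j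

/-- There are fewer than 2^len vertices, each with degree below 2^len and weight at most 2^(2 len).
This holds for every outcome of the coins, so the program never overflows, even on bad levels. -/
theorem Valid.massAt_le {S : Setting} {e : Env} (h : S.Valid e) {g j : ℕ} (hg : g < 2 * S.len) :
    S.massAt g j ≤ 2 ^ (4 * S.len) := by
  have hshare : ∀ u, (if S.G.Touches (S.sampleV (j - S.lam)).toFinset u then
      S.G.share j (g - (j + S.kap)) u else 0) ≤ 2 ^ (3 * S.len) := by
    intro u
    have h1 : S.G.share j (g - (j + S.kap)) u ≤ 2 ^ (3 * S.len) := by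
      unfold BipGraph.share
      split_ifs
      · calc S.G.deg u * 2 ^ (g - (j + S.kap)) ≤ 2 ^ S.len * 2 ^ (2 * S.len) :=
              Nat.mul_le_mul (h.deg_lt u).le (Nat.pow_le_pow_right (by norm_num) (by omega))
          _ = 2 ^ (3 * S.len) := by rw [← pow_add]; congr 1; omega
      · exact Nat.zero_le _
    split_ifs
    exacts [h1, Nat.zero_le _]
  have hlen : (S.sampleU (g - (j + S.kap))).length ≤ 2 ^ S.len :=
    (List.length_filter_le _ _).trans ((Nat.le_add_right _ _).trans h.n_lt.le)
  have hsum := List.sum_le_card_nsmul ((S.sampleU (g - (j + S.kap))).map fun u =>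
    if S.G.Touches (S.sampleV (j - S.lam)).toFinset u then S.G.share j (g - (j + S.kap)) u else 0)
    (2 ^ (3 * S.len)) (by
      intro x hx
      obtain ⟨u, -, rfl⟩ := List.mem_map.1 hx
      exact hshare u)
  rw [List.length_map, smul_eq_mul] at hsum
  calc S.massAt g j ≤ (S.sampleU (g - (j + S.kap))).length * 2 ^ (3 * S.len) := hsum
    _ ≤ 2 ^ S.len * 2 ^ (3 * S.len) := Nat.mul_le_mul_right _ hlen
    _ = 2 ^ (4 * S.len) := by rw [← pow_add]; congr 1; omega

theorem Valid.sum_massAt_le {S : Setting} {e : Env} (h : S.Valid e) {g k : ℕ}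
    (hg : g < 2 * S.len) (hk : k ≤ S.len) :
    ∑ j ∈ Finset.range k, S.massAt g j ≤ 2 ^ (5 * S.len) :=
  calc ∑ j ∈ Finset.range k, S.massAt g j ≤ k * 2 ^ (4 * S.len) := by
        simpa using Finset.sum_le_card_nsmul (Finset.range k) (S.massAt g) (2 ^ (4 * S.len))
          fun j _ => h.massAt_le hg
    _ ≤ 2 ^ S.len * 2 ^ (4 * S.len) :=
        Nat.mul_le_mul_right _ (hk.trans Nat.lt_two_pow_self.le)
    _ = 2 ^ (5 * S.len) := by rw [← pow_add]; congr 1; omega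

end Setting

/-- The last of the values `est 0, …, est (g - 1)` with `2 ^ i ≤ 2 * est i`, or `0` if there is
none. -/
def lastAccepted (est : ℕ → ℕ) : ℕ → ℕ
  | 0 => 0
  | g + 1 => if 2 * est g < 2 ^ g then lastAccepted est g else est g

theorem lastAccepted_congr {est est' : ℕ → ℕ} {g : ℕ} (h : ∀ i < g, est i = est' i) :
    lastAccepted est g = lastAccepted est' g := by
  induction g with
  | zero => rfl
  | succ g ih => rw [lastAccepted, lastAccepted, ih fun i hi => h i (by omega), h g (by omega)]

/-- Compute the estimate for the guess `2 ^ R[14]`, and move it to `R[13]` if it is accepted. -/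
def guessP : Prog :=
  .seq (block [.const 16 0, .const 17 0, .move 18 8])
  (.seq (.loop 18 (.seq innerP (block [.op .add 17 17 4, .op .sub 18 18 4])))
  (block [.op .add 28 16 16, .op .shl 29 4 14, .op .lt 28 28 29, .ite 28 .skip (.move 13 16),
    .op .add 14 14 4, .op .sub 15 15 4]))

theorem innerP_keeps : ∀ i ≤ 18, i ≠ 16 → i ∉ innerP.writes := by decide

/-- The computed value is known only if all budgets suffice; otherwise it is some `est` about which
nothing is claimed, since such guesses are overridden later. -/
theorem guessP_ends {e : Env} {S : Setting} {σ : St} {g k : ℕ}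
    (hS : S.Valid e) (hσ : S.Ready σ) (hg : g < 2 * S.len) (h14 : σ.reg 14 = g)
    (h15 : σ.reg 15 = k + 1) (hk : k < 2 * S.len) :
    Ends e guessP σ (S.len * (S.innerTime + 5) + 20) (S.len * (S.bud * S.len))
      fun σ' => S.Ready σ' ∧ σ'.reg 14 = g + 1 ∧ σ'.reg 15 = k ∧
        ∃ est, ((∀ j < S.len, S.hitsAt g j ≤ S.bud) → est = S.estimate g) ∧
          σ'.reg 13 = if 2 * est < 2 ^ g then σ.reg 13 else est := by
  have hw := hS.one_lt
  have h5 : 2 ^ (5 * S.len + 2) ≤ 2 ^ e.width := hS.two_pow_le (by omega)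
  rw [pow_add] at h5
  have hlw : 3 * S.len < 2 ^ e.width := by
    have h1 : S.len < 2 ^ S.len := Nat.lt_two_pow_self
    have h2 := hS.two_pow_le (k := S.len + 2) (by omega)
    rw [pow_add] at h2
    omega
  have h0 : 0 < 2 ^ (5 * S.len) := by positivity
  refine Ends.seq (t₁ := 5) (t₂ := S.len * (S.innerTime + 5) + 14) (q₁ := 0)
    (q₂ := S.len * (S.bud * S.len)) (Ends.simple rfl ?_)
  generalize hτ : e.act _ σ = τ
  have a16 : τ.reg 16 = 0 := by simp [← hτ, block, Env.act, St.put]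
  have a17 : τ.reg 17 = 0 := by simp [← hτ, block, Env.act, St.put]
  have a18 : τ.reg 18 = S.len := by simp [← hτ, block, Env.act, St.put, hσ.r8]
  have af : ∀ i ≤ 15, τ.reg i = σ.reg i := fun i hi => by
    have h1 : i ≠ 16 := by omega
    have h2 : i ≠ 17 := by omega
    have h3 : i ≠ 18 := by omega
    simp [← hτ, block, Env.act, St.put, h1, h2, h3]
  have am : τ.mem = σ.mem := by simp [← hτ, block, Env.act, St.put]
  clear hτ
  have aR : S.Ready τ := hσ.congr (fun i hi => af i (by omega)) fun x _ => by rw [am]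
  refine Ends.seq (t₁ := S.len * (S.innerTime + 5) + 1) (t₂ := 12)
    (q₁ := S.len * (S.bud * S.len)) (q₂ := 0) ?_
  refine (Ends.loop (t₁ := S.innerTime + 4) (q₁ := S.bud * S.len)
    (fun i τ' => ∃ j, j + i = S.len ∧ S.Ready τ' ∧ τ'.reg 17 = j ∧ τ'.reg 18 = i ∧
      (∀ i ≤ 15, τ'.reg i = σ.reg i) ∧
      τ'.reg 16 ≤ ∑ j' ∈ Finset.range j, S.massAt g j' ∧
      ((∀ j' < j, S.hitsAt g j' ≤ S.bud) → τ'.reg 16 = ∑ j' ∈ Finset.range j, S.massAt g j'))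
    ?_ ?_ S.len ?_ le_rfl le_rfl).mono le_rfl le_rfl ?_
  · rintro τ' ⟨j, -, -, -, h, -⟩
    exact h
  · rintro i τ₁ ⟨j, hji, bR, b17, b18, bf, ble, beq⟩
    refine ⟨by omega, ?_⟩
    have hsum := hS.sum_massAt_le hg (k := j + 1) (by omega)
    rw [Finset.sum_range_succ] at hsum
    refine Ends.seq (t₁ := S.innerTime) (t₂ := 3) (q₁ := S.bud * S.len) (q₂ := 0)
      ((innerP_ends hS bR hg (by omega) ((bf 14 (by norm_num)).trans h14) b17
        (by omega)).frame.mono le_rfl le_rfl ?_)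
    rintro τ₂ ⟨⟨cR, cle, ceq⟩, cf⟩
    have cf : ∀ i ≤ 18, i ≠ 16 → τ₂.reg i = τ₁.reg i := fun i hi hi' => cf i (innerP_keeps i hi hi')
    have e1 : BinOp.add.eval e.width j 1 = j + 1 := BinOp.eval_add (by omega)
    have e2 : BinOp.sub.eval e.width (i + 1) 1 = i := by
      rw [BinOp.eval_sub (by omega) (by omega)]; rfl
    refine Ends.simple rfl ?_
    generalize hτ₃ : e.act _ τ₂ = τ₃
    have d17 : τ₃.reg 17 = j + 1 := by
      simp [← hτ₃, block, Env.act, St.put, cf, b17, bR.r4, e1]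
    have d18 : τ₃.reg 18 = i := by
      simp [← hτ₃, block, Env.act, St.put, cf, b18, bR.r4, e2]
    have df : ∀ i ≤ 16, τ₃.reg i = τ₂.reg i := fun i hi => by
      have h2 : i ≠ 17 := by omega
      have h3 : i ≠ 18 := by omega
      simp [← hτ₃, block, Env.act, St.put, h2, h3]
    have dm : τ₃.mem = τ₂.mem := by simp [← hτ₃, block, Env.act, St.put]
    clear hτ₃
    refine ⟨j + 1, by omega, cR.congr (fun i hi => df i (by omega)) fun x _ => by rw [dm], d17, d18,
      fun i hi => ?_, ?_, fun h => ?_⟩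
    · rw [df i (by omega), cf i (by omega) (by omega), bf i hi]
    · rw [df 16 le_rfl, Finset.sum_range_succ]
      omega
    · rw [df 16 le_rfl, Finset.sum_range_succ, ceq (h j (by omega)), beq fun j' hj' => h j' (by omega)]
  · exact ⟨0, by omega, aR, a17, a18, af, by simp [a16], by simp [a16]⟩
  · rintro τ₁ ⟨j, hj, bR, b17, b18, bf, ble, beq⟩
    obtain rfl : j = S.len := by omega
    have hsum := hS.sum_massAt_le hg (k := S.len) le_rfl
    have hpow : 2 ^ g < 2 ^ e.width :=
      lt_of_lt_of_le (Nat.pow_lt_pow_right (by norm_num) (by omega : g < 2 * S.len + 1))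
        (hS.two_pow_le (by omega))
    have e1 : BinOp.add.eval e.width (τ₁.reg 16) (τ₁.reg 16) = 2 * τ₁.reg 16 := by
      rw [BinOp.eval_add (by omega)]; omega
    have e2 : BinOp.shl.eval e.width 1 g = 2 ^ g := by rw [BinOp.eval_shl (by omega)]; omega
    have e3 : BinOp.add.eval e.width g 1 = g + 1 := BinOp.eval_add (by omega)
    have e4 : BinOp.sub.eval e.width (k + 1) 1 = k := by
      rw [BinOp.eval_sub (by omega) (by omega)]; rfl
    have b14 := (bf 14 (by norm_num)).trans h14
    have b15 := (bf 15 (by norm_num)).trans h15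
    have b13 := bf 13 (by norm_num)
    refine (Ends.simple (p := block _) (t := 12) (q := 0) (Q := fun σ' => (σ'.reg 14 = g + 1 ∧
      σ'.reg 15 = k ∧ σ'.reg 13 = if 2 * τ₁.reg 16 < 2 ^ g then σ.reg 13 else τ₁.reg 16) ∧
      σ'.mem = τ₁.mem) rfl ?_).frame.mono le_rfl le_rfl ?_
    · by_cases h : 2 * τ₁.reg 16 < 2 ^ g
      · simp [block, Env.act, St.put, b14, b15, b13, bR.r4, e1, e2, e3, e4, BinOp.eval_lt hw, h]
      · simp [block, Env.act, St.put, b14, b15, bR.r4, e1, e2, e3, e4, BinOp.eval_lt hw, h]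
    · rintro τ₂ ⟨⟨⟨c14, c15, c13⟩, cm⟩, cf⟩
      exact ⟨bR.congr (fun i hi => cf i (by simp [block, Prog.writes]; omega)) fun x _ => by rw [cm],
        c14, c15, _, beq, c13⟩

/-- Run through all guesses, and return the last estimate that is accepted. -/
def searchAllP : Prog :=
  .seq (block [.const 13 0, .const 14 0, .op .add 15 8 8])
  (.seq (.loop 15 guessP) (block [.move 0 13, .const 1 1]))

theorem searchAllP_ends {e : Env} {S : Setting} {σ : St} (hS : S.Valid e) (hσ : S.Ready σ) :
    Ends e searchAllP σ (2 * S.len * (S.len * (S.innerTime + 5) + 21) + 11)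
      (2 * S.len * (S.len * (S.bud * S.len)))
      fun σ' => σ'.reg 1 = 1 ∧ ∃ est : ℕ → ℕ,
        (∀ g < 2 * S.len, (∀ j < S.len, S.hitsAt g j ≤ S.bud) → est g = S.estimate g) ∧
        σ'.reg 0 = lastAccepted est (2 * S.len) := by
  have hw := hS.one_lt
  have hlw : 3 * S.len < 2 ^ e.width := by
    have h1 : S.len < 2 ^ S.len := Nat.lt_two_pow_self
    have h2 := hS.two_pow_le (k := S.len + 2) (by omega)
    rw [pow_add] at h2
    omega
  refine Ends.seq (t₁ := 5) (t₂ := 2 * S.len * (S.len * (S.innerTime + 5) + 21) + 5) (q₁ := 0)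
    (q₂ := 2 * S.len * (S.len * (S.bud * S.len))) (Ends.simple rfl ?_)
  have e1 : BinOp.add.eval e.width S.len S.len = 2 * S.len := by
    rw [BinOp.eval_add (by omega)]; omega
  generalize hτ : e.act _ σ = τ
  have a13 : τ.reg 13 = 0 := by simp [← hτ, block, Env.act, St.put]
  have a14 : τ.reg 14 = 0 := by simp [← hτ, block, Env.act, St.put]
  have a15 : τ.reg 15 = 2 * S.len := by simp [← hτ, block, Env.act, St.put, hσ.r8, e1]
  have af : ∀ i ≤ 12, τ.reg i = σ.reg i := fun i hi => by
    have h1 : i ≠ 13 := by omega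
    have h2 : i ≠ 14 := by omega
    have h3 : i ≠ 15 := by omega
    simp [← hτ, block, Env.act, St.put, h1, h2, h3]
  have am : τ.mem = σ.mem := by simp [← hτ, block, Env.act, St.put]
  clear hτ
  have aR : S.Ready τ := hσ.congr (fun i hi => af i (by omega)) fun x _ => by rw [am]
  refine Ends.seq (t₁ := 2 * S.len * (S.len * (S.innerTime + 5) + 21) + 1) (t₂ := 3)
    (q₁ := 2 * S.len * (S.len * (S.bud * S.len))) (q₂ := 0) ?_
  refine (Ends.loop (t₁ := S.len * (S.innerTime + 5) + 20) (q₁ := S.len * (S.bud * S.len))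
    (fun k τ' => ∃ g, g + k = 2 * S.len ∧ S.Ready τ' ∧ τ'.reg 14 = g ∧ τ'.reg 15 = k ∧
      ∃ est : ℕ → ℕ, (∀ i < g, (∀ j < S.len, S.hitsAt i j ≤ S.bud) → est i = S.estimate i) ∧
        τ'.reg 13 = lastAccepted est g)
    ?_ ?_ (2 * S.len) ?_ le_rfl le_rfl).mono le_rfl le_rfl ?_
  · rintro τ' ⟨g, -, -, -, h, -⟩
    exact h
  · rintro k τ₁ ⟨g, hgk, bR, b14, b15, est, hest, b13⟩
    refine ⟨by omega, (guessP_ends hS bR (by omega) b14 b15 (by omega)).mono le_rfl le_rfl ?_⟩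
    rintro τ₂ ⟨cR, c14, c15, x, hx, c13⟩
    refine ⟨g + 1, by omega, cR, c14, c15, Function.update est g x, fun i hi h => ?_, ?_⟩
    · by_cases hig : i = g
      · subst hig
        rw [Function.update_self, hx h]
      · rw [Function.update_of_ne hig, hest i (by omega) h]
    · rw [lastAccepted, Function.update_self, c13, b13, lastAccepted_congr (est := est)
        (est' := Function.update est g x) fun i hi => (Function.update_of_ne hi.ne _ _).symm]
  · exact ⟨0, by omega, aR, a14, a15, fun _ => 0, by simp, by simpa [lastAccepted] using a13⟩
  · rintro τ₁ ⟨g, hg, bR, b14, b15, est, hest, b13⟩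
    obtain rfl : g = 2 * S.len := by omega
    refine Ends.simple rfl ⟨?_, est, hest, ?_⟩
    · simp [block, Env.act, St.put, Nat.mod_eq_of_lt hw]
    · simpa [block, Env.act, St.put] using b13

/-! ### Random levels and the complete parameter choice -/

/-- The number of leading `true`s among the first `k` coins. -/
def lead (c : ℕ → Bool) : ℕ → ℕ
  | 0 => 0
  | k + 1 => lead c k + if ∀ i < k + 1, c i = true then 1 else 0

theorem lead_le (c : ℕ → Bool) (k : ℕ) : lead c k ≤ k := by
  induction k with
  | zero => exact le_rfl
  | succ k ih => rw [lead]; split_ifs <;> omega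

theorem lead_eq {c : ℕ → Bool} {k : ℕ} (h : ∀ i < k, c i = true) : lead c k = k := by
  induction k with
  | zero => rfl
  | succ k ih => rw [lead, if_pos h, ih fun i hi => h i (by omega)]

/-- A threshold on the level is an event about the first s coins only; this gives the sampling rate
2^(-s). -/
theorem le_lead {c : ℕ → Bool} {k s : ℕ} (hs : s ≤ k) : s ≤ lead c k ↔ ∀ i < s, c i = true := by
  induction k with
  | zero =>
    obtain rfl : s = 0 := by omega
    simp
  | succ k ih =>
    have hle := lead_le c k
    by_cases hall : ∀ i < k + 1, c i = true
    · rw [lead_eq hall]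
      exact ⟨fun _ i hi => hall i (by omega), fun _ => hs⟩
    · rw [lead, if_neg hall, Nat.add_zero]
      rcases hs.lt_or_eq with h | rfl
      · exact ih (by omega)
      · exact ⟨fun h => by omega, fun h => absurd h hall⟩

theorem lead_congr {c c' : ℕ → Bool} {k : ℕ} (h : ∀ i < k, c i = c' i) : lead c k = lead c' k := by
  induction k with
  | zero => rfl
  | succ k ih =>
    rw [lead, lead, ih fun i hi => h i (by omega)]
    congr 1
    refine if_congr (forall₂_congr fun i hi => ?_) rfl rfl
    rw [h i hi]

/-- Toss `R[12]` coins, and write the number of leading heads into `R[33]`. -/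
def leadP : Prog :=
  .seq (block [.const 32 1, .const 33 0, .move 34 12])
    (.loop 34 (block [.toss 35, .op .mul 32 32 35, .op .add 33 33 32, .op .sub 34 34 4]))

theorem leadP_ends {e : Env} {σ : St} {L : ℕ} (hw : 1 < 2 ^ e.width) (hL : L < 2 ^ e.width)
    (h4 : σ.reg 4 = 1) (h12 : σ.reg 12 = L) :
    Ends e leadP σ (8 * L + 7) 0 fun σ' =>
      σ'.reg 33 = lead (fun l => e.coin (σ.tossed + l)) L ∧ σ'.tossed = σ.tossed + L := by
  refine Ends.seq (t₁ := 5) (t₂ := 8 * L + 1) (q₁ := 0) (q₂ := 0) (Ends.simple rfl ?_)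
  -- Register 32 is the product of the coins so far, so it contributes 1 exactly while all of them
  -- are heads. All L coins are tossed even after the first tail.
  refine (Ends.loop (t₁ := 7) (q₁ := 0) (fun k τ => ∃ m, m + k = L ∧ τ.reg 4 = 1 ∧
    τ.reg 32 = (if ∀ i < m, e.coin (σ.tossed + i) = true then 1 else 0) ∧
    τ.reg 33 = lead (fun l => e.coin (σ.tossed + l)) m ∧ τ.reg 34 = k ∧
    τ.tossed = σ.tossed + m) ?_ ?_ L ?_).mono le_rfl le_rfl ?_
  · rintro τ ⟨m, -, -, -, -, h, -⟩
    exact h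
  · rintro k τ ⟨m, hm, t4, t32, t33, t34, tt⟩
    refine ⟨by omega, Ends.simple rfl ⟨m + 1, by omega, ?_⟩⟩
    have hle := lead_le (fun l => e.coin (σ.tossed + l)) m
    have e1 : BinOp.sub.eval e.width (k + 1) 1 = k := by
      rw [BinOp.eval_sub (by omega) (by omega)]; rfl
    have e2 : (e.coin (σ.tossed + m)).toNat % 2 ^ e.width = (e.coin (σ.tossed + m)).toNat :=
      Nat.mod_eq_of_lt ((Bool.toNat_le _).trans_lt hw)
    have e3 : BinOp.mul.eval e.width
        (if ∀ i < m, e.coin (σ.tossed + i) = true then 1 else 0) (e.coin (σ.tossed + m)).toNat =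
        if ∀ i < m + 1, e.coin (σ.tossed + i) = true then 1 else 0 := by
      have hb := Bool.toNat_le (e.coin (σ.tossed + m))
      rw [BinOp.eval_mul (by split_ifs <;> omega)]
      simp only [Nat.forall_lt_succ_right]
      cases e.coin (σ.tossed + m) <;> simp
    have e4 : BinOp.add.eval e.width (lead (fun l => e.coin (σ.tossed + l)) m)
        (if ∀ i < m + 1, e.coin (σ.tossed + i) = true then 1 else 0) =
        lead (fun l => e.coin (σ.tossed + l)) (m + 1) :=
      BinOp.eval_add (by split_ifs <;> omega)
    have h1 : (e.act (block [.toss 35, .op .mul 32 32 35, .op .add 33 33 32, .op .sub 34 34 4])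
        τ).reg 32 = if ∀ i < m + 1, e.coin (σ.tossed + i) = true then 1 else 0 := by
      rw [← e3, ← t32]
      simp [block, Env.act, St.put, tt, e2]
    have h2 : (e.act (block [.toss 35, .op .mul 32 32 35, .op .add 33 33 32, .op .sub 34 34 4])
        τ).reg 33 = lead (fun l => e.coin (σ.tossed + l)) (m + 1) := by
      rw [← e4, ← e3, ← t32, ← t33]
      simp [block, Env.act, St.put, tt, e2]
    refine ⟨?_, h1, h2, ?_, ?_⟩
    · simp [block, Env.act, St.put, t4]
    · simp [block, Env.act, St.put, t4, t34, e1]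
    · simp [block, Env.act, St.put, tt, Nat.add_assoc]
  · refine ⟨0, by omega, ?_⟩
    simp [block, Env.act, St.put, h4, h12, lead, Nat.mod_eq_of_lt hw]
  · rintro τ ⟨m, hm, t4, t32, t33, t34, tt⟩
    obtain rfl : m = L := by omega
    exact ⟨t33, tt⟩

/-- Write a level, the number of leading heads among `R[12]` coins, for each of `R[5]` vertices
into the array at address `R[6]`. -/
def levelsP : Prog :=
  .seq (block [.move 30 6, .move 31 5])
    (.loop 31 (.seq leadP (block [.store 30 33, .op .add 30 30 4, .op .sub 31 31 4])))

/-- Since each vertex consumes exactly L coins, vertex i owns the disjoint block of coins from i L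
on; this is the source of independence. -/
theorem levelsP_ends {e : Env} {σ : St} {a n L : ℕ} (hw : 1 < 2 ^ e.width)
    (hL : L < 2 ^ e.width) (ha : a + n < 2 ^ e.width) (h4 : σ.reg 4 = 1) (h5 : σ.reg 5 = n)
    (h6 : σ.reg 6 = a) (h12 : σ.reg 12 = L) (ht : σ.tossed = 0) :
    Ends e levelsP σ (n * (8 * L + 14) + 5) 0 fun σ' => (∀ x < a, σ'.mem x = σ.mem x) ∧
      ∀ i < n, σ'.mem (a + i) = lead (fun l => e.coin (i * L + l)) L := by
  refine Ends.seq (t₁ := 3) (t₂ := n * (8 * L + 14) + 1) (q₁ := 0) (q₂ := 0) (Ends.simple rfl ?_)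
  refine (Ends.loop (t₁ := 8 * L + 13) (q₁ := 0) (fun k τ => ∃ m, m + k = n ∧ τ.reg 4 = 1 ∧
    τ.reg 12 = L ∧ τ.reg 30 = a + m ∧ τ.reg 31 = k ∧ τ.tossed = m * L ∧
    (∀ x < a, τ.mem x = σ.mem x) ∧
    ∀ i < m, τ.mem (a + i) = lead (fun l => e.coin (i * L + l)) L) ?_ ?_ n ?_ le_rfl
    (by omega)).mono le_rfl le_rfl ?_
  · rintro τ ⟨m, -, -, -, -, h, -⟩
    exact h
  · rintro k τ ⟨m, hm, t4, t12, t30, t31, tt, tm, tl⟩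
    refine ⟨by omega, ?_⟩
    refine Ends.seq (t₁ := 8 * L + 7) (t₂ := 5) (q₁ := 0) (q₂ := 0)
      (((leadP_ends hw hL t4 t12).frame.frame_mem rfl).mono le_rfl le_rfl ?_)
    rintro τ' ⟨⟨⟨u33, ut⟩, uf⟩, um⟩
    have uf : ∀ i ≤ 31, τ'.reg i = τ.reg i := fun i hi =>
      uf i (by simp [leadP, block, Prog.writes]; omega)
    have e1 : BinOp.sub.eval e.width (k + 1) 1 = k := by
      rw [BinOp.eval_sub (by omega) (by omega)]; rfl
    have e2 : BinOp.add.eval e.width (a + m) 1 = a + m + 1 := BinOp.eval_add (by omega)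
    rw [tt] at u33 ut
    refine Ends.simple rfl ⟨m + 1, by omega, ?_, ?_, ?_, ?_, ?_, fun x hx => ?_, fun i hi => ?_⟩
    · simp [block, Env.act, St.put, uf, t4]
    · simp [block, Env.act, St.put, uf, t12]
    · simp [block, Env.act, St.put, uf, t30, t4, e2, Nat.add_assoc]
    · simp [block, Env.act, St.put, uf, t31, t4, e1]
    · simp [block, Env.act, St.put, ut, Nat.succ_mul]
    · simp [block, Env.act, St.put, uf, t30]
      rw [Function.update_of_ne (by omega), um, tm x hx]
    · simp [block, Env.act, St.put, uf, t30, u33]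
      by_cases him : i = m
      · subst him
        rw [Function.update_self]
      · rw [Function.update_of_ne (by omega), um, tl i (by omega)]
  · refine ⟨0, by omega, ?_⟩
    simp [block, Env.act, St.put, h4, h5, h6, h12, ht]
  · rintro τ ⟨m, hm, -, -, -, -, -, tm, tl⟩
    obtain rfl : m = n := by omega
    exact ⟨tm, tl⟩

/-! ## The complete program -/

/-- The setting for `a` and `b` binary digits of the numerator and denominator of `ε`. -/
def Setting.ofInput (G : BipGraph) (us vs : List ℕ) (lv : ℕ → ℕ) (a b : ℕ) : Setting where
  G := G
  us := us
  vs := vs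
  lv := lv
  base := us.length + vs.length + a + b
  len := (us.length + vs.length).size
  -- Chosen so that `len` + 4 < 2^`lam` ≤ 2 (`len` + 4): large enough for the union bound over
  -- missed vertices, at logarithmic cost.
  lam := ((us.length + vs.length).size + 4).size
  -- Here t = min(b - a + 1, `len`). The exponent b - a + 1 satisfies 1 ≤ ε 2^(b-a+1) ≤ 4, and the
  -- cap at `len` keeps all numbers in one word. The offset 11 makes the Chebyshev bound for guess g
  -- equal to e(G) 2^(-g) / 64.
  kap := 2 * min (b - a + 1) (us.length + vs.length).size + 11
  -- `bud` = 64 `len` 2^(`kap` + `lam`) makes the Markov bounds for the `len` classes sum to e(G)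
  -- 2^(-g) / 64.
  bud := 64 * (us.length + vs.length).size *
    2 ^ (2 * min (b - a + 1) (us.length + vs.length).size + 11 +
      ((us.length + vs.length).size + 4).size)

/-- Compute the parameters from the lengths of the four parts of the input. -/
def setupP : Prog :=
  .seq (block [.const 4 1, .op .add 5 0 1, .op .add 6 5 2, .op .add 6 6 3, .op .add 7 6 5,
    .move 30 5])
  (.seq sizeP
  (.seq (block [.move 8 31, .const 28 4, .op .add 30 8 28])
  (.seq sizeP
  (.seq (block [.move 9 31, .op .sub 28 3 2, .op .add 28 28 4])
  (.seq (monusP 29 28 8)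
  (block [.op .sub 28 28 29, .const 29 11, .op .add 10 28 28, .op .add 10 10 29, .const 29 64,
    .op .mul 11 29 8, .op .add 28 10 9, .op .shl 11 11 28, .op .add 12 8 8]))))))

theorem size_add_four_le (l : ℕ) : (l + 4).size ≤ l + 3 := by
  rw [Nat.size_le]
  have : l < 2 ^ l := Nat.lt_two_pow_self
  rw [pow_add]
  omega

theorem bud_le {l t : ℕ} (ht : t ≤ l) :
    64 * l * 2 ^ (2 * t + 11 + (l + 4).size) ≤ 2 ^ (4 * l + 20) := by
  have h1 : l ≤ 2 ^ l := Nat.lt_two_pow_self.le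
  have h2 := size_add_four_le l
  calc 64 * l * 2 ^ (2 * t + 11 + (l + 4).size) ≤ 2 ^ 6 * 2 ^ l * 2 ^ (2 * l + 11 + (l + 3)) := by
        gcongr <;> norm_num
    _ = 2 ^ (4 * l + 20) := by rw [← pow_add, ← pow_add]; congr 1; omega

theorem Setting.ofInput_valid {e : Env} {G : BipGraph} {us vs : List ℕ} {lv : ℕ → ℕ} {a b : ℕ}
    (hadj : e.adj = G.adjOracle) (hindep : e.indep = G.indepOracle) (hus : us.Nodup)
    (hvs : vs.Nodup) (hU : us.toFinset = G.U) (hV : vs.toFinset = G.V)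
    (hroom : 5 * (us.length + vs.length + a + b) + 32 ≤ 2 ^ e.width)
    (hwidth : 6 * (us.length + vs.length).size + 24 ≤ e.width) :
    (Setting.ofInput G us vs lv a b).Valid e := by
  obtain ⟨S, hS⟩ : ∃ S, S = Setting.ofInput G us vs lv a b := ⟨_, rfl⟩
  rw [← hS]
  have hlen : S.len = (us.length + vs.length).size := by rw [hS]; rfl
  have hn : S.n = us.length + vs.length := by rw [hS]; rfl
  have hbase : S.base = us.length + vs.length + a + b := by rw [hS]; rfl
  have hlam := size_add_four_le S.len
  have hpow : 2 * S.len + 16 < 2 ^ (2 * S.len + 16) := Nat.lt_two_pow_self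
  refine ⟨by rw [hS]; exact hadj, by rw [hS]; exact hindep, by rw [hS]; exact hus,
    by rw [hS]; exact hvs, by rw [hS]; exact hU, by rw [hS]; exact hV, ?_, by omega, by omega,
    by omega, ?_, ?_⟩
  · rw [hlen, hn]
    exact Nat.lt_size_self _
  · have : S.kap = 2 * min (b - a + 1) S.len + 11 := by rw [hS]; rfl
    omega
  · have : S.bud = 64 * S.len * 2 ^ (2 * min (b - a + 1) S.len + 11 + (S.len + 4).size) := by
      rw [hS]; rfl
    rw [this]
    exact (bud_le (min_le_right _ _)).trans_lt (Nat.pow_lt_pow_right (by norm_num) (by omega))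

theorem setupP_ends {e : Env} {G : BipGraph} {us vs : List ℕ} {lv : ℕ → ℕ} {a b : ℕ} {σ : St}
    (h0 : σ.reg 0 = us.length) (h1 : σ.reg 1 = vs.length) (h2 : σ.reg 2 = a) (h3 : σ.reg 3 = b)
    (hab : a ≤ b) (hroom : 5 * (us.length + vs.length + a + b) + 32 ≤ 2 ^ e.width)
    (hwidth : 6 * (us.length + vs.length).size + 24 ≤ e.width) :
    Ends e setupP σ (8 * (us.length + vs.length).size + 80) 0 fun σ' =>
      (∀ S, S = Setting.ofInput G us vs lv a b → σ'.reg 0 = us.length ∧ σ'.reg 1 = vs.length ∧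
        σ'.reg 4 = 1 ∧ σ'.reg 5 = S.n ∧
        σ'.reg 6 = S.base ∧ σ'.reg 7 = S.buf ∧ σ'.reg 8 = S.len ∧ σ'.reg 9 = S.lam ∧
        σ'.reg 10 = S.kap ∧ σ'.reg 11 = S.bud ∧ σ'.reg 12 = 2 * S.len) ∧
      σ'.mem = σ.mem ∧ σ'.tossed = σ.tossed := by
  set n := us.length + vs.length with hn
  have hl1 : n.size < 2 ^ n.size := Nat.lt_two_pow_self
  have hl2 : n.size ≤ n := by
    rw [Nat.size_le]
    exact Nat.lt_two_pow_self
  have hw : 1 < 2 ^ e.width := by omega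
  have hlam := size_add_four_le n.size
  have hpw : 2 ^ (4 * n.size + 20) < 2 ^ e.width := Nat.pow_lt_pow_right (by norm_num) (by omega)
  have hbud := bud_le (t := min (b - a + 1) n.size) (min_le_right _ _)
  have ht1 := min_le_right (b - a + 1) n.size
  -- The minimum of x and y is computed as x - (x - y) with truncated subtraction.
  have ht2 : b - a + 1 - (b - a + 1 - n.size) = min (b - a + 1) n.size := by omega
  refine Ends.seq (t₁ := 11) (t₂ := 8 * n.size + 68) (q₁ := 0) (q₂ := 0) (Ends.simple rfl ?_)
  have e1 : BinOp.add.eval e.width us.length vs.length = n := BinOp.eval_add (by omega)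
  have e2 : BinOp.add.eval e.width n a = n + a := BinOp.eval_add (by omega)
  have e3 : BinOp.add.eval e.width (n + a) b = n + a + b := BinOp.eval_add (by omega)
  have e4 : BinOp.add.eval e.width (n + a + b) n = n + a + b + n := BinOp.eval_add (by omega)
  have e5 : 1 % 2 ^ e.width = 1 := Nat.mod_eq_of_lt hw
  generalize hτ : e.act _ σ = τ
  have a0 : τ.reg 0 = us.length := by simp [← hτ, block, Env.act, St.put, h0]
  have a1 : τ.reg 1 = vs.length := by simp [← hτ, block, Env.act, St.put, h1]
  have a2 : τ.reg 2 = a := by simp [← hτ, block, Env.act, St.put, h2]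
  have a3 : τ.reg 3 = b := by simp [← hτ, block, Env.act, St.put, h3]
  have a4 : τ.reg 4 = 1 := by simp [← hτ, block, Env.act, St.put, e5]
  have a5 : τ.reg 5 = n := by simp [← hτ, block, Env.act, St.put, h0, h1, e1]
  have a6 : τ.reg 6 = n + a + b := by
    simp [← hτ, block, Env.act, St.put, h0, h1, h2, h3, e1, e2, e3]
  have a7 : τ.reg 7 = n + a + b + n := by
    simp [← hτ, block, Env.act, St.put, h0, h1, h2, h3, e1, e2, e3, e4]
  have a30 : τ.reg 30 = n := by simp [← hτ, block, Env.act, St.put, h0, h1, e1]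
  have am : τ.mem = σ.mem := by simp [← hτ, block, Env.act, St.put]
  have att : τ.tossed = σ.tossed := by simp [← hτ, block, Env.act, St.put]
  clear hτ e1 e2 e3 e4 h0 h1 h2 h3
  refine Ends.seq (t₁ := 4 * n.size + 3) (t₂ := 4 * n.size + 64) (q₁ := 0) (q₂ := 0)
    ((sizeP_ends (x := n) (by omega) a4 a30).frame.mono le_rfl le_rfl ?_)
  rintro τ₁ ⟨⟨b31, bm, bt⟩, bf⟩
  have bf : ∀ i ≤ 29, τ₁.reg i = τ.reg i := fun i hi => bf i (by simp [sizeP, Prog.writes]; omega)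
  refine Ends.seq (t₁ := 5) (t₂ := 4 * n.size + 58) (q₁ := 0) (q₂ := 0) (Ends.simple rfl ?_)
  have e1 : BinOp.add.eval e.width n.size 4 = n.size + 4 := BinOp.eval_add (by omega)
  have e2 : 4 % 2 ^ e.width = 4 := Nat.mod_eq_of_lt (by omega)
  generalize hτ : e.act _ τ₁ = τ₂
  have c8 : τ₂.reg 8 = n.size := by simp [← hτ, block, Env.act, St.put, b31]
  have c30 : τ₂.reg 30 = n.size + 4 := by simp [← hτ, block, Env.act, St.put, b31, e2, e1]
  have cf : ∀ i ≤ 7, τ₂.reg i = τ.reg i := fun i hi => by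
    have h1 : i ≠ 8 := by omega
    have h2 : i ≠ 28 := by omega
    have h3 : i ≠ 30 := by omega
    simp [← hτ, block, Env.act, St.put, h1, h2, h3]
    rw [bf i (by omega)]
  have cm : τ₂.mem = σ.mem := by simp [← hτ, block, Env.act, St.put, bm, am]
  have ct : τ₂.tossed = σ.tossed := by simp [← hτ, block, Env.act, St.put, bt, att]
  clear hτ e1 e2 bf bm bt b31 am att a30
  refine Ends.seq (t₁ := 4 * (n.size + 4).size + 3) (t₂ := 42) (q₁ := 0) (q₂ := 0)
    ((sizeP_ends (x := n.size + 4) (by omega) ((cf 4 (by omega)).trans a4) c30).frame.mono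
      le_rfl le_rfl ?_)
  rintro τ₃ ⟨⟨d31, dm, dt⟩, df⟩
  have df : ∀ i ≤ 29, τ₃.reg i = τ₂.reg i := fun i hi => df i (by simp [sizeP, Prog.writes]; omega)
  refine Ends.seq (t₁ := 5) (t₂ := 36) (q₁ := 0) (q₂ := 0) (Ends.simple rfl ?_)
  have e1 : BinOp.sub.eval e.width b a = b - a := BinOp.eval_sub (by omega) (by omega)
  have e2 : BinOp.add.eval e.width (b - a) 1 = b - a + 1 := BinOp.eval_add (by omega)
  generalize hτ : e.act _ τ₃ = τ₄
  have k9 : τ₄.reg 9 = (n.size + 4).size := by simp [← hτ, block, Env.act, St.put, d31]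
  have k28 : τ₄.reg 28 = b - a + 1 := by
    simp [← hτ, block, Env.act, St.put, df, cf, a2, a3, a4, e1, e2]
  have kf : ∀ i ≤ 8, τ₄.reg i = τ₂.reg i := fun i hi => by
    have h1 : i ≠ 9 := by omega
    have h2 : i ≠ 28 := by omega
    simp [← hτ, block, Env.act, St.put, h1, h2]
    rw [df i (by omega)]
  have km : τ₄.mem = σ.mem := by simp [← hτ, block, Env.act, St.put, dm, cm]
  have kt : τ₄.tossed = σ.tossed := by simp [← hτ, block, Env.act, St.put, dt, ct]
  clear hτ e1 e2 df dm dt d31 cm ct c30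
  refine Ends.seq (t₁ := 4) (t₂ := 31) (q₁ := 0) (q₂ := 0)
    (((monusP_ends (x := b - a + 1) (y := n.size) hw (by norm_num) (by norm_num) k28
      ((kf 8 le_rfl).trans c8) (by omega)).mono le_rfl le_rfl ?_))
  rintro τ₅ ⟨⟨u29, um, ut⟩, uf⟩
  refine Ends.simple rfl ⟨?_, ?_, ?_⟩
  · rintro S rfl
    have u28 := (uf 28 (by norm_num)).trans k28
    have u8 : τ₅.reg 8 = n.size := by rw [uf 8 (by norm_num), kf 8 le_rfl, c8]
    have u9 : τ₅.reg 9 = (n.size + 4).size := by rw [uf 9 (by norm_num), k9]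
    have uf : ∀ i ≤ 7, τ₅.reg i = τ.reg i := fun i hi => by
      rw [uf i (by omega), kf i (by omega), cf i hi]
    have e1 : BinOp.sub.eval e.width (b - a + 1) (b - a + 1 - n.size) =
        min (b - a + 1) n.size := by
      rw [BinOp.eval_sub (by omega) (by omega), ht2]
    generalize hT : min (b - a + 1) n.size = T at *
    have e2 : BinOp.add.eval e.width T T = 2 * T := by rw [BinOp.eval_add (by omega)]; omega
    have e3 : BinOp.add.eval e.width (2 * T) 11 = 2 * T + 11 := BinOp.eval_add (by omega)
    have e4 : BinOp.mul.eval e.width 64 n.size = 64 * n.size := by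
      refine BinOp.eval_mul (lt_of_le_of_lt ?_ hpw)
      exact (Nat.le_mul_of_pos_right _ (by positivity)).trans hbud
    have e5' : BinOp.add.eval e.width (2 * T + 11) (n.size + 4).size =
        2 * T + 11 + (n.size + 4).size := BinOp.eval_add (by omega)
    have e6 : BinOp.shl.eval e.width (64 * n.size) (2 * T + 11 + (n.size + 4).size) =
        64 * n.size * 2 ^ (2 * T + 11 + (n.size + 4).size) :=
      BinOp.eval_shl (hbud.trans_lt hpw)
    have e7 : BinOp.add.eval e.width n.size n.size = 2 * n.size := by
      rw [BinOp.eval_add (by omega)]; omega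
    have e8 : 11 % 2 ^ e.width = 11 := Nat.mod_eq_of_lt (by omega)
    have e9 : 64 % 2 ^ e.width = 64 := by
      refine Nat.mod_eq_of_lt (lt_of_lt_of_le ?_ hpw.le)
      exact lt_of_lt_of_le (by norm_num : 64 < 2 ^ 20) (Nat.pow_le_pow_right (by norm_num) (by omega))
    simp [block, Env.act, St.put, Setting.ofInput, Setting.n, Setting.buf, ← hn, hT, uf, u8, u9,
      u28, u29, a0, a1, a4, a5, a6, a7, e1, e2, e3, e4, e5', e6, e7, e8, e9]
  · simp [block, Env.act, St.put, um, km]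
  · simp [block, Env.act, St.put, ut, kt]

/-- The program: setup, tossing of all coins, and search. -/
def mainP : Prog := .seq setupP (.seq levelsP searchAllP)

/-- The levels of the vertices that are determined by a sequence of coins. -/
def levelOf (us vs : List ℕ) (coin : ℕ → Bool) (x : ℕ) : ℕ :=
  lead (fun l => coin ((us ++ vs).idxOf x * (2 * (us.length + vs.length).size) + l))
    (2 * (us.length + vs.length).size)

/-- A bound for the running time of `mainP`. -/
def Setting.totalTime (S : Setting) : ℕ :=
  2 * S.len * (S.len * (S.innerTime + 5) + 21) + S.n * (16 * S.len + 14) + 8 * S.len + 100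

theorem mainP_ends {e : Env} {G : BipGraph} {us vs : List ℕ} {a b : ℕ} {σ : St}
    (hadj : e.adj = G.adjOracle) (hindep : e.indep = G.indepOracle) (hus : us.Nodup)
    (hvs : vs.Nodup) (hU : us.toFinset = G.U) (hV : vs.toFinset = G.V)
    (h0 : σ.reg 0 = us.length) (h1 : σ.reg 1 = vs.length) (h2 : σ.reg 2 = a) (h3 : σ.reg 3 = b)
    (ht : σ.tossed = 0) (hm : Holds σ.mem 0 (us ++ vs))
    (hab : a ≤ b) (hroom : 5 * (us.length + vs.length + a + b) + 32 ≤ 2 ^ e.width)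
    (hwidth : 6 * (us.length + vs.length).size + 24 ≤ e.width) {S : Setting}
    (hS : S = Setting.ofInput G us vs (levelOf us vs e.coin) a b) :
    Ends e mainP σ S.totalTime (2 * S.len * (S.len * (S.bud * S.len)))
      fun σ' => σ'.reg 1 = 1 ∧ ∃ est : ℕ → ℕ,
        (∀ g < 2 * S.len, (∀ j < S.len, S.hitsAt g j ≤ S.bud) → est g = S.estimate g) ∧
        σ'.reg 0 = lastAccepted est (2 * S.len) := by
  have hlen : S.len = (us.length + vs.length).size := by rw [hS]; rfl
  have hn : S.n = us.length + vs.length := by rw [hS]; rfl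
  have hbase : S.base = us.length + vs.length + a + b := by rw [hS]; rfl
  have hl2 : S.len ≤ S.n := by
    rw [hlen, hn, Nat.size_le]
    exact Nat.lt_two_pow_self
  have hlam := size_add_four_le S.len
  have hpow : 2 * S.len + 16 < 2 ^ (2 * S.len + 16) := Nat.lt_two_pow_self
  have hval : S.Valid e := by
    rw [hS]
    exact Setting.ofInput_valid hadj hindep hus hvs hU hV hroom hwidth
  refine Ends.seq (t₁ := 8 * S.len + 80) (t₂ := S.totalTime - (8 * S.len + 81)) (q₁ := 0)
    (q₂ := 2 * S.len * (S.len * (S.bud * S.len)))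
    (((setupP_ends (G := G) (lv := levelOf us vs e.coin) h0 h1 h2 h3 hab hroom hwidth).mono
      (by omega) le_rfl ?_)) (by unfold Setting.totalTime; omega)
  rintro τ ⟨hr, tm, tt⟩
  obtain ⟨a0, a1, a4, a5, a6, a7, a8, a9, a10, a11, a12⟩ := hr S hS
  refine Ends.seq (t₁ := S.n * (16 * S.len + 14) + 5)
    (t₂ := 2 * S.len * (S.len * (S.innerTime + 5) + 21) + 11)
    (q₁ := 0) (q₂ := 2 * S.len * (S.len * (S.bud * S.len)))
    (((levelsP_ends (a := S.base) (n := S.n) (L := 2 * S.len) hval.one_lt (by omega) (by omega)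
      a4 a5 a6 a12 (tt.trans ht)).frame.mono ?_ le_rfl ?_)) (by unfold Setting.totalTime; omega)
  · have : 8 * (2 * S.len) = 16 * S.len := by omega
    rw [this]
  rintro τ' ⟨⟨um, ul⟩, uf⟩
  have uf : ∀ i ≤ 29, τ'.reg i = τ.reg i := fun i hi =>
    uf i (by simp [levelsP, leadP, block, Prog.writes]; omega)
  refine searchAllP_ends hval ⟨?_, ?_, ?_, ?_, ?_, ?_, ?_, ?_, ?_, ?_, ?_⟩
  · rw [uf 0 (by omega), a0, hS]; rfl
  · rw [uf 1 (by omega), a1, hS]; rfl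
  · rw [uf 4 (by omega), a4]
  · rw [uf 6 (by omega), a6]
  · rw [uf 7 (by omega), a7]
  · rw [uf 8 (by omega), a8]
  · rw [uf 9 (by omega), a9]
  · rw [uf 10 (by omega), a10]
  · rw [uf 11 (by omega), a11]
  · have : S.us ++ S.vs = us ++ vs := by rw [hS]; rfl
    rw [this]
    refine hm.congr fun x _ hx => ?_
    rw [List.length_append] at hx
    rw [um x (by omega), tm]
  · have : S.us ++ S.vs = us ++ vs := by rw [hS]; rfl
    have hlv : S.lv = levelOf us vs e.coin := by rw [hS]; rfl
    rw [this, hlv]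
    have hnd : (us ++ vs).Nodup := List.nodup_append'.2 ⟨hus, hvs, fun x hx hx' =>
      Finset.disjoint_left.1 G.disjoint (hU ▸ List.mem_toFinset.2 hx)
        (hV ▸ List.mem_toFinset.2 hx')⟩
    intro i hi
    rw [List.length_map] at hi
    rw [ul i (by rw [List.length_append] at hi; omega), List.getElem_map, levelOf,
      hnd.idxOf_getElem i hi, ← hlen]

end WordRAM

/-! ### Degree classes and the idealised estimate -/

namespace BipGraph

variable (G : BipGraph)

/-- The index of the degree class of `u`. -/
def cls (u : ℕ) : ℕ := Nat.log 2 (G.deg u)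

/-- The estimate for the guess `2 ^ g` if all sampled vertices of `U` are found. -/
def ideal (lv : ℕ → ℕ) (kap g : ℕ) : ℕ :=
  ∑ u ∈ G.U, if g - (G.cls u + kap) ≤ lv u then G.deg u * 2 ^ (g - (G.cls u + kap)) else 0

/-- The number of edges between the vertices of `U` of level at least `s` and those of `V` of level
at least `t`. -/
def edgeHits (lv : ℕ → ℕ) (s t : ℕ) : ℕ := (G.E.filter fun x => s ≤ lv x.1 ∧ t ≤ lv x.2).card

/-- No neighbour of `u` is in the sample of `V` for the degree class of `u`. -/
def Missed (lv : ℕ → ℕ) (lam u : ℕ) : Prop :=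
  ∀ v ∈ G.V.filter fun v => (u, v) ∈ G.E, ¬ G.cls u - lam ≤ lv v

instance (lv : ℕ → ℕ) (lam u : ℕ) : Decidable (G.Missed lv lam u) := by
  unfold Missed; infer_instance

theorem sum_deg : ∑ u ∈ G.U, G.deg u = G.edgeCount := by
  rw [edgeCount, Finset.card_eq_sum_card_fiberwise (f := Prod.fst) (t := G.U)
    fun x hx => mem_U (Finset.mem_coe.1 hx)]
  refine Finset.sum_congr rfl fun u _ => ?_
  refine Finset.card_bij (fun v _ => (u, v)) ?_ ?_ ?_
  · intro v hv
    simpa using (Finset.mem_filter.1 hv).2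
  · intro v _ v' _ h
    exact (Prod.mk.inj h).2
  · rintro ⟨u', v⟩ h₀
    obtain ⟨h, h'⟩ := Finset.mem_filter.1 h₀
    obtain rfl : u' = _ := h'
    exact ⟨v, Finset.mem_filter.2 ⟨mem_V h, h⟩, rfl⟩

variable {G}

/-- The test of the program, a shift by j compared with 1, selects exactly the positive degrees in
one dyadic class. -/
theorem deg_div_eq_one {u j : ℕ} : G.deg u / 2 ^ j = 1 ↔ G.deg u ≠ 0 ∧ G.cls u = j := by
  have hp : 0 < 2 ^ j := by positivity
  rw [cls]
  constructor
  · intro h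
    have h1 : 2 ^ j ≤ G.deg u := by
      by_contra hcon
      rw [Nat.div_eq_of_lt (not_le.1 hcon)] at h
      exact zero_ne_one h
    have h2 : G.deg u < 2 ^ (j + 1) := by
      rw [pow_succ]
      have := Nat.lt_mul_div_succ (G.deg u) hp
      rw [h] at this
      omega
    exact ⟨by omega, Nat.log_eq_of_pow_le_of_lt_pow h1 h2⟩
  · rintro ⟨h, rfl⟩
    have h1 := Nat.pow_log_le_self 2 h
    have h2 := Nat.lt_pow_succ_log_self one_lt_two (G.deg u)
    rw [pow_succ] at h2
    exact Nat.div_eq_of_lt_le (by omega) (by omega)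

end BipGraph

namespace WordRAM.Setting

variable {S : Setting} {e : Env}

theorem Valid.mem_sampleV (hS : S.Valid e) {t v : ℕ} :
    v ∈ (S.sampleV t).toFinset ↔ v ∈ S.G.V ∧ t ≤ S.lv v := by
  rw [← hS.vs_eq]
  simp [sampleV]

theorem Valid.massAt_eq (hS : S.Valid e) (g j : ℕ) :
    S.massAt g j = ∑ u ∈ S.G.U, if g - (j + S.kap) ≤ S.lv u then
      (if S.G.Touches (S.sampleV (j - S.lam)).toFinset u then
        S.G.share j (g - (j + S.kap)) u else 0) else 0 := by
  rw [massAt, BipGraph.mass, sampleU, ← List.sum_toFinset _ (hS.us_nodup.filter _), List.toFinset_filter, hS.us_eq,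
    Finset.sum_filter]
  simp only [decide_eq_true_eq]

/-- Exchange the sums over classes and vertices: a vertex has nonzero share only in its own class,
and there it touches the V-sample unless it is missed. The class index is below `len`, so the loop
reaches it. -/
theorem Valid.estimate_eq (hS : S.Valid e) (g : ℕ)
    (h : ∀ u ∈ S.G.U, S.G.deg u ≠ 0 → ¬ S.G.Missed S.lv S.lam u) :
    S.estimate g = S.G.ideal S.lv S.kap g := by
  unfold estimate BipGraph.ideal
  simp_rw [hS.massAt_eq]
  rw [Finset.sum_comm]
  refine Finset.sum_congr rfl fun u hu => ?_
  by_cases hd : S.G.deg u = 0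
  · simp [BipGraph.share, hd]
  have hcls : S.G.cls u < S.len := Nat.log_lt_of_lt_pow hd (hS.deg_lt u)
  rw [Finset.sum_eq_single_of_mem (S.G.cls u) (Finset.mem_range.2 hcls)]
  · have ht : S.G.Touches (S.sampleV (S.G.cls u - S.lam)).toFinset u := by
      have := h u hu hd
      simp only [BipGraph.Missed, not_forall, not_not] at this
      obtain ⟨v, hv, hv'⟩ := this
      obtain ⟨hvV, huv⟩ := Finset.mem_filter.1 hv
      exact ⟨v, hS.mem_sampleV.2 ⟨hvV, hv'⟩, huv⟩
    rw [if_pos ht, BipGraph.share, if_pos (BipGraph.deg_div_eq_one.2 ⟨hd, rfl⟩)]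
  · intro j _ hj
    have : ¬ S.G.deg u / 2 ^ j = 1 := fun h' => hj (BipGraph.deg_div_eq_one.1 h').2.symm
    simp [BipGraph.share, this]

/-- Each vertex to be found is an endpoint of some edge between the two samples, and counting edges
has a simple expectation. -/
theorem Valid.hitsAt_le (hS : S.Valid e) (g j : ℕ) :
    S.hitsAt g j ≤ S.G.edgeHits S.lv (g - (j + S.kap)) (j - S.lam) := by
  rw [hitsAt, BipGraph.hits, sampleU, List.countP_eq_length_filter,
    ← List.toFinset_card_of_nodup ((hS.us_nodup.filter _).filter _), BipGraph.edgeHits]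
  refine (Finset.card_le_card fun u hu => ?_).trans (Finset.card_image_le (f := Prod.fst))
  simp only [List.mem_toFinset, List.mem_filter, decide_eq_true_eq] at hu
  obtain ⟨⟨_, hs⟩, v, hv, huv⟩ := hu
  exact Finset.mem_image.2 ⟨(u, v), Finset.mem_filter.2 ⟨huv, hs, (hS.mem_sampleV.1 hv).2⟩, rfl⟩

end WordRAM.Setting

/-! ### Selection of the guess -/

namespace WordRAM

/-- Nothing is assumed about guesses below m or about m + 1 and m + 2: since guesses are scanned
upwards, the last accepted one is at least m and below m + 3. -/
theorem exists_lastAccepted {est : ℕ → ℕ} {m N : ℕ} (hN : m < N) (hm : 2 ^ m ≤ 2 * est m)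
    (hrej : ∀ g, m + 3 ≤ g → g < N → 2 * est g < 2 ^ g) :
    ∃ g, m ≤ g ∧ g < N ∧ g ≤ m + 2 ∧ lastAccepted est N = est g := by
  induction N with
  | zero => omega
  | succ N ih =>
    rw [lastAccepted]
    by_cases h : N = m
    · subst h
      exact ⟨N, le_rfl, by omega, by omega, if_neg (by omega)⟩
    · split_ifs with hlt
      · obtain ⟨g, h1, h2, h3, h4⟩ := ih (by omega) fun g h h' => hrej g h (by omega)
        exact ⟨g, h1, by omega, h3, h4⟩
      · refine ⟨N, by omega, by omega, ?_, rfl⟩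
        by_contra hcon
        exact hlt (hrej N (by omega) (by omega))

theorem lastAccepted_eq_zero {est : ℕ → ℕ} {N : ℕ} (h : ∀ g < N, est g = 0) :
    lastAccepted est N = 0 := by
  induction N with
  | zero => rfl
  | succ N ih =>
    rw [lastAccepted, ih fun g hg => h g (by omega), h N (by omega)]
    exact ite_self _

end WordRAM

/-! ### Uniformly random functions and independence of the levels -/

section Expect

open Finset
open scoped BigOperators

/-- Independent coordinates of a uniformly random function. -/
theorem Fintype.expect_prod_apply {ι β : Type*} [Fintype ι] [DecidableEq ι] [Fintype β] [Nonempty β]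
    (f : ι → β → ℝ) : 𝔼 ω : ι → β, ∏ i, f i (ω i) = ∏ i, 𝔼 b, f i b := by
  simp_rw [Fintype.expect_eq_sum_div_card]
  rw [Finset.prod_div_distrib, ← Fintype.prod_sum]
  simp

/-- The restriction of a uniformly random function is uniformly random. -/
theorem Fintype.expect_comp_injective {ι κ β : Type*} [Fintype ι] [Fintype κ] [Fintype β]
    [DecidableEq ι] [DecidableEq κ] [Nonempty β] {φ : ι → κ} (hφ : Function.Injective φ)
    (F : (ι → β) → ℝ) : 𝔼 ω : κ → β, F (ω ∘ φ) = 𝔼 η : ι → β, F η := by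
  classical
  let e₁ : ι ⊕ ↥(Set.range φ)ᶜ ≃ κ :=
    (Equiv.sumCongr (Equiv.ofInjective φ hφ) (Equiv.refl _)).trans (Equiv.Set.sumCompl (Set.range φ))
  let e₂ : (κ → β) ≃ (ι → β) × (↥(Set.range φ)ᶜ → β) :=
    (Equiv.arrowCongr e₁.symm (Equiv.refl β)).trans (Equiv.sumArrowEquivProdArrow _ _ _)
  rw [Fintype.expect_equiv e₂ (fun ω => F (ω ∘ φ)) (fun x => F x.1) fun ω => rfl,
    ← Finset.univ_product_univ, Finset.expect_product]
  simp

end Expect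

namespace WordRAM

open Finset
open scoped BigOperators

/-- The distribution of a level, as an expectation operator: the number of leading heads among `L`
fair coins. -/
noncomputable def levelMean (L : ℕ) (f : ℕ → ℝ) : ℝ :=
  𝔼 b : Fin L → Bool, f (lead (extend b) L)

/-- The indicator is a product over coins, with a factor depending on the coin for the first s of
them and 1 otherwise, and each of these s factors has mean 1/2. -/
theorem levelMean_ge {L s : ℕ} (hs : s ≤ L) :
    levelMean L (fun x => if s ≤ x then 1 else 0) = (1 / 2) ^ s := by
  have h1 : ∀ b : Fin L → Bool, (if s ≤ lead (extend b) L then (1 : ℝ) else 0) =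
      ∏ i : Fin L, if (i : ℕ) < s then (if b i = true then 1 else 0) else 1 := by
    intro b
    simp only [le_lead hs]
    split_ifs with h
    · refine (Finset.prod_eq_one fun i _ => ?_).symm
      split_ifs with h1 h2
      · rfl
      · exact absurd (by simpa [extend] using h i h1) h2
      · rfl
    · push Not at h
      obtain ⟨i, hi, hb⟩ := h
      refine (Finset.prod_eq_zero (Finset.mem_univ (⟨i, by omega⟩ : Fin L)) ?_).symm
      have : b ⟨i, by omega⟩ ≠ true := by
        simpa [extend, show i < L by omega] using hb
      simp [hi, this]
  unfold levelMean
  simp_rw [h1]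
  rw [Fintype.expect_prod_apply (β := Bool)
    (fun (i : Fin L) x => if (i : ℕ) < s then (if x = true then (1 : ℝ) else 0) else 1)]
  have h2 : ∀ i : Fin L, (𝔼 x : Bool, if (i : ℕ) < s then (if x = true then (1 : ℝ) else 0) else 1) =
      if (i : ℕ) < s then 1 / 2 else 1 := by
    intro i
    split_ifs <;> simp
  simp_rw [h2]
  rw [Finset.prod_ite, Finset.prod_const, Finset.prod_const_one, mul_one]
  congr 1
  rw [Fin.card_filter_val_lt]
  omega

theorem levelMean_const (L : ℕ) (c : ℝ) : levelMean L (fun _ => c) = c := by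
  simp [levelMean]

theorem levelMean_add (L : ℕ) (f g : ℕ → ℝ) :
    levelMean L (fun x => f x + g x) = levelMean L f + levelMean L g :=
  Finset.expect_add_distrib _ _ _

theorem levelMean_mul_left (L : ℕ) (c : ℝ) (f : ℕ → ℝ) :
    levelMean L (fun x => c * f x) = c * levelMean L f :=
  (Finset.mul_expect _ _ _).symm

/-- The levels of the members of `W` are independent numbers of leading heads among `L` coins. -/
def IsLevels {Ω : Type*} [Fintype Ω] (W : Finset ℕ) (L : ℕ) (lv : Ω → ℕ → ℕ) : Prop :=
  ∀ A ⊆ W, ∀ f : ℕ → ℕ → ℝ, 𝔼 ω, ∏ x ∈ A, f x (lv ω x) = ∏ x ∈ A, levelMean L (f x)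

/-- The coins relevant to `A` are an injective image of `A` times L positions; the remaining coins,
including those never tossed, do not matter, and a product of functions of separate blocks
factorises. -/
theorem isLevels_levelOf {us vs : List ℕ} {T : ℕ}
    (hT : (us.length + vs.length) * (2 * (us.length + vs.length).size) ≤ T) :
    IsLevels (us ++ vs).toFinset (2 * (us.length + vs.length).size)
      fun b : Fin T → Bool => levelOf us vs (extend b) := by
  intro A hA f
  set L := 2 * (us.length + vs.length).size
  have hidx : ∀ x : A, (us ++ vs).idxOf (x : ℕ) < us.length + vs.length := fun x => by
    rw [← List.length_append]
    exact List.idxOf_lt_length_of_mem (List.mem_toFinset.1 (hA x.2))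
  have hlt : ∀ y : A × Fin L, (us ++ vs).idxOf (y.1 : ℕ) * L + y.2 < T := fun y => by
    have h1 := hidx y.1
    have h2 := y.2.2
    calc (us ++ vs).idxOf (y.1 : ℕ) * L + y.2 < ((us ++ vs).idxOf (y.1 : ℕ) + 1) * L := by
          rw [Nat.succ_mul]; omega
      _ ≤ (us.length + vs.length) * L := Nat.mul_le_mul_right _ h1
      _ ≤ T := hT
  let φ : A × Fin L → Fin T := fun y => ⟨_, hlt y⟩
  have hφ : Function.Injective φ := by
    rintro ⟨x, l⟩ ⟨x', l'⟩ h
    have h : (us ++ vs).idxOf (x : ℕ) * L + l = (us ++ vs).idxOf (x' : ℕ) * L + l' :=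
      congrArg Fin.val h
    have hL : 0 < L := l.pos
    have h1 : (us ++ vs).idxOf (x : ℕ) = (us ++ vs).idxOf (x' : ℕ) := by
      -- Division by L recovers the index of the vertex; what remains is the coin within its block.
      have := congrArg (· / L) h
      simpa [Nat.mul_comm _ L, Nat.mul_add_div hL, Nat.div_eq_of_lt l.2, Nat.div_eq_of_lt l'.2]
        using this
    have h2 : (l : ℕ) = l' := by rw [h1] at h; omega
    have h3 : (x : ℕ) = x' :=
      (List.idxOf_inj (List.mem_toFinset.1 (hA x.2))).1 h1
    exact Prod.ext (Subtype.ext h3) (Fin.ext h2)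
  have h1 : ∀ b : Fin T → Bool, ∏ x ∈ A, f x (levelOf us vs (extend b) x) =
      ∏ x : A, f x (lead (extend fun l => (b ∘ φ) (x, l)) L) := by
    intro b
    rw [← Finset.prod_coe_sort]
    refine Finset.prod_congr rfl fun x _ => ?_
    congr 1
    refine lead_congr fun i hi => ?_
    have := hlt (x, ⟨i, hi⟩)
    have e1 : extend (fun l => (b ∘ φ) (x, l)) i = b (φ (x, ⟨i, hi⟩)) := dif_pos hi
    exact (dif_pos this).trans e1.symm
  simp_rw [h1]
  rw [Fintype.expect_comp_injective hφ
    (fun η : A × Fin L → Bool => ∏ x : A, f x (lead (extend fun l => η (x, l)) L)),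
    Fintype.expect_equiv (Equiv.curry A (Fin L) Bool)
      (fun η : A × Fin L → Bool => ∏ x : A, f x (lead (extend fun l => η (x, l)) L))
      (fun η : A → Fin L → Bool => ∏ x : A, f x (lead (extend (η x)) L)) fun _ => rfl,
    Fintype.expect_prod_apply (fun (x : A) (b : Fin L → Bool) => f x (lead (extend b) L))]
  exact Finset.prod_coe_sort A fun x => levelMean L (f x)

namespace IsLevels

variable {Ω : Type*} [Fintype Ω] {W : Finset ℕ} {L : ℕ} {lv : Ω → ℕ → ℕ}

theorem mean (h : IsLevels W L lv) {x : ℕ} (hx : x ∈ W) (f : ℕ → ℝ) :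
    𝔼 ω, f (lv ω x) = levelMean L f := by
  simpa using h {x} (by simpa using hx) fun _ => f

theorem mean_mul (h : IsLevels W L lv) {x y : ℕ} (hx : x ∈ W) (hy : y ∈ W) (hxy : x ≠ y)
    (f g : ℕ → ℝ) : 𝔼 ω, f (lv ω x) * g (lv ω y) = levelMean L f * levelMean L g := by
  have := h {x, y} (by simp [Finset.insert_subset_iff, hx, hy]) fun z => if z = x then f else g
  simpa [Finset.prod_pair hxy, hxy.symm] using this

end IsLevels

/-! ## Expectations -/

section Analysis

variable {Ω : Type*} [Fintype Ω] {G : BipGraph} {L : ℕ} {lv : Ω → ℕ → ℕ}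

theorem _root_.BipGraph.two_pow_cls_le {u : ℕ} (h : G.deg u ≠ 0) : 2 ^ G.cls u ≤ G.deg u :=
  Nat.pow_log_le_self 2 h

theorem _root_.BipGraph.deg_lt_two_pow_cls (u : ℕ) : G.deg u < 2 ^ (G.cls u + 1) :=
  Nat.lt_pow_succ_log_self one_lt_two _

/-- The centred contribution of a vertex of degree `d` sampled with probability `2 ^ (-s)`. -/
noncomputable def centred (d s x : ℕ) : ℝ := (d * 2 ^ s : ℝ) * (if s ≤ x then 1 else 0) + -(d : ℝ)

theorem levelMean_centred {d s : ℕ} (hs : s ≤ L) : levelMean L (centred d s) = 0 := by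
  unfold centred
  rw [levelMean_add, levelMean_mul_left, levelMean_const, levelMean_ge hs]
  rw [mul_assoc, ← mul_pow]
  norm_num

theorem levelMean_centred_sq {d s : ℕ} (hs : s ≤ L) :
    levelMean L (fun x => centred d s x ^ 2) = (d : ℝ) ^ 2 * (2 ^ s - 1) := by
  have h : ∀ x, centred d s x ^ 2 =
      ((d : ℝ) ^ 2 * ((2 ^ s) ^ 2 - 2 * 2 ^ s)) * (if s ≤ x then 1 else 0) + (d : ℝ) ^ 2 := by
    intro x
    unfold centred
    split_ifs <;> ring
  simp_rw [h]
  rw [levelMean_add, levelMean_mul_left, levelMean_const, levelMean_ge hs]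
  have : (2 : ℝ) ^ s * (1 / 2) ^ s = 1 := by rw [← mul_pow]; norm_num
  linear_combination ((d : ℝ) ^ 2 * (2 ^ s - 2)) * this

/-- The error is a sum of independent centred variables, one for each vertex of U. -/
theorem ideal_sub (lv : ℕ → ℕ) (kap g : ℕ) :
    (G.ideal lv kap g : ℝ) - G.edgeCount =
      ∑ u ∈ G.U, centred (G.deg u) (g - (G.cls u + kap)) (lv u) := by
  rw [← BipGraph.sum_deg, BipGraph.ideal]
  push_cast
  rw [← Finset.sum_sub_distrib]
  refine Finset.sum_congr rfl fun u _ => ?_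
  unfold centred
  split_ifs <;> ring

/-- The variance of the estimate. -/
theorem expect_ideal_sub_sq (h : IsLevels (G.U ∪ G.V) L lv) {kap g : ℕ} (hg : g ≤ L) :
    𝔼 ω, ((G.ideal (lv ω) kap g : ℝ) - G.edgeCount) ^ 2 ≤
      G.edgeCount * (2 ^ (g + 1) / 2 ^ kap) := by
  simp_rw [ideal_sub, sq, Finset.sum_mul_sum]
  rw [Finset.expect_sum_comm]
  rw [← BipGraph.sum_deg]
  push_cast
  rw [Finset.sum_mul]
  refine Finset.sum_le_sum fun u hu => ?_
  rw [Finset.expect_sum_comm]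
  have hs : g - (G.cls u + kap) ≤ L := by omega
  have huW : u ∈ G.U ∪ G.V := Finset.mem_union_left _ hu
  rw [Finset.sum_eq_single_of_mem u hu]
  · simp_rw [← sq]
    rw [h.mean huW fun x => centred (G.deg u) (g - (G.cls u + kap)) x ^ 2, levelMean_centred_sq hs,
      sq, mul_assoc]
    refine mul_le_mul_of_nonneg_left ?_ (Nat.cast_nonneg _)
    -- At sampling rate 1 there is no variance.
    by_cases hle : g ≤ G.cls u + kap
    · rw [Nat.sub_eq_zero_of_le hle]
      simp only [pow_zero, sub_self, mul_zero]
      positivity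
    · obtain ⟨s, hs'⟩ := Nat.exists_eq_add_of_le (not_le.1 hle).le
      -- One factor deg u is bounded by its class; the class cancels against the sampling exponent,
      -- which makes the bound linear in the degree.
      have hd : (G.deg u : ℝ) ≤ 2 ^ (G.cls u + 1) := by
        exact_mod_cast (BipGraph.deg_lt_two_pow_cls u).le
      rw [le_div_iff₀ (by positivity), hs', Nat.add_sub_cancel_left]
      calc (G.deg u : ℝ) * (2 ^ s - 1) * 2 ^ kap ≤ 2 ^ (G.cls u + 1) * 2 ^ s * 2 ^ kap := by
            have : (1 : ℝ) ≤ 2 ^ s := one_le_pow₀ (by norm_num)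
            gcongr
            linarith
        _ = 2 ^ (G.cls u + kap + s + 1) := by rw [← pow_add, ← pow_add]; congr 1; omega
  · intro v hv hvu
    -- Cross terms vanish: distinct vertices are independent and the variables have mean zero.
    rw [h.mean_mul huW (Finset.mem_union_left _ hv) hvu.symm (centred _ _) (centred _ _),
      levelMean_centred hs, zero_mul]

/-- The expected number of edges between the samples. -/
theorem expect_edgeHits (h : IsLevels (G.U ∪ G.V) L lv) {kap lam g j : ℕ} (hg : g ≤ L)
    (hj : j ≤ L) :
    𝔼 ω, (G.edgeHits (lv ω) (g - (j + kap)) (j - lam) : ℝ) ≤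
      G.edgeCount * (2 ^ (kap + lam) / 2 ^ g) := by
  have h1 : ∀ ω, (G.edgeHits (lv ω) (g - (j + kap)) (j - lam) : ℝ) =
      ∑ x ∈ G.E, (if g - (j + kap) ≤ lv ω x.1 then 1 else 0) *
        (if j - lam ≤ lv ω x.2 then 1 else 0) := by
    intro ω
    rw [BipGraph.edgeHits, Finset.card_filter]
    push_cast
    refine Finset.sum_congr rfl fun x _ => ?_
    split_ifs <;> simp_all
  simp_rw [h1]
  rw [Finset.expect_sum_comm, BipGraph.edgeCount, ← nsmul_eq_mul]
  refine Finset.sum_le_card_nsmul _ _ _ fun x hx => ?_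
  have hU := BipGraph.mem_U (u := x.1) (v := x.2) hx
  have hV := BipGraph.mem_V (u := x.1) (v := x.2) hx
  rw [h.mean_mul (Finset.mem_union_left _ hU) (Finset.mem_union_right _ hV)
    (fun he => BipGraph.not_mem_V hU (he ▸ hV)) (fun y => if g - (j + kap) ≤ y then 1 else 0)
    (fun y => if j - lam ≤ y then 1 else 0), levelMean_ge (by omega), levelMean_ge (by omega),
    ← pow_add, one_div, inv_pow, inv_eq_one_div, div_le_div_iff₀ (by positivity) (by positivity),
    one_mul, ← pow_add]
  -- The two thresholds add up to at least g - `kap` - `lam`: j cancels, and truncation at 0 can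
  -- only increase the thresholds.
  exact pow_le_pow_right₀ (by norm_num) (by omega)

/-- A vertex of positive degree is rarely missed. -/
theorem expect_missed (h : IsLevels (G.U ∪ G.V) L lv) {lam u : ℕ} (hd : G.deg u ≠ 0)
    (hL : G.cls u ≤ L) :
    𝔼 ω, (if G.Missed (lv ω) lam u then (1 : ℝ) else 0) ≤ (1 / 2) ^ 2 ^ lam := by
  set t := G.cls u - lam with ht
  -- Missing u means that every neighbour is unsampled: the indicator is a product over independent
  -- neighbours.
  have h1 : ∀ ω, (if G.Missed (lv ω) lam u then (1 : ℝ) else 0) =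
      ∏ v ∈ G.V.filter fun v => (u, v) ∈ G.E, ((-1) * (if t ≤ lv ω v then 1 else 0) + 1) := by
    intro ω
    split_ifs with hm
    · refine (Finset.prod_eq_one fun v hv => ?_).symm
      rw [if_neg (hm v hv)]
      norm_num
    · simp only [BipGraph.Missed, not_forall, not_not] at hm
      obtain ⟨v, hv, hv'⟩ := hm
      refine (Finset.prod_eq_zero hv ?_).symm
      rw [if_pos hv']
      norm_num
  simp_rw [h1]
  rw [h _ ((Finset.filter_subset _ _).trans Finset.subset_union_right) fun _ x =>
    (-1) * (if t ≤ x then (1 : ℝ) else 0) + 1]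
  simp only [levelMean_add, levelMean_mul_left, levelMean_const]
  rw [levelMean_ge (by omega), Finset.prod_const]
  change (-1 * (1 / 2 : ℝ) ^ t + 1) ^ G.deg u ≤ _
  have hp : (0 : ℝ) < (1 / 2) ^ t := by positivity
  have hp1 : (1 / 2 : ℝ) ^ t ≤ 1 := pow_le_one₀ (by norm_num) (by norm_num)
  -- For small degrees all of V is sampled, so a vertex with a neighbour is never missed.
  by_cases hlt : G.cls u ≤ lam
  · have : t = 0 := by omega
    rw [this]
    simp [hd]
  · have hd' : 2 ^ t * 2 ^ lam ≤ G.deg u := by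
      rw [← pow_add]
      convert BipGraph.two_pow_cls_le hd using 2
      omega
    calc (-1 * (1 / 2 : ℝ) ^ t + 1) ^ G.deg u ≤ (-1 * (1 / 2 : ℝ) ^ t + 1) ^ (2 ^ t * 2 ^ lam) :=
          pow_le_pow_of_le_one (by linarith) (by linarith) hd'
      _ ≤ (Real.exp (-(1 / 2) ^ t)) ^ (2 ^ t * 2 ^ lam) := by
          refine pow_le_pow_left₀ (by linarith) ?_ _
          have := Real.one_sub_le_exp_neg ((1 / 2 : ℝ) ^ t)
          linarith
      _ = (Real.exp (-1)) ^ 2 ^ lam := by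
          rw [pow_mul, ← Real.exp_nat_mul]
          congr 2
          push_cast
          have : (2 : ℝ) ^ t * (1 / 2) ^ t = 1 := by rw [← mul_pow]; norm_num
          linear_combination -this
      -- This uses only e > 2.
      _ ≤ (1 / 2) ^ 2 ^ lam := by
          refine pow_le_pow_left₀ (Real.exp_pos _).le ?_ _
          rw [Real.exp_neg, inv_eq_one_div]
          exact one_div_le_one_div_of_le (by norm_num) (by linarith [Real.exp_one_gt_d9])

end Analysis

/-! ### Probability that the levels are good, and accuracy on good levels -/

open Finset
open scoped BigOperators

section Good

variable {Ω : Type*} [Fintype Ω] {G : BipGraph} {lv : Ω → ℕ → ℕ} {len t lam m : ℕ}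

/-- For every guess from `2 ^ m` on, the estimate is accurate and no search runs out of budget, and
no vertex is missed. -/
def Good (G : BipGraph) (lv : ℕ → ℕ) (len t lam bud m : ℕ) : Prop :=
  (∀ g, m ≤ g → g < 2 * len →
    |(G.ideal lv (2 * t + 11) g : ℝ) - G.edgeCount| * 2 ^ (t + 2) < 2 ^ g ∧
    ∀ j < len, G.edgeHits lv (g - (j + (2 * t + 11))) (j - lam) ≤ bud) ∧
  ∀ u ∈ G.U, G.deg u ≠ 0 → ¬ G.Missed lv lam u

/-- A sum of penalties that is at least `1` unless the levels are good. -/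
noncomputable def penalty (G : BipGraph) (lv : ℕ → ℕ) (len t lam bud m : ℕ) : ℝ :=
  ∑ g ∈ Ico m (2 * len), (((G.ideal lv (2 * t + 11) g : ℝ) - G.edgeCount) ^ 2 *
      (2 ^ (t + 2) / 2 ^ g) ^ 2 +
    ∑ j ∈ range len, (G.edgeHits lv (g - (j + (2 * t + 11))) (j - lam) : ℝ) * (1 / bud)) +
  ∑ u ∈ G.U.filter fun u => G.deg u ≠ 0, if G.Missed lv lam u then (1 : ℝ) else 0

theorem penalty_nonneg (G : BipGraph) (lv : ℕ → ℕ) (len t lam bud m : ℕ) :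
    0 ≤ penalty G lv len t lam bud m := by
  unfold penalty
  positivity

/-- All summands are nonnegative, so each is below 1; a summand is a normalised squared error, a
normalised hit count, or an indicator, as in the inequalities of Chebyshev and Markov and the union
bound. -/
theorem good_of_penalty_lt {lv : ℕ → ℕ} {bud : ℕ} (hbud : 0 < bud)
    (h : penalty G lv len t lam bud m < 1) : Good G lv len t lam bud m := by
  unfold penalty at h
  have hbud' : (0 : ℝ) < bud := Nat.cast_pos.2 hbud
  refine ⟨fun g hg hg' => ?_, fun u hu hd hmiss => ?_⟩
  · have h1 := (le_add_of_nonneg_right (Finset.sum_nonneg fun u _ => by positivity)).trans_lt h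
    have h2 := (Finset.single_le_sum (fun g _ => by positivity)
      (Finset.mem_Ico.2 ⟨hg, hg'⟩)).trans_lt h1
    constructor
    · have h3 := (le_add_of_nonneg_right (Finset.sum_nonneg fun j _ => by positivity)).trans_lt h2
      rw [← mul_pow, sq_lt_one_iff_abs_lt_one, abs_mul,
        abs_of_nonneg (by positivity : (0 : ℝ) ≤ 2 ^ (t + 2) / 2 ^ g), ← mul_div_assoc,
        div_lt_one (by positivity)] at h3
      exact h3
    · intro j hj
      have h3 := (le_add_of_nonneg_left (by positivity)).trans_lt h2
      have h4 := (Finset.single_le_sum (fun j _ => by positivity) (Finset.mem_range.2 hj)).trans_lt h3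
      rw [mul_one_div, div_lt_one hbud'] at h4
      exact_mod_cast h4.le
  · have h1 := (le_add_of_nonneg_left (Finset.sum_nonneg fun g _ => by positivity)).trans_lt h
    have h2 := (Finset.single_le_sum (fun u _ => by positivity)
      (Finset.mem_filter.2 ⟨hu, hd⟩)).trans_lt h1
    rw [if_pos hmiss] at h2
    exact lt_irrefl _ h2

/-- The guesses contribute at most 1/8 in total, a geometric series that starts at the order of
e(G), and the missed vertices contribute at most 1/16. -/
theorem expect_penalty_le (h : IsLevels (G.U ∪ G.V) (2 * len) lv) (hn : G.order < 2 ^ len)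
    (hlen : 0 < len) (hm : G.edgeCount < 2 ^ (m + 1)) (hlam : len + 4 ≤ 2 ^ lam) :
    𝔼 ω, penalty G (lv ω) len t lam (64 * len * 2 ^ (2 * t + 11 + lam)) m ≤ 3 / 16 := by
  unfold penalty
  rw [Finset.expect_add_distrib, Finset.expect_sum_comm, Finset.expect_sum_comm]
  have hlen' : (0 : ℝ) < len := Nat.cast_pos.2 hlen
  have hguess : ∀ g ∈ Ico m (2 * len),
      𝔼 ω, (((G.ideal (lv ω) (2 * t + 11) g : ℝ) - G.edgeCount) ^ 2 * (2 ^ (t + 2) / 2 ^ g) ^ 2 +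
        ∑ j ∈ range len, (G.edgeHits (lv ω) (g - (j + (2 * t + 11))) (j - lam) : ℝ) *
          (1 / (64 * len * 2 ^ (2 * t + 11 + lam) : ℕ))) ≤
      (G.edgeCount / 32 : ℝ) * (1 / 2) ^ g := by
    intro g hg
    have hg' := (Finset.mem_Ico.1 hg).2
    rw [Finset.expect_add_distrib, Finset.expect_sum_comm, ← Finset.expect_mul]
    have h1 := mul_le_mul_of_nonneg_right (expect_ideal_sub_sq h (kap := 2 * t + 11) hg'.le)
      (by positivity : (0 : ℝ) ≤ (2 ^ (t + 2) / 2 ^ g) ^ 2)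
    have hc : (0 : ℝ) ≤ 1 / (64 * len * 2 ^ (2 * t + 11 + lam) : ℕ) := by positivity
    have hcdef : (1 / (64 * len * 2 ^ (2 * t + 11 + lam) : ℕ) : ℝ) * len * 2 ^ (2 * t + 11 + lam) =
        1 / 64 := by
      push_cast
      field_simp
    generalize (1 / (64 * len * 2 ^ (2 * t + 11 + lam) : ℕ) : ℝ) = c at hc hcdef ⊢
    have h2 : ∀ j ∈ range len, 𝔼 ω,
        (G.edgeHits (lv ω) (g - (j + (2 * t + 11))) (j - lam) : ℝ) * c ≤
          G.edgeCount * (2 ^ (2 * t + 11 + lam) / 2 ^ g) * c := by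
      intro j hj
      have hj' : j ≤ 2 * len := by
        have := Finset.mem_range.1 hj
        omega
      have h0 := expect_edgeHits h (kap := 2 * t + 11) (lam := lam) hg'.le hj'
      rw [← Finset.expect_mul]
      exact mul_le_mul_of_nonneg_right h0 hc
    have h3 := Finset.sum_le_card_nsmul _ _ _ h2
    rw [Finset.card_range, nsmul_eq_mul] at h3
    -- The variance term and the budget term each equal e(G) 2^(-g) / 64.
    refine (add_le_add h1 h3).trans (le_of_eq ?_)
    have e3 : (len : ℝ) * (G.edgeCount * (2 ^ (2 * t + 11 + lam) / 2 ^ g) * c) =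
        G.edgeCount * (1 / 2) ^ g * (1 / 64) := by
      rw [← hcdef, one_div_pow]
      ring
    have e1 : (2 : ℝ) ^ (2 * t + 11) = 2 ^ t * 2 ^ t * 2048 := by
      rw [pow_add, two_mul, pow_add]; norm_num
    have e2 : (2 : ℝ) ^ (t + 2) = 2 ^ t * 4 := by rw [pow_add]; norm_num
    rw [e3, e1, e2, pow_succ, one_div_pow]
    field_simp
    ring
  have hgeom : ∑ g ∈ Ico m (2 * len), (1 / 2 : ℝ) ^ g ≤ 2 * (1 / 2) ^ m := by
    refine (geom_sum_Ico_le_of_lt_one (by norm_num) (by norm_num)).trans (le_of_eq ?_)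
    norm_num
    ring
  have hmiss : ∀ u ∈ G.U.filter fun u => G.deg u ≠ 0,
      𝔼 ω, (if G.Missed (lv ω) lam u then (1 : ℝ) else 0) ≤ (1 / 2) ^ 2 ^ lam := by
    intro u hu
    have hd := (Finset.mem_filter.1 hu).2
    have hdn : G.deg u ≤ G.order := Finset.card_le_card
      ((Finset.filter_subset _ _).trans Finset.subset_union_right)
    have : G.cls u < len := Nat.log_lt_of_lt_pow hd (hdn.trans_lt hn)
    exact expect_missed h hd (by omega)
  have hmiss' : ∑ u ∈ G.U.filter fun u => G.deg u ≠ 0,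
      𝔼 ω, (if G.Missed (lv ω) lam u then (1 : ℝ) else 0) ≤ 1 / 16 := by
    refine (Finset.sum_le_card_nsmul _ _ _ hmiss).trans ?_
    have hc : ((G.U.filter fun u => G.deg u ≠ 0).card : ℝ) ≤ 2 ^ len := by
      have : (G.U.filter fun u => G.deg u ≠ 0).card ≤ G.order := Finset.card_le_card
        ((Finset.filter_subset _ _).trans Finset.subset_union_left)
      exact_mod_cast this.trans hn.le
    -- At most 2^len vertices, each missed with probability at most 2^(-(len + 4)).
    have hp : (1 / 2 : ℝ) ^ 2 ^ lam ≤ (1 / 2) ^ (len + 4) :=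
      pow_le_pow_of_le_one (by norm_num) (by norm_num) hlam
    rw [nsmul_eq_mul]
    calc ((G.U.filter fun u => G.deg u ≠ 0).card : ℝ) * (1 / 2) ^ 2 ^ lam
        ≤ 2 ^ len * (1 / 2) ^ (len + 4) := by gcongr
      _ = 1 / 16 := by rw [pow_add, ← mul_assoc, ← mul_pow]; norm_num
  have hsum : ∑ g ∈ Ico m (2 * len), (G.edgeCount / 32 : ℝ) * (1 / 2) ^ g ≤ 1 / 8 := by
    rw [← Finset.mul_sum]
    have hm' : (G.edgeCount : ℝ) ≤ 2 ^ (m + 1) := by exact_mod_cast hm.le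
    calc (G.edgeCount / 32 : ℝ) * ∑ g ∈ Ico m (2 * len), (1 / 2 : ℝ) ^ g
        ≤ (2 ^ (m + 1) / 32) * (2 * (1 / 2) ^ m) := by gcongr
      _ = (2 ^ m * (1 / 2) ^ m) / 8 := by ring
      _ = 1 / 8 := by rw [← mul_pow]; norm_num
  have := add_le_add ((Finset.sum_le_sum hguess).trans hsum) hmiss'
  linarith

open Classical in
/-- Levels are good with probability at least `2 / 3`. -/
theorem two_thirds_le_expect_good [Nonempty Ω] (h : IsLevels (G.U ∪ G.V) (2 * len) lv)
    (hn : G.order < 2 ^ len) (hlen : 0 < len) (hm : G.edgeCount < 2 ^ (m + 1))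
    (hlam : len + 4 ≤ 2 ^ lam) :
    (2 / 3 : ℝ) ≤ 𝔼 ω, if Good G (lv ω) len t lam (64 * len * 2 ^ (2 * t + 11 + lam)) m
      then (1 : ℝ) else 0 := by
  have h1 := expect_penalty_le (t := t) h hn hlen hm hlam
  have h2 : 𝔼 ω, (1 - penalty G (lv ω) len t lam (64 * len * 2 ^ (2 * t + 11 + lam)) m) ≤
      𝔼 ω, if Good G (lv ω) len t lam (64 * len * 2 ^ (2 * t + 11 + lam)) m
        then (1 : ℝ) else 0 := by
    refine Finset.expect_le_expect fun ω _ => ?_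
    have h3 := penalty_nonneg G (lv ω) len t lam (64 * len * 2 ^ (2 * t + 11 + lam)) m
    split_ifs with hg
    · linarith
    · have : ¬ penalty G (lv ω) len t lam (64 * len * 2 ^ (2 * t + 11 + lam)) m < 1 := fun hlt =>
        hg (good_of_penalty_lt (by positivity) hlt)
      linarith
  -- One minus the penalty is a lower bound for the indicator of good levels, and 1 - 3/16 ≥ 2/3.
  rw [Finset.expect_sub_distrib, Fintype.expect_const] at h2
  linarith

end Good

/-- If the levels are good then the answer is an accurate estimate. -/
theorem Good.accurate {G : BipGraph} {lv : ℕ → ℕ} {len t lam bud m : ℕ} {est : ℕ → ℕ}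
    (h : Good G lv len t lam bud m) (ht : 1 ≤ t) (hm : 2 ^ m ≤ G.edgeCount)
    (hm' : G.edgeCount < 2 ^ (m + 1)) (hmlen : m < 2 * len)
    (hest : ∀ g, m ≤ g → g < 2 * len → est g = G.ideal lv (2 * t + 11) g) :
    ∃ g < 2 * len, lastAccepted est (2 * len) = G.ideal lv (2 * t + 11) g ∧
      |(lastAccepted est (2 * len) : ℝ) - G.edgeCount| * 2 ^ t ≤ G.edgeCount := by
  have hacc : ∀ g, m ≤ g → g < 2 * len →
      |(est g : ℝ) - G.edgeCount| * 2 ^ t * 4 < 2 ^ g := by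
    intro g hg hg'
    have := (h.1 g hg hg').1
    rw [← hest g hg hg', pow_add] at this
    linarith
  -- Since t ≥ 1, the error is below 2^g / 8: small enough to accept m, where the estimate exceeds
  -- 7/8 · 2^m, and to reject g ≥ m + 3, where it is below 3/8 · 2^g.
  have hacc8 : ∀ g, m ≤ g → g < 2 * len → |(est g : ℝ) - G.edgeCount| * 8 < 2 ^ g := by
    intro g hg hg'
    have h1 : (2 : ℝ) ^ 1 ≤ 2 ^ t := pow_le_pow_right₀ (by norm_num) ht
    have := mul_le_mul_of_nonneg_left h1 (abs_nonneg ((est g : ℝ) - G.edgeCount))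
    have := hacc g hg hg'
    linarith
  have hmR : (2 : ℝ) ^ m ≤ G.edgeCount := by exact_mod_cast hm
  have hmR' : (G.edgeCount : ℝ) < 2 ^ (m + 1) := by exact_mod_cast hm'
  obtain ⟨g, h1, h2, h3, h4⟩ := exists_lastAccepted (est := est) hmlen
    (by
      have h1 := hacc8 m le_rfl hmlen
      have h2 := (abs_lt.1 (lt_div_iff₀ (by norm_num : (0 : ℝ) < 8) |>.2 h1)).1
      have : (2 : ℝ) ^ m ≤ 2 * est m := by linarith
      exact_mod_cast this)
    (by
      intro g hg hg'
      have h1 := hacc8 g (by omega) hg'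
      have h2 := (abs_lt.1 (lt_div_iff₀ (by norm_num : (0 : ℝ) < 8) |>.2 h1)).2
      have h3 : (2 : ℝ) ^ (m + 3) ≤ 2 ^ g := pow_le_pow_right₀ (by norm_num) hg
      rw [pow_succ] at hmR'
      rw [pow_add] at h3
      have : (2 * est g : ℝ) < 2 ^ g := by linarith
      exact_mod_cast this)
  refine ⟨g, h2, by rw [h4, hest g h1 h2], ?_⟩
  rw [h4]
  -- The chosen guess is at most m + 2, so 2^g ≤ 4 e(G), which the factor 4 in the accuracy absorbs.
  have h5 := hacc g h1 h2
  have h6 : (2 : ℝ) ^ g ≤ 2 ^ (m + 2) := pow_le_pow_right₀ (by norm_num) h3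
  rw [pow_add] at h6
  linarith

/-- If the sampling probabilities are `1` then the estimate is exact. -/
theorem ideal_eq_edgeCount {G : BipGraph} {lv : ℕ → ℕ} {kap g : ℕ} (h : g ≤ kap) :
    G.ideal lv kap g = G.edgeCount := by
  rw [← BipGraph.sum_deg, BipGraph.ideal]
  refine Finset.sum_congr rfl fun u _ => ?_
  rw [Nat.sub_eq_zero_of_le (h.trans (Nat.le_add_left _ _)), if_pos (Nat.zero_le _), pow_zero, mul_one]

open Finset in
open scoped BigOperators Classical in
theorem two_thirds_le_toOuterMeasure {α : Type*} [Fintype α] [Nonempty α] {s : Set α}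
    (h : (2 / 3 : ℝ) ≤ 𝔼 a, if a ∈ s then (1 : ℝ) else 0) :
    2 / 3 ≤ (PMF.uniformOfFintype α).toOuterMeasure s := by
  rw [Fintype.expect_eq_sum_div_card, Finset.sum_boole] at h
  rw [PMF.toOuterMeasure_uniformOfFintype_apply, Fintype.card_subtype]
  have hc : (0 : ℝ) < Fintype.card α := Nat.cast_pos.2 Fintype.card_pos
  rw [div_le_div_iff₀ (by norm_num) hc] at h
  have h' : 2 * Fintype.card α ≤ (univ.filter fun a => a ∈ s).card * 3 := by exact_mod_cast h
  rw [ENNReal.le_div_iff_mul_le (by simp) (by simp), ← ENNReal.mul_div_right_comm]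
  refine ENNReal.div_le_of_le_mul ?_
  exact_mod_cast h'

/-! ## Bounds on the resources -/

section Resources

variable {l n t : ℕ}

theorem two_pow_size_le (l : ℕ) : 2 ^ (l + 4).size ≤ 2 * (l + 4) := by
  have h1 : 0 < (l + 4).size := Nat.size_pos.2 (by omega)
  have h2 : (l + 4).size - 1 < (l + 4).size := by omega
  rw [Nat.lt_size] at h2
  calc 2 ^ (l + 4).size = 2 ^ ((l + 4).size - 1) * 2 := by rw [← pow_succ]; congr 1; omega
    _ ≤ 2 * (l + 4) := by omega

theorem bud_le_four_pow :
    64 * l * 2 ^ (2 * t + 11 + (l + 4).size) ≤ 2 ^ 18 * (l + 4) ^ 2 * 4 ^ t := by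
  have h : (4 : ℕ) ^ t = 2 ^ (2 * t) := by rw [pow_mul]; norm_num
  calc 64 * l * 2 ^ (2 * t + 11 + (l + 4).size) = 2 ^ 17 * l * 2 ^ (l + 4).size * 4 ^ t := by
        rw [pow_add, pow_add, h]; ring
    _ ≤ 2 ^ 17 * (l + 4) * (2 * (l + 4)) * 4 ^ t := by
        have := two_pow_size_le l
        gcongr
        omega
    _ = 2 ^ 18 * (l + 4) ^ 2 * 4 ^ t := by ring

/-- Three factors from guesses, classes and binary search, and two from the budget, give the fifth
power of `l` + 4. -/
theorem calls_le {B : ℕ} (hB : B ≤ 2 ^ 18 * (l + 4) ^ 2 * 4 ^ t) :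
    2 * l * (l * (B * l)) ≤ 2 ^ 19 * (l + 4) ^ 5 * 4 ^ t := by
  calc 2 * l * (l * (B * l)) ≤
        2 * (l + 4) * ((l + 4) * ((2 ^ 18 * (l + 4) ^ 2 * 4 ^ t) * (l + 4))) := by
        gcongr <;> omega
    _ = 2 ^ 19 * (l + 4) ^ 5 * 4 ^ t := by ring

/-- The dominant term is the number of rounds times O(n `len`) per round, for searching and counting
a degree. The variable x = `l` + 4 ≥ 4 absorbs the lower-order terms. -/
theorem time_le {B : ℕ} (hB : B ≤ 2 ^ 18 * (l + 4) ^ 2 * 4 ^ t) :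
    2 * l * (l * (B * (l * (n + 15) + 10 * n + 38) + 17 * n + 50 + 5) + 21) + n * (16 * l + 14) +
      8 * l + 100 ≤ 2 ^ 25 * (l + 4) ^ 5 * (n + 1) * 4 ^ t := by
  obtain ⟨x, hx⟩ : ∃ x, x = l + 4 := ⟨_, rfl⟩
  have hl : l ≤ x := by omega
  have hx4 : 4 ≤ x := by omega
  rw [← hx] at hB ⊢
  have hq : 1 ≤ 4 ^ t := Nat.one_le_pow _ _ (by norm_num)
  generalize 4 ^ t = q at hB hq ⊢
  have h1 : l * (n + 15) + 10 * n + 38 ≤ 25 * (x * (n + 1)) := by nlinarith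
  have hxy : n + 1 ≤ x ^ 3 * (n + 1) * q := by
    have : 1 ≤ x ^ 3 * q := Nat.one_le_iff_ne_zero.2 (by positivity)
    nlinarith
  have h2 : B * (l * (n + 15) + 10 * n + 38) + 17 * n + 50 + 5 + 21 ≤
      2 ^ 23 * (x ^ 3 * (n + 1) * q) := by
    have h3 : B * (l * (n + 15) + 10 * n + 38) ≤ (2 ^ 18 * x ^ 2 * q) * (25 * (x * (n + 1))) :=
      Nat.mul_le_mul hB h1
    have h4 : (2 ^ 18 * x ^ 2 * q) * (25 * (x * (n + 1))) =
        2 ^ 18 * 25 * (x ^ 3 * (n + 1) * q) := by ring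
    rw [h4] at h3
    omega
  have h5 : n * (16 * l + 14) + 8 * l + 100 ≤ 53 * (x * (n + 1)) := by nlinarith
  have h6 : x * (n + 1) ≤ x ^ 5 * (n + 1) * q := by
    have : 1 ≤ x ^ 4 * q := Nat.one_le_iff_ne_zero.2 (by positivity)
    calc x * (n + 1) ≤ x * (n + 1) * (x ^ 4 * q) := Nat.le_mul_of_pos_right _ this
      _ = x ^ 5 * (n + 1) * q := by ring
  generalize B * (l * (n + 15) + 10 * n + 38) + 17 * n + 50 + 5 = I at h2 ⊢
  have h7 : 2 * l * (l * I + 21) ≤ 2 ^ 24 * (x ^ 5 * (n + 1) * q) :=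
    calc 2 * l * (l * I + 21) ≤ 2 * x * (x * I + x * 21) := by gcongr; omega
      _ = 2 * x ^ 2 * (I + 21) := by ring
      _ ≤ 2 * x ^ 2 * (2 ^ 23 * (x ^ 3 * (n + 1) * q)) := by gcongr
      _ = 2 ^ 24 * (x ^ 5 * (n + 1) * q) := by ring
  calc _ = 2 * l * (l * I + 21) + (n * (16 * l + 14) + 8 * l + 100) := by ring
    _ ≤ 2 ^ 24 * (x ^ 5 * (n + 1) * q) + 53 * (x ^ 5 * (n + 1) * q) :=
      Nat.add_le_add h7 (h5.trans (Nat.mul_le_mul_left _ h6))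
    _ ≤ 2 ^ 25 * x ^ 5 * (n + 1) * q := by nlinarith [Nat.zero_le (x ^ 5 * (n + 1) * q)]

/-- The size is at most log₂ n + 1; as log n ≥ 1 for n ≥ 3, the constant 1 / log 2 + 5 < 7 works. -/
theorem size_add_four_le_log {n : ℕ} (hn : 3 ≤ n) : (n.size + 4 : ℝ) ≤ 7 * Real.log n := by
  have hs : 0 < n.size := Nat.size_pos.2 (by omega)
  have h1 : n.size - 1 < n.size := by omega
  rw [Nat.lt_size] at h1
  have h2 : ((n.size - 1 : ℕ) : ℝ) * Real.log 2 ≤ Real.log n := by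
    rw [← Real.log_pow]
    exact Real.log_le_log (by positivity) (by exact_mod_cast h1)
  rw [Nat.cast_sub hs, Nat.cast_one] at h2
  have h3 : 1 ≤ Real.log n := by
    rw [Real.le_log_iff_exp_le (by positivity)]
    have : (3 : ℝ) ≤ n := by exact_mod_cast hn
    linarith [Real.exp_one_lt_d9]
  have h4 := Real.log_two_gt_d9
  have h5 : (1 : ℝ) ≤ n.size := by exact_mod_cast hs
  nlinarith

theorem one_le_log {n : ℕ} (hn : 3 ≤ n) : 1 ≤ Real.log n := by
  rw [Real.le_log_iff_exp_le (by positivity)]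
  have : (3 : ℝ) ≤ n := by exact_mod_cast hn
  linarith [Real.exp_one_lt_d9]

/-- The bound for the running time. -/
def timeBound (n : ℕ) : ℝ := 2 ^ 29 * (n.size + 4) ^ 5 * (n + 1)

/-- The bound for the number of independence queries. -/
def callBound (n : ℕ) : ℝ := 2 ^ 23 * (n.size + 4) ^ 5

theorem isSoftO_timeBound : IsSoftO timeBound fun n => n := by
  refine ⟨(5 : ℕ), IsBigO.of_bound (2 ^ 30 * 7 ^ 5) ?_⟩
  filter_upwards [eventually_ge_atTop 3] with n hn
  have h1 := size_add_four_le_log hn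
  have h2 := one_le_log hn
  have h3 : (3 : ℝ) ≤ n := by exact_mod_cast hn
  rw [Real.rpow_natCast, timeBound, Real.norm_of_nonneg (by positivity),
    Real.norm_of_nonneg (by positivity)]
  calc (2 : ℝ) ^ 29 * (n.size + 4) ^ 5 * (n + 1) ≤ 2 ^ 29 * (7 * Real.log n) ^ 5 * (2 * n) := by
        gcongr
        linarith
    _ = 2 ^ 30 * 7 ^ 5 * (Real.log n ^ 5 * n) := by ring

theorem isBigO_callBound : callBound =O[atTop] fun n : ℕ => Real.log n ^ 6 := by
  refine IsBigO.of_bound (2 ^ 23 * 7 ^ 5) ?_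
  filter_upwards [eventually_ge_atTop 3] with n hn
  have h1 := size_add_four_le_log hn
  have h2 := one_le_log hn
  rw [callBound, Real.norm_of_nonneg (by positivity), Real.norm_of_nonneg (by positivity)]
  calc (2 : ℝ) ^ 23 * (n.size + 4) ^ 5 ≤ 2 ^ 23 * (7 * Real.log n) ^ 5 := by gcongr
    _ = 2 ^ 23 * 7 ^ 5 * Real.log n ^ 5 := by ring
    _ ≤ 2 ^ 23 * 7 ^ 5 * Real.log n ^ 6 := by
      gcongr
      norm_num

end Resources

/-! ## The input -/

section Input

variable {ε : ℚ}

theorem num_natAbs_lt_den (h0 : 0 < ε) (h1 : ε < 1) : ε.num.natAbs < ε.den := by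
  have h2 := Rat.num_lt_denom_iff.2 h1
  have h3 := Rat.num_pos.2 h0
  omega

theorem bits_length_le (h0 : 0 < ε) (h1 : ε < 1) :
    ε.num.natAbs.bits.length ≤ ε.den.bits.length := by
  rw [Nat.size_eq_bits_len, Nat.size_eq_bits_len]
  exact Nat.size_le_size (num_natAbs_lt_den h0 h1).le

theorem bits_length_pos (h0 : 0 < ε) : 1 ≤ ε.num.natAbs.bits.length := by
  rw [Nat.size_eq_bits_len]
  exact Nat.size_pos.2 (by have := Rat.num_pos.2 h0; omega)

theorem two_le_bits_length (h0 : 0 < ε) (h1 : ε < 1) : 2 ≤ ε.den.bits.length := by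
  rw [Nat.size_eq_bits_len]
  have h2 := num_natAbs_lt_den h0 h1
  have h3 := Rat.num_pos.2 h0
  exact Nat.lt_size.2 (by omega)

theorem cast_eps (h0 : 0 < ε) : (ε : ℝ) = ε.num.natAbs / ε.den := by
  have h3 := Rat.num_pos.2 h0
  have h4 : ((ε.num.natAbs : ℤ) : ℝ) = ε.num := by rw [Int.natAbs_of_nonneg h3.le]
  rw [Rat.cast_def, ← h4, Int.cast_natCast]

/-- Comparing the numbers of digits determines ε up to constant factors: the numerator is at least
2^(a-1) and the denominator below 2^b. So the program only needs the lengths of the two digit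
arrays, not the digits. -/
theorem one_le_eps_mul_two_pow (h0 : 0 < ε) (h1 : ε < 1) :
    (1 : ℝ) ≤ ε * 2 ^ (ε.den.bits.length - ε.num.natAbs.bits.length + 1) := by
  have hab := bits_length_le h0 h1
  have ha := bits_length_pos h0
  have hden : (0 : ℝ) < ε.den := by exact_mod_cast ε.den_pos
  rw [cast_eps h0, div_mul_eq_mul_div, le_div_iff₀ hden, one_mul]
  rw [Nat.size_eq_bits_len] at ha hab ⊢
  rw [Nat.size_eq_bits_len] at hab ⊢
  have h2 : 2 ^ (ε.num.natAbs.size - 1) ≤ ε.num.natAbs := Nat.lt_size.1 (by omega)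
  have h3 := Nat.lt_size_self ε.den
  have h4 : ε.den ≤ ε.num.natAbs * 2 ^ (ε.den.size - ε.num.natAbs.size + 1) :=
    calc ε.den ≤ 2 ^ ε.den.size := h3.le
      _ = 2 ^ (ε.num.natAbs.size - 1) * 2 ^ (ε.den.size - ε.num.natAbs.size + 1) := by
        rw [← pow_add]; congr 1; omega
      _ ≤ _ := Nat.mul_le_mul_right _ h2
  exact_mod_cast h4

theorem eps_mul_two_pow_le (h0 : 0 < ε) (h1 : ε < 1) :
    (ε : ℝ) * 2 ^ (ε.den.bits.length - ε.num.natAbs.bits.length + 1) ≤ 4 := by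
  have hab := bits_length_le h0 h1
  have hb := two_le_bits_length h0 h1
  have hden : (0 : ℝ) < ε.den := by exact_mod_cast ε.den_pos
  rw [cast_eps h0, div_mul_eq_mul_div, div_le_iff₀ hden]
  rw [Nat.size_eq_bits_len] at hab hb ⊢
  rw [Nat.size_eq_bits_len] at hab ⊢
  have h2 : 2 ^ (ε.den.size - 1) ≤ ε.den := Nat.lt_size.1 (by omega)
  have h3 := Nat.lt_size_self ε.num.natAbs
  have h4 : ε.num.natAbs * 2 ^ (ε.den.size - ε.num.natAbs.size + 1) ≤ 4 * ε.den :=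
    calc ε.num.natAbs * 2 ^ (ε.den.size - ε.num.natAbs.size + 1) ≤
          2 ^ ε.num.natAbs.size * 2 ^ (ε.den.size - ε.num.natAbs.size + 1) :=
        Nat.mul_le_mul_right _ h3.le
      _ = 4 * 2 ^ (ε.den.size - 1) := by
        rw [← pow_add, show (4 : ℕ) = 2 ^ 2 by norm_num, ← pow_add]; congr 1; omega
      _ ≤ _ := Nat.mul_le_mul_left _ h2
  exact_mod_cast h4

theorem four_pow_le (h0 : 0 < ε) (h1 : ε < 1) (l : ℕ) :
    (4 : ℝ) ^ min (ε.den.bits.length - ε.num.natAbs.bits.length + 1) l ≤ 16 * ((ε : ℝ) ^ 2)⁻¹ := by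
  have h := eps_mul_two_pow_le h0 h1
  set t := ε.den.bits.length - ε.num.natAbs.bits.length + 1
  have hε : (0 : ℝ) < ε := by exact_mod_cast h0
  have h2 : (4 : ℝ) ^ min t l ≤ (2 ^ t) ^ 2 := by
    rw [← pow_mul, mul_comm, pow_mul]
    norm_num
    exact pow_le_pow_right₀ (by norm_num) (min_le_left _ _)
  refine h2.trans ?_
  rw [← div_eq_mul_inv, le_div_iff₀ (by positivity), ← mul_pow]
  calc ((2 : ℝ) ^ t * ε) ^ 2 ≤ 4 ^ 2 := by
        refine pow_le_pow_left₀ (by positivity) ?_ 2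
        rw [mul_comm]
        exact h
    _ = 16 := by norm_num

theorem length_inputArray (us vs : List ℕ) (ε : ℚ) :
    (inputArray us vs ε).length =
      us.length + vs.length + ε.num.natAbs.bits.length + ε.den.bits.length := by
  simp [inputArray, Nat.add_assoc]

/-- Logarithmic word size is sufficient. -/
theorem width_sufficient {N n w : ℕ} (hN : 3 ≤ N) (hn : n ≤ N) (h : N ^ 26 ≤ 2 ^ w) :
    5 * N + 32 ≤ 2 ^ w ∧ 6 * n.size + 24 ≤ w := by
  constructor
  · refine le_trans ?_ h
    calc 5 * N + 32 ≤ 27 * N := by omega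
      _ = 3 ^ 3 * N := by norm_num
      _ ≤ N ^ 3 * N := by gcongr
      _ = N ^ 4 := by ring
      _ ≤ N ^ 26 := Nat.pow_le_pow_right (by omega) (by norm_num)
  · have h1 : 2 ^ n.size ≤ 2 * N := by
      rcases Nat.eq_zero_or_pos n with rfl | hpos
      · simp; omega
      · have h2 : 0 < n.size := Nat.size_pos.2 hpos
        have h3 : 2 ^ (n.size - 1) ≤ n := Nat.lt_size.1 (by omega)
        calc 2 ^ n.size = 2 * 2 ^ (n.size - 1) := by rw [← pow_succ']; congr 1; omega
          _ ≤ 2 * N := by omega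
    refine (Nat.pow_le_pow_iff_right one_lt_two).1 (le_trans ?_ h)
    -- The exponent 26 is 6 for the vertex count and 20 to absorb the constant, as 2^30 ≤ 3^20 and N
    -- ≥ 3.
    calc 2 ^ (6 * n.size + 24) = (2 ^ n.size) ^ 6 * 2 ^ 24 := by
          rw [pow_add, ← pow_mul, Nat.mul_comm 6]
      _ ≤ (2 * N) ^ 6 * 2 ^ 24 := by gcongr
      _ = N ^ 6 * 2 ^ 30 := by ring
      _ ≤ N ^ 6 * 3 ^ 20 := Nat.mul_le_mul_left _ (by norm_num)
      _ ≤ N ^ 6 * N ^ 20 := by gcongr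
      _ = N ^ 26 := by ring

theorem initial_holds (P : Prog) (us vs : List ℕ) (ε : ℚ) :
    Holds (initial P us vs ε).mem 0 (us ++ vs) := by
  intro i hi
  have hi' : i < us.length + vs.length := by simpa using hi
  have h : (inputArray us vs ε)[0 + i]? = some (us ++ vs)[i] := by
    rw [inputArray, List.append_assoc, Nat.zero_add, List.getElem?_append_left hi,
      List.getElem?_eq_getElem hi]
  simp only [initial, List.getD_eq_getElem?_getD, h, Option.getD_some]

end Input

/-! ### From good levels to the answer -/

namespace Setting

variable {S : Setting} {e : Env} {est : ℕ → ℕ}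

/-- Without edges there is no m with 2^m ≤ e(G), so this case is separate. It needs no randomness:
nothing is ever found, and every estimate is 0. -/
theorem Valid.lastAccepted_eq_zero (hS : S.Valid e) (hE : S.G.edgeCount = 0)
    (hest : ∀ g < 2 * S.len, (∀ j < S.len, S.hitsAt g j ≤ S.bud) → est g = S.estimate g) :
    lastAccepted est (2 * S.len) = 0 := by
  have hdeg : ∀ u ∈ S.G.U, S.G.deg u = 0 :=
    Finset.sum_eq_zero_iff.1 ((BipGraph.sum_deg (G := S.G)).trans hE)
  refine WordRAM.lastAccepted_eq_zero fun g hg => ?_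
  rw [hest g hg fun j _ => (hS.hitsAt_le g j).trans ?_,
    hS.estimate_eq g fun u hu hd => absurd (hdeg u hu) hd]
  · exact Finset.sum_eq_zero fun u hu => by rw [hdeg u hu, Nat.zero_mul, ite_self]
  · exact ((Finset.card_filter_le _ _).trans hE.le).trans (Nat.zero_le _)

theorem Valid.lastAccepted_accurate (hS : S.Valid e) {t m : ℕ} (hkap : S.kap = 2 * t + 11)
    (ht : 1 ≤ t) (hm : 2 ^ m ≤ S.G.edgeCount) (hm' : S.G.edgeCount < 2 ^ (m + 1))
    (hmlen : m < 2 * S.len) (hgood : Good S.G S.lv S.len t S.lam S.bud m)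
    (hest : ∀ g < 2 * S.len, (∀ j < S.len, S.hitsAt g j ≤ S.bud) → est g = S.estimate g) :
    |(lastAccepted est (2 * S.len) : ℝ) - S.G.edgeCount| * 2 ^ t ≤ S.G.edgeCount ∧
      (S.len ≤ t → lastAccepted est (2 * S.len) = S.G.edgeCount) := by
  obtain ⟨g, hg, h1, h2⟩ := hgood.accurate (est := est) ht hm hm' hmlen fun g hmg hg => by
    rw [hest g hg fun j hj => (hS.hitsAt_le g j).trans ?_, hS.estimate_eq g hgood.2, hkap]
    rw [hkap]
    exact (hgood.1 g hmg hg).2 j hj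
  -- If t reaches `len`, then every guess is below 2 `len` ≤ `kap`, so all of U is sampled and the
  -- error is zero.
  exact ⟨h2, fun hlt => by rw [h1, ideal_eq_edgeCount (by omega)]⟩

end Setting

/-- A relative error of `2 ^ (-t)` with `2 ^ (-t) ≤ ε`, or none at all, is allowed. -/
theorem mem_of_abs_sub_mul_le {x E s l : ℕ} {ε : ℚ} (h0 : 0 < ε) (hs : (1 : ℝ) ≤ ε * 2 ^ s)
    (h : |(x : ℝ) - E| * 2 ^ min s l ≤ E) (h' : l ≤ min s l → x = E) :
    (1 - ε) * (E : ℚ) ≤ x ∧ (x : ℚ) ≤ (1 + ε) * E := by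
  have hε : (0 : ℝ) < ε := by exact_mod_cast h0
  have habs : |(x : ℝ) - E| ≤ ε * E := by
    rcases le_total s l with hsl | hls
    · rw [min_eq_left hsl] at h
      calc |(x : ℝ) - E| ≤ |(x : ℝ) - E| * (ε * 2 ^ s) := le_mul_of_one_le_right (abs_nonneg _) hs
        _ = ε * (|(x : ℝ) - E| * 2 ^ s) := by ring
        _ ≤ ε * E := mul_le_mul_of_nonneg_left h hε.le
    · rw [h' (le_min hls le_rfl), sub_self, abs_zero]
      positivity
  obtain ⟨h1, h2⟩ := abs_le.1 habs
  constructor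
  · have : (1 - (ε : ℝ)) * E ≤ x := by linarith
    exact_mod_cast this
  · have : (x : ℝ) ≤ (1 + ε) * E := by linarith
    exact_mod_cast this

section Main

variable {G : BipGraph} {us vs : List ℕ} {ε : ℚ}

theorem order_eq_length_add_length (hus : us.Nodup) (hvs : vs.Nodup) (hU : us.toFinset = G.U)
    (hV : vs.toFinset = G.V) : G.order = us.length + vs.length := by
  rw [BipGraph.order, Finset.card_union_of_disjoint G.disjoint, ← hU, ← hV,
    List.toFinset_card_of_nodup hus, List.toFinset_card_of_nodup hvs]

/-- This keeps log₂ e(G) below 2 `len`, within the range of guesses. -/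
theorem edgeCount_le_order_sq : G.edgeCount ≤ G.order * G.order :=
  calc G.edgeCount ≤ (G.U ×ˢ G.V).card := Finset.card_le_card G.subset
    _ = G.U.card * G.V.card := Finset.card_product _ _
    _ ≤ G.order * G.order := Nat.mul_le_mul (Finset.card_le_card Finset.subset_union_left)
        (Finset.card_le_card Finset.subset_union_right)

/-- The setting for the input `U`, `V`, `ε`. -/
def Setting.ofEps (G : BipGraph) (us vs : List ℕ) (lv : ℕ → ℕ) (ε : ℚ) : Setting :=
  Setting.ofInput G us vs lv ε.num.natAbs.bits.length ε.den.bits.length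

theorem Setting.ofEps_bud_le {lv : ℕ → ℕ} :
    (Setting.ofEps G us vs lv ε).bud ≤ 2 ^ 18 * ((us.length + vs.length).size + 4) ^ 2 *
      4 ^ min (ε.den.bits.length - ε.num.natAbs.bits.length + 1) (us.length + vs.length).size :=
  bud_le_four_pow

theorem Setting.ofEps_totalTime_le {lv : ℕ → ℕ} (h0 : 0 < ε) (h1 : ε < 1) :
    ((Setting.ofEps G us vs lv ε).totalTime : ℝ) ≤
      ((ε : ℝ) ^ 4)⁻¹ * timeBound (us.length + vs.length) := by
  have hε : (0 : ℝ) < ε := by exact_mod_cast h0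
  have hε1 : (ε : ℝ) ≤ 1 := by exact_mod_cast h1.le
  have h := time_le (n := us.length + vs.length)
    (Setting.ofEps_bud_le (G := G) (us := us) (vs := vs) (lv := lv) (ε := ε))
  have h' := four_pow_le h0 h1 (us.length + vs.length).size
  -- The running time grows only like ε^(-2); the allowed ε^(-4) is weaker for ε < 1.
  have h42 : ((ε : ℝ) ^ 2)⁻¹ ≤ ((ε : ℝ) ^ 4)⁻¹ :=
    inv_anti₀ (by positivity) (pow_le_pow_of_le_one hε.le hε1 (by norm_num))
  refine (Nat.cast_le.2 h).trans ?_
  rw [timeBound]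
  simp only [Nat.cast_mul, Nat.cast_add, Nat.cast_pow, Nat.cast_ofNat, Nat.cast_one]
  calc _ ≤ (2 : ℝ) ^ 25 * ((us.length + vs.length).size + 4) ^ 5 * (us.length + vs.length + 1) *
          (16 * ((ε : ℝ) ^ 4)⁻¹) :=
        mul_le_mul_of_nonneg_left (h'.trans (by gcongr)) (by positivity)
    _ = _ := by ring

theorem Setting.ofEps_calls_le {lv : ℕ → ℕ} (h0 : 0 < ε) (h1 : ε < 1) {S : Setting}
    (hS : S = Setting.ofEps G us vs lv ε) :
    ((2 * S.len * (S.len * (S.bud * S.len)) : ℕ) : ℝ) ≤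
      ((ε : ℝ) ^ 2)⁻¹ * callBound (us.length + vs.length) := by
  subst hS
  have h := calls_le (Setting.ofEps_bud_le (G := G) (us := us) (vs := vs) (lv := lv) (ε := ε))
  have h' := four_pow_le h0 h1 (us.length + vs.length).size
  refine (Nat.cast_le.2 h).trans ?_
  rw [callBound]
  simp only [Nat.cast_mul, Nat.cast_add, Nat.cast_pow, Nat.cast_ofNat]
  calc _ ≤ (2 : ℝ) ^ 19 * ((us.length + vs.length).size + 4) ^ 5 * (16 * ((ε : ℝ) ^ 2)⁻¹) :=
        mul_le_mul_of_nonneg_left h' (by positivity)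
    _ = _ := by ring

/-- Along every sequence of coins, the program halts within the bounds, and its output is accurate
if there are no edges or the levels of the vertices are good. -/
theorem mainP_run {w : ℕ} (hus : us.Nodup) (hU : us.toFinset = G.U) (hvs : vs.Nodup)
    (hV : vs.toFinset = G.V) (h0 : 0 < ε) (h1 : ε < 1)
    (hw : (inputArray us vs ε).length ^ 26 ≤ 2 ^ w) (coin : ℕ → Bool) {S : Setting}
    (hS : S = Setting.ofEps G us vs (levelOf us vs coin) ε) :
    ∃ c : Config,
      ((⟨G.adjOracle, G.indepOracle, w, coin⟩ : Env).tick^[S.totalTime]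
        (initial mainP us vs ε, 0)).1 = c ∧
      c.Halted ∧ c.reg 1 = 1 ∧ c.time ≤ S.totalTime ∧
      c.indepCalls ≤ 2 * S.len * (S.len * (S.bud * S.len)) ∧
      ((G.edgeCount = 0 ∨ Good G S.lv S.len
          (min (ε.den.bits.length - ε.num.natAbs.bits.length + 1) S.len) S.lam S.bud
          (Nat.log 2 G.edgeCount)) →
        (1 - ε) * (G.edgeCount : ℚ) ≤ c.output ∧ c.output ≤ (1 + ε) * (G.edgeCount : ℚ)) := by
  have ha := bits_length_pos h0
  have hb := two_le_bits_length h0 h1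
  rw [length_inputArray] at hw
  obtain ⟨hroom, hwidth⟩ := width_sufficient (n := us.length + vs.length) (by omega) (by omega) hw
  have hval : S.Valid ⟨G.adjOracle, G.indepOracle, w, coin⟩ := by
    rw [hS]
    exact Setting.ofInput_valid rfl rfl hus hvs hU hV hroom hwidth
  obtain ⟨σ', t', q', hex, ht, hq, hr1, est, hest, hr0⟩ := mainP_ends
    (e := ⟨G.adjOracle, G.indepOracle, w, coin⟩)
    (σ := ⟨(initial mainP us vs ε).reg, (initial mainP us vs ε).mem, 0⟩) rfl rfl hus hvs hU hV
    rfl rfl rfl rfl rfl (initial_holds mainP us vs ε) (bits_length_le h0 h1) hroom hwidth hS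
  have hG : S.G = G := by rw [hS]; rfl
  have hout : ((⟨[], σ'.reg, σ'.mem, t', q'⟩ : Config).output : ℚ) =
      (lastAccepted est (2 * S.len) : ℕ) := by
    simp only [Config.output, hr1, hr0, Nat.cast_one, div_one]
  refine ⟨⟨[], σ'.reg, σ'.mem, t', q'⟩, congrArg Prod.fst (hex.halts ht), rfl, hr1, ht, hq, ?_⟩
  intro h
  rw [hout]
  by_cases hE : G.edgeCount = 0
  · rw [hval.lastAccepted_eq_zero (by rw [hG, hE]) hest, hE]
    simp
  · have hgood := h.resolve_left hE
    have hm : 2 ^ Nat.log 2 G.edgeCount ≤ G.edgeCount := Nat.pow_log_le_self 2 hE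
    have hm' : G.edgeCount < 2 ^ (Nat.log 2 G.edgeCount + 1) :=
      Nat.lt_pow_succ_log_self one_lt_two _
    have hn : G.order < 2 ^ S.len := by
      rw [order_eq_length_add_length hus hvs hU hV]
      have := hval.n_lt
      rwa [hS] at this ⊢
    -- An edge forces a vertex, so `len` and hence t are positive.
    have hlen : 0 < S.len := by
      rcases Nat.eq_zero_or_pos S.len with h | h
      · rw [h] at hn
        have := edgeCount_le_order_sq (G := G)
        obtain hz : G.order = 0 := by omega
        rw [hz] at this
        omega
      · exact h
    have hmlen : Nat.log 2 G.edgeCount < 2 * S.len := by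
      refine Nat.log_lt_of_lt_pow hE (edgeCount_le_order_sq.trans_lt ?_)
      rw [two_mul, pow_add]
      exact Nat.mul_lt_mul'' hn hn
    rw [← hG] at hgood hm hm'
    have hkap : S.kap = 2 * min (ε.den.bits.length - ε.num.natAbs.bits.length + 1) S.len + 11 := by
      rw [hS]; rfl
    obtain ⟨h2, h3⟩ := hval.lastAccepted_accurate hkap (by omega) hm hm' (by rwa [hG]) hgood hest
    rw [hG] at h2 h3
    exact mem_of_abs_sub_mul_le h0 (one_le_eps_mul_two_pow h0 h1) h2 h3

end Main

end WordRAM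

open WordRAM in
/-- There are one program `P`, one constant `k` for the logarithmic word size, and bounds
`f = Õ(n)` and `h = O((log n) ^ 6)` that serve all inputs: bipartite graphs `G`, arrays `us`, `vs`
that list the vertex classes in any order, rational `0 < ε < 1`, and word sizes `w` of at least
`k * log₂ (input length)` bits in which vertex names fit. Along every sequence of coin tosses `P`
halts within the bounds and returns a fraction; with probability at least `2 / 3` this is a
`(1 ± ε)`-approximation of the number of edges. -/
theorem mainTheorem1 :
    ∃ (P : WordRAM.Prog) (k : ℕ) (f h : ℕ → ℝ),
      1 ≤ k ∧
      IsSoftO f (fun n : ℕ => (n : ℝ)) ∧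
      h =O[atTop] (fun n : ℕ => Real.log n ^ 6) ∧
      ∀ (G : BipGraph) (us vs : List ℕ) (ε : ℚ) (w : ℕ),
        us.Nodup → us.toFinset = G.U →
        vs.Nodup → vs.toFinset = G.V →
        0 < ε → ε < 1 →
        (WordRAM.inputArray us vs ε).length ^ k ≤ 2 ^ w →
        (∀ x ∈ G.U ∪ G.V, x < 2 ^ w) →
        ∃ T : ℕ,
          (∀ c ∈ (WordRAM.run G.adjOracle G.indepOracle w T
              (WordRAM.initial P us vs ε)).support,
            c.Halted ∧
            c.reg 1 ≠ 0 ∧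
            (c.time : ℝ) ≤ ((ε : ℝ) ^ 4)⁻¹ * f G.order ∧
            (c.indepCalls : ℝ) ≤ ((ε : ℝ) ^ 2)⁻¹ * h G.order) ∧
          2 / 3 ≤ (WordRAM.run G.adjOracle G.indepOracle w T
              (WordRAM.initial P us vs ε)).toOuterMeasure
            {c | (1 - ε) * (G.edgeCount : ℚ) ≤ c.output ∧
              c.output ≤ (1 + ε) * (G.edgeCount : ℚ)} := by
  refine ⟨mainP, 26, timeBound, callBound, by norm_num, isSoftO_timeBound, isBigO_callBound, ?_⟩
  intro G us vs ε w hus hU hvs hV h0 h1 hw _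
  have hn := order_eq_length_add_length hus hvs hU hV
  have hrun := fun coin => mainP_run (w := w) hus hU hvs hV h0 h1 hw coin rfl
  obtain ⟨T, hT⟩ : ∃ T, T = (Setting.ofEps G us vs (fun _ => 0) ε).totalTime := ⟨_, rfl⟩
  -- The time bound does not depend on the levels, so one number of steps serves all coin sequences.
  have hTlv : ∀ lv, (Setting.ofEps G us vs lv ε).totalTime = T := fun lv => hT.symm ▸ rfl
  refine ⟨T, ?_, ?_⟩
  · intro c hc
    rw [run_eq_map_tick, PMF.mem_support_map_iff] at hc
    obtain ⟨b, -, rfl⟩ := hc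
    obtain ⟨c, hc, hhalt, hr1, ht, hq, -⟩ := hrun (extend b)
    rw [hTlv] at hc
    rw [hc, hn]
    exact ⟨hhalt, by rw [hr1]; exact one_ne_zero,
      (Nat.cast_le.2 ht).trans (Setting.ofEps_totalTime_le h0 h1),
      (Nat.cast_le.2 hq).trans (Setting.ofEps_calls_le h0 h1 rfl)⟩
  · rw [run_eq_map_tick, PMF.toOuterMeasure_map_apply]
    apply two_thirds_le_toOuterMeasure
    classical
    have hmem : ∀ b : Fin T → Bool, (G.edgeCount = 0 ∨ Good G (levelOf us vs (extend b))
        (us.length + vs.length).size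
        (min (ε.den.bits.length - ε.num.natAbs.bits.length + 1) (us.length + vs.length).size)
        ((us.length + vs.length).size + 4).size
        (Setting.ofEps G us vs (fun _ => 0) ε).bud (Nat.log 2 G.edgeCount)) →
        b ∈ (fun b : Fin T → Bool => ((⟨G.adjOracle, G.indepOracle, w, extend b⟩ : Env).tick^[T]
          (initial mainP us vs ε, 0)).1) ⁻¹' {c | (1 - ε) * (G.edgeCount : ℚ) ≤ c.output ∧
              c.output ≤ (1 + ε) * (G.edgeCount : ℚ)} := by
      intro b hb
      obtain ⟨c, hc, -, -, -, -, hgood⟩ := hrun (extend b)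
      rw [hTlv] at hc
      simp only [Set.mem_preimage, Set.mem_ofPred_eq, hc]
      exact hgood hb
    by_cases hE : G.edgeCount = 0
    · simp only [if_pos (hmem _ (Or.inl hE))]
      rw [Finset.expect_const Finset.univ_nonempty]
      norm_num
    -- The T coins of the run cover the n blocks of 2 `len` coins, because the time bound counts the
    -- tossing.
    · have hlevels := isLevels_levelOf (us := us) (vs := vs) (T := T) (by
        rw [hT]
        have : (us.length + vs.length) * (2 * (us.length + vs.length).size) ≤
            (us.length + vs.length) * (16 * (us.length + vs.length).size + 14) :=
          Nat.mul_le_mul_left _ (by omega)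
        simp only [Setting.totalTime, Setting.ofEps, Setting.ofInput, Setting.n]
        omega)
      rw [List.toFinset_append, hU, hV] at hlevels
      have hlen : 0 < (us.length + vs.length).size := by
        rw [Nat.size_pos, ← hn]
        refine Nat.pos_of_ne_zero fun hz => hE ?_
        have := edgeCount_le_order_sq (G := G)
        rw [hz] at this
        omega
      refine (two_thirds_le_expect_good
        (t := min (ε.den.bits.length - ε.num.natAbs.bits.length + 1) (us.length + vs.length).size)
        hlevels (by rw [hn]; exact Nat.lt_size_self _) hlen
        (Nat.lt_pow_succ_log_self one_lt_two _) (Nat.lt_size_self _).le).trans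
        (Finset.expect_le_expect fun b _ => ?_)
      split_ifs with hg hb
      · exact le_rfl
      · exact absurd (hmem b (Or.inr hg)) hb
      · exact zero_le_one
      · exact le_rfl
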